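/- Let $\mathbb K=\mathbb R$ or $\mathbb C$, let $n\ge 1$ and $m\ge 0$ be integers, let $I\subseteq\mathbb K$ be open, $x_0\in I$, and consider the linear system $$y^{(n)}+B_1(x)\,y^{(n-1)}+\dots+B_n(x)\,y=0,\qquad y=(y_1,\dots,y_m)\in\mathbb K^m,\qquad(1)$$ where $B_1,\dots,B_n$ are $m\times m$ matrices with smooth entries on $I$ (smooth over $\mathbb C$ means holomorphic). All notions below are local, near $x_0$. A normal form of (1) near $x_0$ is a system $w^{(n)}+A_2w^{(n-2)}+\dots+A_nw=0$ with smooth $m\times m$ matrix coefficients and no term of order $n-1$, obtained from (1) near $x_0$ by a change of the dependent variable $y=Q(x)w$ with $Q$ a smooth, pointwise invertible $m\times m$ matrix function. The system (1) belongs to the canonical class near $x_0$ if for some $y_0\in\mathbb K^m$ there is an invertible point transformation $X=X(x,y)$, $Y=Y(x,y)$ (smooth with smooth inverse), defined on a neighbourhood of $(x_0,y_0)$ in $\mathbb K\times\mathbb K^m$, that transforms (1) into the canonical form $d^nY/dX^n=0$. Then (1) has a normal form near $x_0$; and, for every normal form of (1) near $x_0$, the system (1) belongs to the canonical class near $x_0$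 if and only if that normal form consists, near $x_0$, of uncoupled identical iterative equations $$\Psi^n[w_i]=0,\qquad i=1,\dots,m$$ (after division by the leading coefficient $r^n$), where $\Psi=r(x)\frac{d}{dx}+s(x)$ for some smooth scalar functions $r,s$, the same for all $i$, with $r$ nowhere zero and $s=-\tfrac{1}{2}(n-1)\,r'$. -/

import Mathlib

open scoped ContDiff Topology Matrix

namespace LinSys

variable {𝕜 : Type*} [RCLike 𝕜] {m : ℕ}

/-- All entries of the matrix function `Q` are smooth on `V`
(for `𝕜 = ℂ` and `V` open this means holomorphic). -/
def SmoothMatrixOn (Q : 𝕜 → Matrix (Fin m) (Fin m) 𝕜) (V : Set 𝕜) : Prop :=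
  ∀ i j, ContDiffOn 𝕜 ∞ (fun x => Q x i j) V

/-- The coefficients `B 1, …, B n` of an `n`-th order system are smooth on `V`.
Only these values of the sequence `B` are ever used. -/
def SmoothCoeffsOn (n : ℕ) (B : ℕ → 𝕜 → Matrix (Fin m) (Fin m) 𝕜) (V : Set 𝕜) : Prop :=
  ∀ k ∈ Finset.Icc 1 n, SmoothMatrixOn (B k) V

/-- The left-hand side `y⁽ⁿ⁾ + B₁ y⁽ⁿ⁻¹⁾ + ⋯ + Bₙ y` of the linear system with coefficients
`B 1, …, B n`, evaluated at `x`. -/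
noncomputable def sysOp (n : ℕ) (B : ℕ → 𝕜 → Matrix (Fin m) (Fin m) 𝕜)
    (y : 𝕜 → Fin m → 𝕜) (x : 𝕜) : Fin m → 𝕜 :=
  iteratedDeriv n y x + ∑ k ∈ Finset.Icc 1 n, B k x *ᵥ iteratedDeriv (n - k) y x

/-- The equation with coefficients `A` is a normal form, near `x₀`, of the one with coefficients
`B` (given on `I`): the coefficient of order `n - 1` vanishes, and it is obtained
by a smooth invertible change of the dependent variable `y = Q(x) w`. -/
def IsNormalForm (n : ℕ) (B A : ℕ → 𝕜 → Matrix (Fin m) (Fin m) 𝕜) (I : Set 𝕜) (x₀ : 𝕜) : Prop :=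
  ∃ V : Set 𝕜, IsOpen V ∧ x₀ ∈ V ∧ V ⊆ I ∧
    SmoothCoeffsOn n A V ∧ (∀ x ∈ V, A 1 x = 0) ∧
    ∃ Q : 𝕜 → Matrix (Fin m) (Fin m) 𝕜, SmoothMatrixOn Q V ∧ (∀ x ∈ V, IsUnit (Q x)) ∧
      ∀ x ∈ V, ∀ w : 𝕜 → Fin m → 𝕜, ContDiffAt 𝕜 ∞ w x →
        sysOp n B (fun t => Q t *ᵥ w t) x = Q x *ᵥ sysOp n A w x

/-- The point transformation `Φ : (x, y) ↦ (X, Y)` maps the system with coefficients `B` to the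
canonical form `d^n Y / dX^n = 0`. Whenever the image under `Φ` of the graph of
`y` (through the point over `x`) is, with `X(t)` having nonzero derivative at `x`,
the graph of a function `Y` of `X`, the system holds for `y` at `x` if and only if the canonical
equation holds for `Y` at the corresponding point `X(x)`. -/
def MapsToCanonical (n : ℕ) (B : ℕ → 𝕜 → Matrix (Fin m) (Fin m) 𝕜)
    (Φ : OpenPartialHomeomorph (𝕜 × (Fin m → 𝕜)) (𝕜 × (Fin m → 𝕜))) : Prop :=
  ∀ (x : 𝕜) (y Y : 𝕜 → Fin m → 𝕜), ContDiffAt 𝕜 ∞ y x → (x, y x) ∈ Φ.source →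
    deriv (fun t => (Φ (t, y t)).1) x ≠ 0 →
    ContDiffAt 𝕜 ∞ Y (Φ (x, y x)).1 →
    (∀ᶠ t in 𝓝 x, Y (Φ (t, y t)).1 = (Φ (t, y t)).2) →
    (sysOp n B y x = 0 ↔ iteratedDeriv n Y (Φ (x, y x)).1 = 0)

/-- The system with coefficients `B` (given on `I`) belongs to the canonical class near `x₀`:
some smooth, smoothly invertible point transformation `(x, y) ↦ (X(x, y), Y(x, y))`, defined
around a point over `x₀`, maps it to the canonical form. -/
def InCanonicalClass (n : ℕ) (B : ℕ → 𝕜 → Matrix (Fin m) (Fin m) 𝕜) (I : Set 𝕜) (x₀ : 𝕜) :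
    Prop :=
  ∃ (y₀ : Fin m → 𝕜) (Φ : OpenPartialHomeomorph (𝕜 × (Fin m → 𝕜)) (𝕜 × (Fin m → 𝕜))),
    (x₀, y₀) ∈ Φ.source ∧ Φ.source ⊆ I ×ˢ Set.univ ∧
    ContDiffOn 𝕜 ∞ Φ Φ.source ∧ ContDiffOn 𝕜 ∞ Φ.symm Φ.target ∧
    MapsToCanonical n B Φ

/-- The scalar operator `Ψ = r d/dx + s`. Its `n`-th iterate `Ψⁿ` is `(Psi r s)^[n]`. -/
noncomputable def Psi (r s : 𝕜 → 𝕜) (u : 𝕜 → 𝕜) : 𝕜 → 𝕜 :=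
  fun x => r x * deriv u x + s x * u x

/-- Near `x₀` the system with coefficients `A` is `Ψⁿ[w_i] = 0`, `i = 1, …, m`, divided by the
leading coefficient `rⁿ`, with one operator `Ψ = r d/dx + s` for all `i`, where `r` has no zero
and `s = -(n - 1) r' / 2`. -/
def IsUncoupledIterative (n : ℕ) (A : ℕ → 𝕜 → Matrix (Fin m) (Fin m) 𝕜) (x₀ : 𝕜) : Prop :=
  ∃ (V : Set 𝕜) (r s : 𝕜 → 𝕜), IsOpen V ∧ x₀ ∈ V ∧
    ContDiffOn 𝕜 ∞ r V ∧ ContDiffOn 𝕜 ∞ s V ∧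
    (∀ x ∈ V, r x ≠ 0) ∧ (∀ x ∈ V, s x = -(((n : 𝕜) - 1) / 2) * deriv r x) ∧
    ∀ x ∈ V, ∀ w : 𝕜 → Fin m → 𝕜, ContDiffAt 𝕜 ∞ w x →
      ∀ i, (Psi r s)^[n] (fun t => w t i) x = r x ^ n * sysOp n A w x i

end LinSys

namespace LinSys

/-! ### Primitives and linear differential equations over ℝ and ℂ at once. -/

section ODE

variable {𝕜 : Type*} [RCLike 𝕜] {F : Type*} [NormedAddCommGroup F] [NormedSpace 𝕜 F]

/-! Normal form. Solving Q' = -(1/n) B₁ Q with Q(x₀) = 1 removes the term of order n - 1, and Q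
stays invertible near x₀ (`exists_isNormalForm`).

Iterative implies canonical. If r g' = s g, then conjugation by g turns Ψ = r d/dx + s into r d/dx,
and r d/dx is d/dX for X = ∫ dx/r. Hence (x, w) ↦ (X(x), g(x) w) carries the iterative system to
dⁿY/dXⁿ = 0 (`inCanonicalClass_of_isUncoupledIterative`).

Canonical implies iterative. Transported to the normal form, the transformation becomes a map Z with
injective derivative sending solutions to solutions (`Linearizes`). Being a solution at one point
restricts only the n-jet there, so Z may be tested on polynomial curves corrected by a multiple of
(t - x)ⁿ.

For n ≥ 3 the tests are rescaled by t = x + εσ and ε tends to 0. Curves with a large free quadratic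
term show that X does not depend on y (`Linearizes.fst_fderiv_eq_zero`): otherwise the slope dY/dX
would tend to a nonconstant fractional linear function of σ, whose higher X-derivatives do not
vanish. Curves that grow in the y-direction then show that Y is affine in y
(`Linearizes.iteratedDeriv_snd_eq_zero`, `iteratedDeriv_two_eq_zero_of_comp`). Once X = χ(x) and Y =
G(x) y + c(x), the operators (r d/dx)ⁿ ∘ G and rⁿ G ∘ (dⁿ/dxⁿ + ⋯) coincide, with r = 1/χ'.
Comparing coefficients of order n - 1, where A₁ = 0, gives r G' = s G with s = -(n - 1) r'/2. So G
is a scalar function times a constant matrix, and undoing the conjugation yields Ψⁿ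
(`isUncoupledIterative_of_affine`).

For n = 2 projective maps may mix x and y, so the argument is geometric. The flat connection pulled
back by Z has the solutions as its unparametrised geodesics. Zero curvature then forces A₂ to
preserve the kernel condition ℓ(v) = 0 for every functional ℓ (`Linearizes.apply_mulVec_eq_zero`),
so A₂ is a scalar matrix a(x)·1. A zero-free solution u of u'' + a u = 0 gives r = u². For n = 1 the
normal form is w' = 0 and nothing has to be shown. -/

/-- A continuously differentiable function on a disc has a primitive. -/
theorem exists_primitive [CompleteSpace F] {f : 𝕜 → F} {x₀ : 𝕜} {ρ : ℝ}
    (hf : ContDiffOn 𝕜 1 f (Metric.ball x₀ ρ)) :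
    ∃ g : 𝕜 → F, g x₀ = 0 ∧ ∀ x ∈ Metric.ball x₀ ρ, HasDerivAt g (f x) x := by
  let _ : NormedSpace ℝ F := NormedSpace.restrictScalars ℝ 𝕜 F
  have _ : IsScalarTower ℝ 𝕜 F := RestrictScalars.isScalarTower ℝ 𝕜 F
  -- Integration along the segment from x₀ makes sense for both fields; no path independence is
  -- needed.
  refine ⟨fun x => ∫ t in (0 : ℝ)..1, (x - x₀) • f (x₀ + (t : 𝕜) * (x - x₀)), by simp, ?_⟩
  intro x hx
  obtain ⟨R, hxR, hRρ⟩ := exists_between (Metric.mem_ball.1 hx)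
  have hR0 : 0 < R := lt_of_le_of_lt dist_nonneg hxR
  have hsub : Metric.closedBall x₀ R ⊆ Metric.ball x₀ ρ := Metric.closedBall_subset_ball hRρ
  have hd : ∀ z ∈ Metric.ball x₀ ρ, HasDerivAt f (deriv f z) z := fun z hz =>
    ((hf.differentiableOn one_ne_zero).differentiableAt (Metric.isOpen_ball.mem_nhds hz)).hasDerivAt
  have hdc : ContinuousOn (deriv f) (Metric.ball x₀ ρ) :=
    hf.continuousOn_deriv_of_isOpen Metric.isOpen_ball le_rfl
  obtain ⟨C₀, hC₀⟩ := (isCompact_closedBall x₀ R).exists_bound_of_continuousOn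
    (hf.continuousOn.mono hsub)
  obtain ⟨C₁, hC₁⟩ := (isCompact_closedBall x₀ R).exists_bound_of_continuousOn (hdc.mono hsub)
  have hC₁0 : 0 ≤ C₁ := (norm_nonneg _).trans (hC₁ x₀ (Metric.mem_closedBall_self hR0.le))
  have hnt : ∀ t : ℝ, t ∈ Set.Icc (0 : ℝ) 1 → ‖(t : 𝕜)‖ ≤ 1 := fun t ht => by
    rw [RCLike.norm_ofReal, abs_of_nonneg ht.1]; exact ht.2
  have hmem : ∀ z ∈ Metric.ball x₀ R, ∀ t ∈ Set.Icc (0 : ℝ) 1,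
      x₀ + (t : 𝕜) * (z - x₀) ∈ Metric.closedBall x₀ R := by
    intro z hz t ht
    rw [Metric.mem_closedBall, dist_eq_norm, add_sub_cancel_left, norm_mul]
    have h1 := hnt t ht
    have h2 : ‖z - x₀‖ ≤ R := by rw [← dist_eq_norm]; exact (Metric.mem_ball.1 hz).le
    calc _ ≤ 1 * R := mul_le_mul h1 h2 (norm_nonneg _) zero_le_one
      _ = R := one_mul _
  have hcurve : ∀ z : 𝕜, Continuous fun t : ℝ => x₀ + (t : 𝕜) * (z - x₀) := fun z => by
    have := RCLike.continuous_ofReal (K := 𝕜); fun_prop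
  have hfc : ∀ z ∈ Metric.ball x₀ R, ContinuousOn (fun t : ℝ => f (x₀ + (t : 𝕜) * (z - x₀)))
      (Set.Icc 0 1) := fun z hz =>
    (hf.continuousOn.mono hsub).comp (hcurve z).continuousOn fun t ht => hmem z hz t ht
  have hdfc : ∀ z ∈ Metric.ball x₀ R,
      ContinuousOn (fun t : ℝ => deriv f (x₀ + (t : 𝕜) * (z - x₀))) (Set.Icc 0 1) := fun z hz =>
    (hdc.mono hsub).comp (hcurve z).continuousOn fun t ht => hmem z hz t ht
  have hIoc : Set.uIoc (0 : ℝ) 1 ⊆ Set.Icc 0 1 := by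
    rw [Set.uIoc_of_le zero_le_one]; exact Set.Ioc_subset_Icc_self
  have hIcc : Set.uIcc (0 : ℝ) 1 = Set.Icc 0 1 := Set.uIcc_of_le zero_le_one
  let F' : 𝕜 → ℝ → F := fun z t => f (x₀ + (t : 𝕜) * (z - x₀)) +
    (z - x₀) • (t : 𝕜) • deriv f (x₀ + (t : 𝕜) * (z - x₀))
  have hF'c : ∀ z ∈ Metric.ball x₀ R, ContinuousOn (F' z) (Set.Icc 0 1) := fun z hz =>
    (hfc z hz).add ((RCLike.continuous_ofReal.continuousOn.smul (hdfc z hz)).const_smul _)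
  have hxR' : x ∈ Metric.ball x₀ R := Metric.mem_ball.2 hxR
  have key := (intervalIntegral.hasDerivAt_integral_of_dominated_loc_of_deriv_le
    (μ := MeasureTheory.volume) (a := 0) (b := 1) (bound := fun _ => C₀ + R * C₁)
    (F := fun z t => (z - x₀) • f (x₀ + (t : 𝕜) * (z - x₀))) (F' := F')
    (Metric.isOpen_ball.mem_nhds hxR') ?_ ?_ ?_ ?_ ?_ ?_).2
  · convert key using 1
    -- The x-derivative of the integrand equals d/dt of t f(x₀ + t(x - x₀)), so its integral over
    -- [0, 1] is f(x).
    have hF : ∀ t ∈ Set.uIcc (0 : ℝ) 1,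
        HasDerivAt (fun t : ℝ => (t : 𝕜) • f (x₀ + (t : 𝕜) * (x - x₀))) (F' x t) t := by
      intro t ht
      rw [hIcc] at ht
      have h0 : HasDerivAt (fun t : ℝ => (t : 𝕜)) 1 t := by
        simpa using (RCLike.ofRealCLM (K := 𝕜)).hasDerivAt (x := t)
      have h1 : HasDerivAt (fun t : ℝ => x₀ + (t : 𝕜) * (x - x₀)) (x - x₀) t := by
        simpa using (h0.mul_const (x - x₀)).const_add x₀
      have h2 := HasDerivAt.scomp t (hd _ (hsub (hmem x hxR' t ht))) h1
      have h3 := h0.smul h2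
      convert! h3 using 1
      simp only [F', Function.comp, one_smul, smul_smul, mul_comm, add_comm]
    rw [intervalIntegral.integral_eq_sub_of_hasDerivAt hF
      ((hIcc ▸ hF'c x hxR').intervalIntegrable)]
    simp
  · filter_upwards [Metric.isOpen_ball.mem_nhds hxR'] with z hz
    exact (((hfc z hz).const_smul _).mono hIoc).aestronglyMeasurable measurableSet_uIoc
  · exact (hIcc ▸ (hfc x hxR').const_smul (x - x₀)).intervalIntegrable
  · exact ((hF'c x hxR').mono hIoc).aestronglyMeasurable measurableSet_uIoc
  · refine Filter.Eventually.of_forall fun t ht z hz => ?_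
    have ht' := hIoc ht
    have hz' : ‖z - x₀‖ ≤ R := by rw [← dist_eq_norm]; exact (Metric.mem_ball.1 hz).le
    refine (norm_add_le _ _).trans (add_le_add (hC₀ _ (hmem z hz t ht')) ?_)
    rw [norm_smul, norm_smul]
    refine mul_le_mul hz' ?_ (by positivity) hR0.le
    calc _ ≤ 1 * C₁ := mul_le_mul (hnt t ht') (hC₁ _ (hmem z hz t ht')) (norm_nonneg _) zero_le_one
      _ = C₁ := one_mul _
  · exact intervalIntegrable_const
  · refine Filter.Eventually.of_forall fun t ht z hz => ?_
    have h1 : HasDerivAt (fun z : 𝕜 => x₀ + (t : 𝕜) * (z - x₀)) (t : 𝕜) z := by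
      simpa using (((hasDerivAt_id z).sub_const x₀).const_mul (t : 𝕜)).const_add x₀
    have h2 := HasDerivAt.scomp z (hd _ (hsub (hmem z hz t (hIoc ht)))) h1
    have h3 := ((hasDerivAt_id z).sub_const x₀).smul h2
    convert! h3 using 1
    simp only [F', Function.comp, one_smul, id, add_comm]

/-- Solutions of linear equations with smooth coefficients are smooth. -/
theorem contDiffOn_of_hasDerivAt_linear {M : 𝕜 → F →L[𝕜] F} {V : Set 𝕜} (hV : IsOpen V)
    (hM : ContDiffOn 𝕜 ∞ M V) {y : 𝕜 → F} (hy : ∀ x ∈ V, HasDerivAt y (M x (y x)) x) :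
    ContDiffOn 𝕜 ∞ y V := by
  refine contDiffOn_infty.2 fun k => ?_
  induction k with
  | zero => exact contDiffOn_zero.2 fun x hx => (hy x hx).continuousAt.continuousWithinAt
  | succ k ih =>
    push_cast
    rw [contDiffOn_succ_iff_deriv_of_isOpen hV]
    refine ⟨fun x hx => (hy x hx).differentiableAt.differentiableWithinAt, by simp, ?_⟩
    have hM' : ContDiffOn 𝕜 k M V := hM.of_le (by exact_mod_cast le_top)
    exact (hM'.clm_apply ih).congr fun x hx => (hy x hx).deriv

/-- Local existence for linear equations `y' = M(x) y`. -/
theorem exists_linear_ode [CompleteSpace F] {M : 𝕜 → F →L[𝕜] F} {V : Set 𝕜} (hV : IsOpen V)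
    (hM : ContDiffOn 𝕜 ∞ M V) {x₀ : 𝕜} (hx₀ : x₀ ∈ V) (v : F) :
    ∃ ρ > 0, Metric.ball x₀ ρ ⊆ V ∧ ∃ y : 𝕜 → F, y x₀ = v ∧
      ContDiffOn 𝕜 ∞ y (Metric.ball x₀ ρ) ∧
      ∀ x ∈ Metric.ball x₀ ρ, HasDerivAt y (M x (y x)) x := by
  obtain ⟨R, hR, hRV⟩ := Metric.nhds_basis_closedBall.mem_iff.1 (hV.mem_nhds hx₀)
  obtain ⟨K, hK⟩ := (isCompact_closedBall x₀ R).exists_bound_of_continuousOn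
    (hM.continuousOn.mono hRV)
  have hK0 : 0 ≤ K := (norm_nonneg _).trans (hK x₀ (Metric.mem_closedBall_self hR.le))
  -- The radius gives Kρ ≤ 1/2, so that each Picard increment is at most half the bound of the
  -- previous one.
  set ρ := min R (1 / (2 * (K + 1))) with hρ
  have hρ0 : 0 < ρ := lt_min hR (by positivity)
  have hKρ : K * ρ ≤ 1 / 2 := by
    have h1 : ρ ≤ 1 / (2 * (K + 1)) := min_le_right _ _
    have h2 : (K + 1) * (1 / (2 * (K + 1))) = 1 / 2 := by field_simp
    nlinarith
  have hball : Metric.ball x₀ ρ ⊆ Metric.closedBall x₀ R := fun z hz =>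
    Metric.mem_closedBall.2 ((Metric.mem_ball.1 hz).le.trans (min_le_left _ _))
  have hbV : Metric.ball x₀ ρ ⊆ V := hball.trans hRV
  have hMb := hM.mono hbV
  -- The primitive is made a total operation, so the recursion can be defined before its terms are
  -- known to be smooth.
  have hP : ∀ f : 𝕜 → F, ∃ g : 𝕜 → F, ContDiffOn 𝕜 1 f (Metric.ball x₀ ρ) →
      g x₀ = 0 ∧ ∀ x ∈ Metric.ball x₀ ρ, HasDerivAt g (f x) x := fun f => by
    by_cases h : ContDiffOn 𝕜 1 f (Metric.ball x₀ ρ)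
    · obtain ⟨g, hg⟩ := exists_primitive h
      exact ⟨g, fun _ => hg⟩
    · exact ⟨0, fun h' => absurd h' h⟩
  choose P hP using hP
  -- Picard increments: d₀ = v and dₖ₊₁ = ∫ M dₖ. The solution is their sum, differentiated term by
  -- term.
  let d : ℕ → 𝕜 → F := fun k => Nat.rec (fun _ => v) (fun _ u => P fun x => M x (u x)) k
  have hd0 : d 0 = fun _ => v := rfl
  have hds : ∀ k, d (k + 1) = P fun x => M x (d k x) := fun k => rfl
  have hone : (1 : ℕ∞ω) ≤ ∞ := by exact_mod_cast le_top
  have hdsm : ∀ k, ContDiffOn 𝕜 ∞ (d k) (Metric.ball x₀ ρ) := fun k => by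
    induction k with
    | zero => exact contDiffOn_const
    | succ k ih =>
      have h1 := hMb.clm_apply ih
      have h2 := (hP _ (h1.of_le hone)).2
      rw [hds, contDiffOn_infty_iff_deriv_of_isOpen Metric.isOpen_ball]
      exact ⟨fun x hx => (h2 x hx).differentiableAt.differentiableWithinAt,
        h1.congr fun x hx => (h2 x hx).deriv⟩
  have hdd : ∀ k, d (k + 1) x₀ = 0 ∧
      ∀ x ∈ Metric.ball x₀ ρ, HasDerivAt (d (k + 1)) (M x (d k x)) x := fun k =>
    hP _ ((hMb.clm_apply (hdsm k)).of_le hone)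
  have hbound : ∀ k, ∀ x ∈ Metric.ball x₀ ρ, ‖d k x‖ ≤ ‖v‖ * (1 / 2) ^ k := fun k => by
    induction k with
    | zero => intro x _; simp [hd0]
    | succ k ih =>
      intro x hx
      have h1 := Convex.norm_image_sub_le_of_norm_hasDerivWithin_le
        (C := K * (‖v‖ * (1 / 2) ^ k)) (fun z hz => ((hdd k).2 z hz).hasDerivWithinAt)
        (fun z hz => ((M z).le_opNorm _).trans
          (mul_le_mul (hK z (hball hz)) (ih z hz) (norm_nonneg _) hK0))
        (convex_ball x₀ ρ) (Metric.mem_ball_self hρ0) hx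
      rw [(hdd k).1, sub_zero] at h1
      have h2 : ‖x - x₀‖ ≤ ρ := by rw [← dist_eq_norm]; exact (Metric.mem_ball.1 hx).le
      have h3 : 0 ≤ ‖v‖ * (1 / 2) ^ k := by positivity
      calc _ ≤ _ := h1
        _ ≤ K * (‖v‖ * (1 / 2) ^ k) * ρ := by gcongr
        _ = (K * ρ) * (‖v‖ * (1 / 2) ^ k) := by ring
        _ ≤ 1 / 2 * (‖v‖ * (1 / 2) ^ k) := by gcongr
        _ = _ := by ring
  have hgeom : Summable fun k : ℕ => ‖v‖ * (1 / 2 : ℝ) ^ k :=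
    (summable_geometric_of_lt_one (by norm_num) (by norm_num)).mul_left _
  have hsum : ∀ x ∈ Metric.ball x₀ ρ, Summable fun k => d k x := fun x hx =>
    Summable.of_norm_bounded hgeom fun k => hbound k x hx
  let d' : ℕ → 𝕜 → F := fun k x => Nat.casesOn k 0 (fun k => M x (d k x))
  have hd' : ∀ k, ∀ x ∈ Metric.ball x₀ ρ, HasDerivAt (d k) (d' k x) x := fun k x hx => by
    cases k with
    | zero => exact hasDerivAt_const x v
    | succ k => exact (hdd k).2 x hx
  -- The factor 2 pays for the index shift: the derivative of dₖ₊₁ is M dₖ.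
  have hd'b : ∀ k, ∀ x ∈ Metric.ball x₀ ρ, ‖d' k x‖ ≤ (2 * K) * (‖v‖ * (1 / 2) ^ k) :=
    fun k x hx => by
      cases k with
      | zero =>
        have : (0 : ℝ) ≤ (2 * K) * (‖v‖ * (1 / 2) ^ 0) := by positivity
        simpa [d'] using this
      | succ k =>
        calc ‖M x (d k x)‖ ≤ K * (‖v‖ * (1 / 2) ^ k) := ((M x).le_opNorm _).trans
              (mul_le_mul (hK x (hball hx)) (hbound k x hx) (norm_nonneg _) hK0)
          _ = _ := by ring
  have hder : ∀ x ∈ Metric.ball x₀ ρ, HasDerivAt (fun z => ∑' k, d k z) (M x (∑' k, d k x)) x := by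
    intro x hx
    have h1 := hasDerivAt_tsum_of_isPreconnected (hgeom.mul_left (2 * K)) Metric.isOpen_ball
      (convex_ball x₀ ρ).isPreconnected hd' hd'b (Metric.mem_ball_self hρ0)
      (hsum x₀ (Metric.mem_ball_self hρ0)) hx
    convert h1 using 1
    have hs' : Summable fun k => d' k x :=
      Summable.of_norm_bounded (hgeom.mul_left (2 * K)) fun k => hd'b k x hx
    rw [hs'.tsum_eq_zero_add, (M x).map_tsum (hsum x hx)]
    simp [d']
  refine ⟨ρ, hρ0, hbV, fun z => ∑' k, d k z, ?_, contDiffOn_of_hasDerivAt_linear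
    Metric.isOpen_ball hMb hder, hder⟩
  change ∑' k, d k x₀ = v
  rw [(hsum x₀ (Metric.mem_ball_self hρ0)).tsum_eq_zero_add]
  simp [fun k => (hdd k).1, hd0]

end ODE

/-! ### Iterates of r d/dx + s. -/

section Operators

variable {𝕜 : Type*} [RCLike 𝕜] {F : Type*} [NormedAddCommGroup F] [NormedSpace 𝕜 F]
  {G : Type*} [NormedAddCommGroup G] [NormedSpace 𝕜 G]

theorem infty_ne_zero : (∞ : ℕ∞ω) ≠ 0 := by simp

theorem one_le_infty : (1 : ℕ∞ω) ≤ ∞ := by exact_mod_cast le_top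

theorem _root_.ContDiffAt.deriv_infty {f : 𝕜 → F} {x : 𝕜} (hf : ContDiffAt 𝕜 ∞ f x) :
    ContDiffAt 𝕜 ∞ (deriv f) x := by
  have h := (hf.fderiv_right (m := ∞) (by simp)).clm_apply (contDiffAt_const (c := (1 : 𝕜)))
  exact h

theorem _root_.ContDiffAt.iteratedDeriv_infty {f : 𝕜 → F} {x : 𝕜} (hf : ContDiffAt 𝕜 ∞ f x)
    (n : ℕ) : ContDiffAt 𝕜 ∞ (iteratedDeriv n f) x := by
  induction n with
  | zero => simpa using hf
  | succ n ih => rw [iteratedDeriv_succ]; exact ih.deriv_infty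

theorem _root_.ContDiffAt.eventually_differentiableAt {E : Type*} [NormedAddCommGroup E]
    [NormedSpace 𝕜 E] {f : E → F} {x : E} (hf : ContDiffAt 𝕜 ∞ f x) :
    ∀ᶠ t in 𝓝 x, DifferentiableAt 𝕜 f t :=
  ((hf.of_le one_le_infty).eventually (by simp)).mono fun _ h => h.differentiableAt one_ne_zero

/-- The operator `r d/dx + s` on vector-valued functions. -/
noncomputable def PsiV (r s : 𝕜 → 𝕜) (f : 𝕜 → F) : 𝕜 → F :=
  fun x => r x • deriv f x + s x • f x

theorem PsiV_congr {r r' s s' : 𝕜 → 𝕜} {f f' : 𝕜 → F} {x : 𝕜} (hr : r =ᶠ[𝓝 x] r')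
    (hs : s =ᶠ[𝓝 x] s') (hf : f =ᶠ[𝓝 x] f') : PsiV r s f =ᶠ[𝓝 x] PsiV r' s' f' := by
  filter_upwards [hr, hs, hf, hf.deriv] with t h1 h2 h3 h4
  simp only [PsiV, h1, h2, h3, h4]

theorem PsiV_iterate_congr {r r' s s' : 𝕜 → 𝕜} {f f' : 𝕜 → F} {x : 𝕜} (hr : r =ᶠ[𝓝 x] r')
    (hs : s =ᶠ[𝓝 x] s') (hf : f =ᶠ[𝓝 x] f') (n : ℕ) :
    (PsiV r s)^[n] f =ᶠ[𝓝 x] (PsiV r' s')^[n] f' := by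
  induction n with
  | zero => exact hf
  | succ n ih => rw [Function.iterate_succ_apply', Function.iterate_succ_apply']
                 exact PsiV_congr hr hs ih

theorem _root_.ContDiffAt.PsiV {r s : 𝕜 → 𝕜} {f : 𝕜 → F} {x : 𝕜} (hr : ContDiffAt 𝕜 ∞ r x)
    (hs : ContDiffAt 𝕜 ∞ s x) (hf : ContDiffAt 𝕜 ∞ f x) : ContDiffAt 𝕜 ∞ (PsiV r s f) x :=
  (hr.smul hf.deriv_infty).add (hs.smul hf)

theorem _root_.ContDiffAt.PsiV_iterate {r s : 𝕜 → 𝕜} {f : 𝕜 → F} {x : 𝕜}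
    (hr : ContDiffAt 𝕜 ∞ r x) (hs : ContDiffAt 𝕜 ∞ s x) (hf : ContDiffAt 𝕜 ∞ f x) (n : ℕ) :
    ContDiffAt 𝕜 ∞ ((LinSys.PsiV r s)^[n] f) x := by
  induction n with
  | zero => exact hf
  | succ n ih => rw [Function.iterate_succ_apply']; exact hr.PsiV hs ih

/-- A constant linear map commutes with scalar differential operators. This gives components,
additivity and the removal of constant matrices. -/
theorem PsiV_iterate_clm {r s : 𝕜 → 𝕜} {f : 𝕜 → F} {x : 𝕜} (L : F →L[𝕜] G)
    (hr : ContDiffAt 𝕜 ∞ r x) (hs : ContDiffAt 𝕜 ∞ s x) (hf : ContDiffAt 𝕜 ∞ f x) (n : ℕ) :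
    (PsiV r s)^[n] (fun t => L (f t)) =ᶠ[𝓝 x] fun t => L ((PsiV r s)^[n] f t) := by
  induction n with
  | zero => rfl
  | succ n ih =>
    simp only [Function.iterate_succ_apply']
    refine (PsiV_congr .rfl .rfl ih).trans ?_
    filter_upwards [(hr.PsiV_iterate hs hf n).eventually_differentiableAt] with t ht
    simp only [PsiV, map_add, map_smul]
    have h : deriv (fun t => L ((PsiV r s)^[n] f t)) t = _ :=
      (L.hasFDerivAt.comp_hasDerivAt t ht.hasDerivAt).deriv
    rw [h]

theorem PsiV_iterate_add {r s : 𝕜 → 𝕜} {f g : 𝕜 → F} {x : 𝕜}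
    (hr : ContDiffAt 𝕜 ∞ r x) (hs : ContDiffAt 𝕜 ∞ s x) (hf : ContDiffAt 𝕜 ∞ f x)
    (hg : ContDiffAt 𝕜 ∞ g x) (n : ℕ) :
    (PsiV r s)^[n] (f + g) =ᶠ[𝓝 x] (PsiV r s)^[n] f + (PsiV r s)^[n] g := by
  -- Addition is the linear map `fst + snd` applied to the pair (f, g).
  have h := hf.prodMk hg
  filter_upwards [PsiV_iterate_clm (ContinuousLinearMap.fst 𝕜 F F) hr hs h n,
    PsiV_iterate_clm (ContinuousLinearMap.snd 𝕜 F F) hr hs h n,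
    PsiV_iterate_clm (ContinuousLinearMap.fst 𝕜 F F + ContinuousLinearMap.snd 𝕜 F F) hr hs h n]
    with t h1 h2 h3
  simp only [add_apply, ContinuousLinearMap.coe_fst',
    ContinuousLinearMap.coe_snd'] at h1 h2 h3
  rw [Pi.add_apply, h1, h2, ← h3]
  rfl

/-- By the product rule r (g f)' = g (r f' + s f) when r g' = s g: conjugation by g absorbs the
zeroth-order term of Ψ. -/
theorem PsiV_iterate_smul {r s g : 𝕜 → 𝕜} {f : 𝕜 → F} {x : 𝕜}
    (hr : ContDiffAt 𝕜 ∞ r x) (hs : ContDiffAt 𝕜 ∞ s x) (hf : ContDiffAt 𝕜 ∞ f x)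
    (hg : ContDiffAt 𝕜 ∞ g x) (h : ∀ᶠ t in 𝓝 x, r t * deriv g t = s t * g t) (n : ℕ) :
    (PsiV r 0)^[n] (fun t => g t • f t) =ᶠ[𝓝 x] fun t => g t • (PsiV r s)^[n] f t := by
  induction n with
  | zero => rfl
  | succ n ih =>
    simp only [Function.iterate_succ_apply']
    refine (PsiV_congr .rfl .rfl ih).trans ?_
    filter_upwards [(hr.PsiV_iterate hs hf n).eventually_differentiableAt,
      hg.eventually_differentiableAt, h] with t ht hgt h
    simp only [PsiV, Pi.zero_apply, zero_smul, add_zero]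
    have h' : deriv (fun t => g t • (PsiV r s)^[n] f t) t = _ :=
      (hgt.hasDerivAt.smul ht.hasDerivAt).deriv
    rw [h']
    simp only [smul_add, smul_smul, h, mul_comm]

/-- Differentiation with respect to a new independent variable `X`. -/
theorem iteratedDeriv_comp_eventuallyEq {X : 𝕜 → 𝕜} {Y f : 𝕜 → F} {x : 𝕜}
    (hX : ContDiffAt 𝕜 ∞ X x) (hX' : deriv X x ≠ 0) (hY : ContDiffAt 𝕜 ∞ Y (X x))
    (h : ∀ᶠ t in 𝓝 x, Y (X t) = f t) (n : ℕ) :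
    (fun t => iteratedDeriv n Y (X t)) =ᶠ[𝓝 x] (PsiV (fun t => (deriv X t)⁻¹) 0)^[n] f := by
  induction n with
  | zero => simpa using! h
  | succ n ih =>
    simp only [Function.iterate_succ_apply']
    refine .trans ?_ (PsiV_congr .rfl .rfl ih)
    filter_upwards [hX.eventually_differentiableAt,
      hX.continuousAt.eventually (hY.iteratedDeriv_infty n).eventually_differentiableAt,
      hX.deriv_infty.continuousAt.eventually_ne hX'] with t h1 h2 h3
    simp only [PsiV, Pi.zero_apply, zero_smul, add_zero]
    have h' : deriv (fun t => iteratedDeriv n Y (X t)) t = _ :=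
      (HasDerivAt.scomp t h2.hasDerivAt h1.hasDerivAt).deriv
    rw [h', smul_smul, inv_mul_cancel₀ h3,
      one_smul, iteratedDeriv_succ]

theorem PsiV_iterate_const (c : 𝕜) (f : 𝕜 → F) {x : 𝕜} (hf : ContDiffAt 𝕜 ∞ f x) (n : ℕ) :
    (PsiV (fun _ => c) 0)^[n] f =ᶠ[𝓝 x] fun t => c ^ n • iteratedDeriv n f t := by
  induction n with
  | zero => simp
  | succ n ih =>
    simp only [Function.iterate_succ_apply']
    refine (PsiV_congr .rfl .rfl ih).trans ?_
    filter_upwards [(hf.iteratedDeriv_infty n).eventually_differentiableAt] with t ht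
    simp only [PsiV, Pi.zero_apply, zero_smul, add_zero]
    have h' : deriv (fun t => c ^ n • iteratedDeriv n f t) t = _ :=
      (ht.hasDerivAt.const_smul (c ^ n)).deriv
    rw [h',
      smul_smul, ← pow_succ', iteratedDeriv_succ]

/-- Affine substitution of the independent variable. -/
theorem PsiV_iterate_comp_affine (ρ : 𝕜 → 𝕜) (f : 𝕜 → F) (x : 𝕜) (ε : 𝕜) (n : ℕ)
    (σ : 𝕜) : (PsiV (fun σ => ρ (x + ε * σ)) 0)^[n] (fun σ => f (x + ε * σ)) σ =
      ε ^ n • (PsiV ρ 0)^[n] f (x + ε * σ) := by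
  induction n generalizing σ with
  | zero => simp
  | succ n ih =>
    simp only [Function.iterate_succ_apply']
    rw [PsiV, funext ih]
    simp only [Pi.zero_apply, zero_smul, add_zero, PsiV]
    rw [show (fun σ => ε ^ n • (PsiV ρ 0)^[n] f (x + ε * σ)) =
      ε ^ n • fun σ => (PsiV ρ 0)^[n] f (x + ε * σ) from rfl, deriv_const_smul_field,
      deriv_comp_mul_left ε (fun σ => (PsiV ρ 0)^[n] f (x + σ)), deriv_comp_const_add,
      smul_smul, smul_smul, smul_smul]
    congr 1
    ring

/-- One application lowers the power of t - x by one and changes the smooth factor. This drives the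
inductions that read off the two top coefficients of (r d/dt)ⁿ. -/
theorem PsiV_pow_succ_smul (r : 𝕜 → 𝕜) {f : 𝕜 → F} {x : 𝕜} (hf : ContDiffAt 𝕜 ∞ f x) (n : ℕ) :
    PsiV r 0 (fun t => (t - x) ^ (n + 1) • f t) =ᶠ[𝓝 x] fun t => (t - x) ^ n •
      (((n + 1 : 𝕜) * r t) • f t + ((t - x) * r t) • deriv f t) := by
  filter_upwards [hf.eventually_differentiableAt] with t ht
  have h2 : HasDerivAt (fun t => (t - x) ^ (n + 1)) ((n + 1 : 𝕜) * (t - x) ^ n) t := by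
    simpa using! ((hasDerivAt_id t).sub_const x).pow (n + 1)
  simp only [PsiV, Pi.zero_apply, zero_smul, add_zero]
  have h3 : deriv (fun t => (t - x) ^ (n + 1) • f t) t = _ := (h2.smul ht.hasDerivAt).deriv
  rw [h3]
  module

theorem contDiffAt_pow_smul_aux {r : 𝕜 → 𝕜} {f : 𝕜 → F} {x : 𝕜} (hr : ContDiffAt 𝕜 ∞ r x)
    (hf : ContDiffAt 𝕜 ∞ f x) (n : ℕ) : ContDiffAt 𝕜 ∞
      (fun t => ((n + 1 : 𝕜) * r t) • f t + ((t - x) * r t) • deriv f t) x :=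
  ((contDiffAt_const.mul hr).smul hf).add
    (((contDiffAt_id.sub contDiffAt_const).mul hr).smul hf.deriv_infty)

/-- Value at `x` of `(r d/dt)ⁿ` on `(t - x)ⁿ f(t)`. -/
theorem PsiV_iterate_pow_smul {r : 𝕜 → 𝕜} {f : 𝕜 → F} {x : 𝕜} (hr : ContDiffAt 𝕜 ∞ r x)
    (hf : ContDiffAt 𝕜 ∞ f x) (n : ℕ) :
    (PsiV r 0)^[n] (fun t => (t - x) ^ n • f t) x = ((n.factorial : 𝕜) * r x ^ n) • f x := by
  induction n generalizing f with
  | zero => simp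
  | succ n ih =>
    rw [Function.iterate_succ_apply]
    have hf' := contDiffAt_pow_smul_aux hr hf n
    rw [(PsiV_iterate_congr .rfl .rfl (PsiV_pow_succ_smul r hf n) n).eq_of_nhds, ih hf',
      Nat.factorial_succ]
    simp only [sub_self, zero_mul, zero_smul, add_zero, smul_smul]
    congr 1
    push_cast
    ring

/-- Value at `x` of `(r d/dt)ⁿ⁺¹` on `(t - x)ⁿ f(t)`. -/
theorem PsiV_iterate_succ_pow_smul {r : 𝕜 → 𝕜} {f : 𝕜 → F} {x : 𝕜} (hr : ContDiffAt 𝕜 ∞ r x)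
    (hf : ContDiffAt 𝕜 ∞ f x) (n : ℕ) :
    (PsiV r 0)^[n + 1] (fun t => (t - x) ^ n • f t) x = ((n + 1).factorial * r x ^ n : 𝕜) •
      (r x • deriv f x + (n / 2 * deriv r x) • f x) := by
  induction n generalizing f with
  | zero => simp [PsiV]
  | succ n ih =>
    rw [Function.iterate_succ_apply]
    have hf' := contDiffAt_pow_smul_aux hr hf n
    rw [(PsiV_iterate_congr .rfl .rfl (PsiV_pow_succ_smul r hf n) (n + 1)).eq_of_nhds,
      ih hf']
    have hr1 := (hr.differentiableAt infty_ne_zero).hasDerivAt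
    have hf1 := (hf.differentiableAt infty_ne_zero).hasDerivAt
    have hf2 := (hf.deriv_infty.differentiableAt infty_ne_zero).hasDerivAt
    have h3 : HasDerivAt (fun t => ((n + 1 : 𝕜) * r t) • f t + ((t - x) * r t) • deriv f t)
        _ x := ((hr1.const_mul (n + 1 : 𝕜)).smul hf1).add
          ((((hasDerivAt_id x).sub_const x).mul hr1).smul hf2)
    -- The new factor has derivative (n + 1) r' f + (n + 2) r f' at x. With the term (n/2) r' · (n +
    -- 1) r f the sum is (n + 2) r (r f' + ((n + 1)/2) r' f).
    rw [h3.deriv, Nat.factorial_succ (n + 1)]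
    simp only [sub_self, zero_mul, zero_smul, add_zero, id, one_mul, Pi.mul_apply]
    push_cast
    module

end Operators

/-! ### The system operator and its values on test functions. -/

section Systems

variable {𝕜 : Type*} [RCLike 𝕜] {m : ℕ}

/-- A matrix as a continuous linear map. -/
noncomputable def clm (M : Matrix (Fin m) (Fin m) 𝕜) : (Fin m → 𝕜) →L[𝕜] (Fin m → 𝕜) :=
  LinearMap.toContinuousLinearMap M.mulVecLin

@[simp] theorem clm_apply (M : Matrix (Fin m) (Fin m) 𝕜) (v : Fin m → 𝕜) :
    clm M v = M *ᵥ v := rfl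

theorem clm_mul (M N : Matrix (Fin m) (Fin m) 𝕜) : clm (M * N) = clm M * clm N := by
  ext v : 1; simp

theorem clm_one : clm (1 : Matrix (Fin m) (Fin m) 𝕜) = 1 := by
  ext v : 1; simp

theorem smoothMatrixOn_iff {Q : 𝕜 → Matrix (Fin m) (Fin m) 𝕜} {V : Set 𝕜} :
    SmoothMatrixOn Q V ↔ ContDiffOn 𝕜 ∞ (fun x => clm (Q x)) V := by
  rw [contDiffOn_clm_apply]
  constructor
  · intro h v
    rw [contDiffOn_pi]
    intro i
    simp only [clm_apply, Matrix.mulVec, dotProduct]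
    exact ContDiffOn.sum fun j _ => (h i j).mul contDiffOn_const
  · intro h i j
    have := contDiffOn_pi.1 (h (Pi.single j 1)) i
    simpa using this

theorem toMatrix'_clm (L : (Fin m → 𝕜) →L[𝕜] (Fin m → 𝕜)) :
    clm (LinearMap.toMatrix' (L : (Fin m → 𝕜) →ₗ[𝕜] (Fin m → 𝕜))) = L := by
  ext v : 1
  simp [LinearMap.toMatrix'_mulVec]

theorem isUnit_clm {M : Matrix (Fin m) (Fin m) 𝕜} (h : IsUnit M) : IsUnit (clm M) := by
  obtain ⟨u, rfl⟩ := h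
  exact ⟨⟨clm u, clm (u⁻¹ : (Matrix (Fin m) (Fin m) 𝕜)ˣ), by rw [← clm_mul]; simp [clm_one],
    by rw [← clm_mul]; simp [clm_one]⟩, rfl⟩

theorem isUnit_of_isUnit_clm {M : Matrix (Fin m) (Fin m) 𝕜} (h : IsUnit (clm M)) : IsUnit M := by
  rw [← Matrix.mulVec_injective_iff_isUnit]
  obtain ⟨u, hu⟩ := h
  intro v w hvw
  have h1 : ∀ z, (u⁻¹ : ((Fin m → 𝕜) →L[𝕜] (Fin m → 𝕜))ˣ).1 (clm M z) = z := fun z => by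
    rw [← hu, ← mul_apply_eq_comp]; simp
  rw [← h1 v, ← h1 w]
  exact congrArg _ hvw

theorem sysOp_congr (n : ℕ) (B : ℕ → 𝕜 → Matrix (Fin m) (Fin m) 𝕜) {y z : 𝕜 → Fin m → 𝕜} {x : 𝕜}
    (h : y =ᶠ[𝓝 x] z) : sysOp n B y x = sysOp n B z x := by
  simp only [sysOp, h.iteratedDeriv_eq]

theorem sysOp_add (n : ℕ) (B : ℕ → 𝕜 → Matrix (Fin m) (Fin m) 𝕜) {y z : 𝕜 → Fin m → 𝕜} {x : 𝕜}
    (hy : ContDiffAt 𝕜 ∞ y x) (hz : ContDiffAt 𝕜 ∞ z x) :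
    sysOp n B (y + z) x = sysOp n B y x + sysOp n B z x := by
  have h : ∀ k : ℕ, iteratedDeriv k (y + z) x = iteratedDeriv k y x + iteratedDeriv k z x :=
    fun k => iteratedDeriv_add (hy.of_le (by exact_mod_cast le_top))
      (hz.of_le (by exact_mod_cast le_top))
  simp only [sysOp, h, Matrix.mulVec_add, Finset.sum_add_distrib]
  abel

theorem sysOp_const_smul (n : ℕ) (B : ℕ → 𝕜 → Matrix (Fin m) (Fin m) 𝕜) {y : 𝕜 → Fin m → 𝕜} {x : 𝕜}
    (hy : ContDiffAt 𝕜 ∞ y x) (c : 𝕜) : sysOp n B (c • y) x = c • sysOp n B y x := by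
  have h : ∀ k : ℕ, iteratedDeriv k (c • y) x = c • iteratedDeriv k y x :=
    fun k => iteratedDeriv_const_smul (hy.of_le (by exact_mod_cast le_top)) c
  simp only [sysOp, h, Matrix.mulVec_smul, smul_add, Finset.smul_sum]

section

variable {F : Type*} [NormedAddCommGroup F] [NormedSpace 𝕜 F]

theorem iteratedDeriv_eq_PsiV {f : 𝕜 → F} {x : 𝕜} (hf : ContDiffAt 𝕜 ∞ f x) (n : ℕ) :
    iteratedDeriv n f x = (PsiV (fun _ => (1 : 𝕜)) 0)^[n] f x := by
  rw [(PsiV_iterate_const 1 f hf n).eq_of_nhds]; simp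

theorem contDiffAt_pow_smul {f : 𝕜 → F} {x : 𝕜} (hf : ContDiffAt 𝕜 ∞ f x) (n : ℕ) :
    ContDiffAt 𝕜 ∞ (fun t => (t - x) ^ n • f t) x :=
  ((contDiffAt_id.sub contDiffAt_const).pow n).smul hf

theorem iteratedDeriv_pow_smul_self {f : 𝕜 → F} {x : 𝕜} (hf : ContDiffAt 𝕜 ∞ f x) (n : ℕ) :
    iteratedDeriv n (fun t => (t - x) ^ n • f t) x = (n.factorial : 𝕜) • f x := by
  rw [iteratedDeriv_eq_PsiV (contDiffAt_pow_smul hf n), PsiV_iterate_pow_smul contDiffAt_const hf]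
  simp

theorem iteratedDeriv_pow_smul_lt {f : 𝕜 → F} {x : 𝕜} (hf : ContDiffAt 𝕜 ∞ f x) {k n : ℕ}
    (hkn : k < n) : iteratedDeriv k (fun t => (t - x) ^ n • f t) x = 0 := by
  obtain ⟨j, rfl⟩ := Nat.exists_eq_add_of_lt hkn
  have h : (fun t => (t - x) ^ (k + j + 1) • f t) =
      fun t => (t - x) ^ k • ((t - x) ^ (j + 1) • f t) := by
    ext t; rw [smul_smul, ← pow_add, add_assoc]
  rw [h, iteratedDeriv_pow_smul_self (contDiffAt_pow_smul hf _)]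
  simp

theorem iteratedDeriv_succ_pow_smul {f : 𝕜 → F} {x : 𝕜} (hf : ContDiffAt 𝕜 ∞ f x) (n : ℕ) :
    iteratedDeriv (n + 1) (fun t => (t - x) ^ n • f t) x = ((n + 1).factorial : 𝕜) • deriv f x := by
  rw [iteratedDeriv_eq_PsiV (contDiffAt_pow_smul hf n),
    PsiV_iterate_succ_pow_smul contDiffAt_const hf]
  simp

end

/-- All derivatives of order below n vanish at x, so only the leading term is seen. Adding such a
function corrects any curve to a solution at x without changing its lower jet. -/
theorem sysOp_pow_smul (n : ℕ) (B : ℕ → 𝕜 → Matrix (Fin m) (Fin m) 𝕜) {y : 𝕜 → Fin m → 𝕜} {x : 𝕜}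
    (hy : ContDiffAt 𝕜 ∞ y x) :
    sysOp n B (fun t => (t - x) ^ n • y t) x = (n.factorial : 𝕜) • y x := by
  rw [sysOp, iteratedDeriv_pow_smul_self hy, Finset.sum_eq_zero, add_zero]
  intro k hk
  rw [Finset.mem_Icc] at hk
  rw [iteratedDeriv_pow_smul_lt hy (by omega), Matrix.mulVec_zero]

/-- The power is one below the order of the operator, so besides the leading term only `B 1`
contributes. -/
theorem sysOp_succ_pow_smul (n : ℕ) (B : ℕ → 𝕜 → Matrix (Fin m) (Fin m) 𝕜) {y : 𝕜 → Fin m → 𝕜}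
    {x : 𝕜} (hy : ContDiffAt 𝕜 ∞ y x) :
    sysOp (n + 1) B (fun t => (t - x) ^ n • y t) x =
      (n.factorial : 𝕜) • ((n + 1 : 𝕜) • deriv y x + B 1 x *ᵥ y x) := by
  rw [sysOp, iteratedDeriv_succ_pow_smul hy, Finset.sum_eq_single_of_mem 1 (by simp),
    Nat.add_sub_cancel, iteratedDeriv_pow_smul_self hy, Matrix.mulVec_smul, Nat.factorial_succ,
    smul_add, smul_smul]
  · push_cast; rw [mul_comm]
  · intro k hk hk1
    rw [Finset.mem_Icc] at hk
    rw [iteratedDeriv_pow_smul_lt hy (by omega), Matrix.mulVec_zero]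

end Systems

/-! ### Existence of a normal form. -/

section NormalForm

variable {𝕜 : Type*} [RCLike 𝕜] {E : Type*} [NormedAddCommGroup E] [NormedSpace 𝕜 E]

/-- `P` is a linear differential operator of order at most `N` with smooth coefficients on `V`. -/
def IsDiffOp (V : Set 𝕜) (N : ℕ) (P : (𝕜 → E) → 𝕜 → E) : Prop :=
  ∃ C : ℕ → 𝕜 → E →L[𝕜] E, (∀ i, ContDiffOn 𝕜 ∞ (C i) V) ∧
    ∀ x ∈ V, ∀ w : 𝕜 → E, ContDiffAt 𝕜 N w x →
      P w x = ∑ i ∈ Finset.range (N + 1), C i x (iteratedDeriv i w x)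

theorem IsDiffOp.clm {V : Set 𝕜} {Q : 𝕜 → E →L[𝕜] E} (hQ : ContDiffOn 𝕜 ∞ Q V) :
    IsDiffOp V 0 fun w t => Q t (w t) :=
  ⟨fun _ => Q, fun _ => hQ, fun x _ w _ => by simp⟩

theorem IsDiffOp.mono {V : Set 𝕜} {N N' : ℕ} {P : (𝕜 → E) → 𝕜 → E} (h : IsDiffOp V N P)
    (hN : N ≤ N') : IsDiffOp V N' P := by
  obtain ⟨C, hC, hP⟩ := h
  refine ⟨fun i => if i ≤ N then C i else 0, fun i => ?_, fun x hx w hw => ?_⟩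
  · by_cases hi : i ≤ N
    · simpa [hi] using hC i
    · simpa [hi] using! contDiffOn_const (c := (0 : E →L[𝕜] E))
  · rw [hP x hx w (hw.of_le (by exact_mod_cast hN))]
    refine Finset.sum_subset_zero_on_sdiff (Finset.range_mono (by omega)) (fun i hi => ?_)
      fun i hi => ?_
    · have : ¬ i ≤ N := fun h => (Finset.mem_sdiff.1 hi).2 (Finset.mem_range.2 (by omega))
      simp [this]
    · have : i ≤ N := Nat.lt_succ_iff.1 (Finset.mem_range.1 hi)
      simp [this]

theorem IsDiffOp.add {V : Set 𝕜} {N : ℕ} {P P' : (𝕜 → E) → 𝕜 → E} (h : IsDiffOp V N P)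
    (h' : IsDiffOp V N P') : IsDiffOp V N fun w t => P w t + P' w t := by
  obtain ⟨C, hC, hP⟩ := h
  obtain ⟨C', hC', hP'⟩ := h'
  exact ⟨fun i x => C i x + C' i x, fun i => (hC i).add (hC' i), fun x hx w hw => by
    simp [hP x hx w hw, hP' x hx w hw, Finset.sum_add_distrib]⟩

theorem IsDiffOp.sum {V : Set 𝕜} {N : ℕ} {ι : Type*} (s : Finset ι)
    {P : ι → (𝕜 → E) → 𝕜 → E} (h : ∀ k ∈ s, IsDiffOp V N (P k)) :
    IsDiffOp V N fun w t => ∑ k ∈ s, P k w t := by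
  classical
  induction s using Finset.induction_on with
  | empty => exact ⟨fun _ _ => 0, fun _ => contDiffOn_const, fun x _ w _ => by simp⟩
  | insert a s ha ih =>
    simp only [Finset.sum_insert ha]
    exact (h a (Finset.mem_insert_self a s)).add
      (ih fun k hk => h k (Finset.mem_insert_of_mem hk))

theorem IsDiffOp.clm_apply {V : Set 𝕜} {N : ℕ} {P : (𝕜 → E) → 𝕜 → E} (h : IsDiffOp V N P)
    {L : 𝕜 → E →L[𝕜] E} (hL : ContDiffOn 𝕜 ∞ L V) :
    IsDiffOp V N fun w t => L t (P w t) := by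
  obtain ⟨C, hC, hP⟩ := h
  exact ⟨fun i x => (L x).comp (C i x), fun i => hL.clm_comp (hC i), fun x hx w hw => by
    simp [hP x hx w hw]⟩

theorem IsDiffOp.deriv {V : Set 𝕜} (hV : IsOpen V) {N : ℕ} {P : (𝕜 → E) → 𝕜 → E}
    (h : IsDiffOp V N P) : IsDiffOp V (N + 1) fun w => deriv (P w) := by
  obtain ⟨C, hC, hP⟩ := h
  refine ⟨fun i x => (if i ≤ N then _root_.deriv (C i) x else 0) + if i = 0 then 0 else C (i - 1) x,
    fun i => ContDiffOn.add ?_ ?_, fun x hx w hw => ?_⟩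
  · by_cases hi : i ≤ N
    · simpa [hi] using ((contDiffOn_infty_iff_deriv_of_isOpen hV).1 (hC i)).2
    · simpa [hi] using contDiffOn_const
  · by_cases hi : i = 0
    · simpa [hi] using contDiffOn_const
    · simpa [hi] using hC (i - 1)
  -- Finite differentiability at x spreads to a neighbourhood, whereas for order ∞ the
  -- neighbourhoods could shrink; hence the finite order in `IsDiffOp`.
  · have h1 : P w =ᶠ[𝓝 x] fun t => ∑ i ∈ Finset.range (N + 1), C i t (iteratedDeriv i w t) := by
      filter_upwards [hV.mem_nhds hx, hw.eventually (by simp)] with t ht hwt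
      exact hP t ht w (hwt.of_le (by exact_mod_cast Nat.le_succ N))
    have h2 : ∀ i ∈ Finset.range (N + 1), HasDerivAt (fun t => C i t (iteratedDeriv i w t))
        (_root_.deriv (C i) x (iteratedDeriv i w x) + C i x (iteratedDeriv (i + 1) w x)) x := by
      intro i hi
      rw [Finset.mem_range] at hi
      have h3 : DifferentiableAt 𝕜 (C i) x :=
        ((hC i).differentiableOn (by simp)).differentiableAt (hV.mem_nhds hx)
      have h4 : DifferentiableAt 𝕜 (iteratedDeriv i w) x :=
by
        have := hw.differentiableAt_iteratedFDeriv (m := i) (by exact_mod_cast hi)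
        simp only [funext fun t => iteratedDeriv_eq_iteratedFDeriv (n := i) (f := w) (x := t)]
        exact ((ContinuousMultilinearMap.apply 𝕜 (fun _ : Fin i => 𝕜) E
          fun _ => 1).differentiableAt.comp x this)
      rw [iteratedDeriv_succ]
      exact h3.hasDerivAt.clm_apply h4.hasDerivAt
    change _root_.deriv (P w) x = _
    rw [h1.deriv_eq, (HasDerivAt.fun_sum h2).deriv, Finset.sum_add_distrib]
    simp only [add_apply, Finset.sum_add_distrib]
    congr 1
    · rw [Finset.sum_range_succ _ (N + 1)]
      simp only [show ¬ N + 1 ≤ N by omega, if_false, zero_apply, add_zero]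
      refine Finset.sum_congr rfl fun i hi => ?_
      rw [Finset.mem_range] at hi
      simp [show i ≤ N by omega]
    · rw [Finset.sum_range_succ' _ (N + 1)]
      simp

theorem IsDiffOp.iteratedDeriv {V : Set 𝕜} (hV : IsOpen V) {P : (𝕜 → E) → 𝕜 → E}
    (h : IsDiffOp V 0 P) (N : ℕ) : IsDiffOp V N fun w => iteratedDeriv N (P w) := by
  induction N with
  | zero => simpa using h
  | succ N ih => simp only [iteratedDeriv_succ]; exact ih.deriv hV

end NormalForm

section

variable {𝕜 : Type*} [RCLike 𝕜] {m : ℕ}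

theorem contDiffOn_inverse {V : Set 𝕜} {Q : 𝕜 → (Fin m → 𝕜) →L[𝕜] (Fin m → 𝕜)}
    (hQ : ContDiffOn 𝕜 ∞ Q V) (hu : ∀ x ∈ V, IsUnit (Q x)) :
    ContDiffOn 𝕜 ∞ (fun x => Ring.inverse (Q x)) V := fun x hx => by
  obtain ⟨u, hu⟩ := hu x hx
  have h := contDiffAt_ringInverse 𝕜 (n := ∞) u
  rw [hu] at h
  exact h.comp_contDiffWithinAt x (hQ x hx)

/-- The system obtained from `B` by the substitution `y = Q w`. -/
theorem exists_gauge {n : ℕ} (hn : 1 ≤ n) {V : Set 𝕜} (hV : IsOpen V)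
    {B : ℕ → 𝕜 → Matrix (Fin m) (Fin m) 𝕜} (hB : SmoothCoeffsOn n B V)
    {Q : 𝕜 → (Fin m → 𝕜) →L[𝕜] (Fin m → 𝕜)} (hQ : ContDiffOn 𝕜 ∞ Q V)
    (hu : ∀ x ∈ V, IsUnit (Q x))
    (hQ' : ∀ x ∈ V, (n : 𝕜) • deriv Q x + clm (B 1 x) * Q x = 0) :
    ∃ A : ℕ → 𝕜 → Matrix (Fin m) (Fin m) 𝕜, SmoothCoeffsOn n A V ∧ (∀ x ∈ V, A 1 x = 0) ∧
      ∀ x ∈ V, ∀ w : 𝕜 → Fin m → 𝕜, ContDiffAt 𝕜 ∞ w x →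
        sysOp n B (fun t => Q t (w t)) x = Q x (sysOp n A w x) := by
  -- The Leibniz expansion is never written out: the coefficients merely exist, and the top two are
  -- found by testing on powers of t - x.
  have h0 : IsDiffOp V n fun w : 𝕜 → Fin m → 𝕜 => sysOp n B fun t => Q t (w t) := by
    refine ((IsDiffOp.clm hQ).iteratedDeriv hV n).add (IsDiffOp.sum _ fun k hk => ?_)
    exact (((IsDiffOp.clm hQ).iteratedDeriv hV (n - k)).clm_apply
      (smoothMatrixOn_iff.1 (hB k hk))).mono (Nat.sub_le n k)
  obtain ⟨C, hC, hop⟩ := h0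
  beta_reduce at hop
  obtain ⟨n, rfl⟩ := Nat.exists_eq_add_of_le' hn
  have hle : ∀ k : ℕ, (k : ℕ∞ω) ≤ ∞ := fun k => by exact_mod_cast le_top
  have hQat : ∀ x ∈ V, ContDiffAt 𝕜 ∞ Q x := fun x hx => hQ.contDiffAt (hV.mem_nhds hx)
  have hfac : ∀ k : ℕ, (k.factorial : 𝕜) ≠ 0 := fun k => by exact_mod_cast k.factorial_ne_zero
  have htop : ∀ x ∈ V, C (n + 1) x = Q x := by
    intro x hx
    ext v : 1
    have hs := contDiffAt_pow_smul (contDiffAt_const (c := v) (x := x)) (n + 1)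
    have h1 := hop x hx _ (hs.of_le (hle _))
    have h2 : (fun t => Q t ((t - x) ^ (n + 1) • v)) = fun t => (t - x) ^ (n + 1) • Q t v := by
      ext1 t; rw [map_smul]
    rw [h2, sysOp_pow_smul _ _ ((hQat x hx).clm_apply contDiffAt_const),
      Finset.sum_range_succ, Finset.sum_eq_zero, zero_add,
      iteratedDeriv_pow_smul_self contDiffAt_const, map_smul] at h1
    · exact (smul_right_injective _ (hfac _) h1).symm
    · intro i hi
      rw [iteratedDeriv_pow_smul_lt contDiffAt_const (Finset.mem_range.1 hi), map_zero]
  -- Here n + 1 is the order. The test (t - x)ⁿ v yields (n + 1) Q' v + B₁ Q v, which vanishes by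
  -- the choice of Q.
  have hsub : ∀ x ∈ V, C n x = 0 := by
    intro x hx
    ext v : 1
    have hs := contDiffAt_pow_smul (contDiffAt_const (c := v) (x := x)) n
    have h1 := hop x hx _ (hs.of_le (hle _))
    have h2 : (fun t => Q t ((t - x) ^ n • v)) = fun t => (t - x) ^ n • Q t v := by
      ext1 t; rw [map_smul]
    have h3 : deriv (fun t => Q t v) x = deriv Q x v := by
      have := ((hQat x hx).differentiableAt infty_ne_zero).hasDerivAt.clm_apply
        (hasDerivAt_const x v)
      simpa using this.deriv
    have h4 : ((n + 1 : ℕ) : 𝕜) • deriv Q x v + B 1 x *ᵥ Q x v = 0 :=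
      DFunLike.congr_fun (hQ' x hx) v
    push_cast at h4
    rw [h2, sysOp_succ_pow_smul _ _ ((hQat x hx).clm_apply contDiffAt_const), h3, h4, smul_zero,
      Finset.sum_range_succ, Finset.sum_range_succ, Finset.sum_eq_zero, zero_add,
      iteratedDeriv_pow_smul_self contDiffAt_const, map_smul,
      iteratedDeriv_succ_pow_smul contDiffAt_const, deriv_const, smul_zero, map_zero,
      add_zero] at h1
    · exact ((smul_eq_zero.1 h1.symm).resolve_left (hfac _))
    · intro i hi
      rw [iteratedDeriv_pow_smul_lt contDiffAt_const (Finset.mem_range.1 hi), map_zero]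
  have hinv : ∀ x ∈ V, ∀ v, Q x (Ring.inverse (Q x) v) = v := fun x hx v => by
    rw [← mul_apply_eq_comp, Ring.mul_inverse_cancel _ (hu x hx)]; rfl
  -- The normal-form coefficient Aₖ is Q⁻¹ times the coefficient of order n + 1 - k.
  refine ⟨fun k x => LinearMap.toMatrix'
    (Ring.inverse (Q x) * C (n + 1 - k) x : (Fin m → 𝕜) →L[𝕜] (Fin m → 𝕜)).toLinearMap,
    fun k _ => ?_, fun x hx => ?_, fun x hx w hw => ?_⟩
  · rw [smoothMatrixOn_iff]
    simp only [toMatrix'_clm]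
    exact (contDiffOn_inverse hQ hu).clm_comp (hC _)
  · simp [hsub x hx]
  · rw [hop x hx w (hw.of_le (hle _)), Finset.sum_range_succ, htop x hx, sysOp, map_add, map_sum,
      add_comm]
    congr 1
    simp only [← clm_apply, toMatrix'_clm, mul_apply_eq_comp, hinv x hx]
    rw [Finset.range_eq_Ico, Finset.sum_bij' (fun i _ => n + 1 - i) (fun k _ => n + 1 - k)]
    · intro i hi; simp at hi ⊢; omega
    · intro i hi; simp at hi ⊢; omega
    · intro i hi; simp at hi ⊢; omega
    · intro i hi; simp at hi ⊢; omega
    · intro i hi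
      rw [show n + 1 - (n + 1 - i) = i by simp at hi; omega]

/-- The matrix equation Q' = -(1/n) B₁ Q is solved with Q(x₀) = 1, then restricted to the open set
where Q is invertible. -/
theorem exists_isNormalForm {n : ℕ} (hn : 1 ≤ n) {I : Set 𝕜} (hI : IsOpen I) {x₀ : 𝕜}
    (hx₀ : x₀ ∈ I) {B : ℕ → 𝕜 → Matrix (Fin m) (Fin m) 𝕜} (hB : SmoothCoeffsOn n B I) :
    ∃ A : ℕ → 𝕜 → Matrix (Fin m) (Fin m) 𝕜, IsNormalForm n B A I x₀ := by
  have hn0 : (n : 𝕜) ≠ 0 := by exact_mod_cast (by omega : n ≠ 0)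
  have hB1 := smoothMatrixOn_iff.1 (hB 1 (Finset.mem_Icc.2 ⟨le_rfl, hn⟩))
  obtain ⟨ρ, hρ, hρI, Q, hQ0, hQ, hQ'⟩ := exists_linear_ode hI
    (M := fun x => ContinuousLinearMap.compL 𝕜 (Fin m → 𝕜) (Fin m → 𝕜) (Fin m → 𝕜)
      ((-(n : 𝕜)⁻¹) • clm (B 1 x)))
    ((ContinuousLinearMap.contDiff _).comp_contDiffOn (hB1.const_smul _)) hx₀ 1
  have hopen : IsOpen (Metric.ball x₀ ρ ∩ Q ⁻¹' {L | IsUnit L}) :=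
    hQ.continuousOn.isOpen_inter_preimage Metric.isOpen_ball Units.isOpen
  have hsub : Metric.ball x₀ ρ ∩ Q ⁻¹' {L | IsUnit L} ⊆ Metric.ball x₀ ρ := Set.inter_subset_left
  obtain ⟨A, hA, hA1, hAop⟩ := exists_gauge hn hopen
    (fun k hk i j => (hB k hk i j).mono (hsub.trans hρI)) (hQ.mono hsub) (fun x hx => hx.2)
    (fun x hx => by
      rw [(hQ' x hx.1).deriv]
      simp [smul_smul, hn0, ContinuousLinearMap.mul_def])
  refine ⟨A, _, hopen, ⟨Metric.mem_ball_self hρ, ?_⟩, hsub.trans hρI, hA, hA1,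
    fun x => LinearMap.toMatrix' (Q x).toLinearMap, ?_, fun x hx => ?_, fun x hx w hw => ?_⟩
  · simp [hQ0]
  · rw [smoothMatrixOn_iff]
    simpa only [toMatrix'_clm] using hQ.mono hsub
  · refine isUnit_of_isUnit_clm ?_
    rw [toMatrix'_clm]; exact hx.2
  · simp only [← clm_apply, toMatrix'_clm]
    exact hAop x hx w hw

end

/-! ### From an iterative normal form to the canonical form. -/

section IterativeToCanonical

variable {𝕜 : Type*} [RCLike 𝕜] {m : ℕ}

theorem isUnit_smul_clm {c : 𝕜} (hc : c ≠ 0) {L : (Fin m → 𝕜) →L[𝕜] (Fin m → 𝕜)}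
    (hL : IsUnit L) : IsUnit (c • L) := by
  obtain ⟨u, rfl⟩ := hL
  refine ⟨⟨c • u.1, c⁻¹ • (u⁻¹).1, ?_, ?_⟩, rfl⟩
  · ext v : 1
    have : u.1 ((u⁻¹).1 v) = v := by rw [← mul_apply_eq_comp, u.mul_inv]; rfl
    simp [smul_smul, hc, mul_apply_eq_comp, this]
  · ext v : 1
    have : (u⁻¹).1 (u.1 v) = v := by rw [← mul_apply_eq_comp, u.inv_mul]; rfl
    simp [smul_smul, hc, mul_apply_eq_comp, this]

/-- The fibre-preserving transformation `(x, y) ↦ (e x, G(x) y)`. -/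
theorem exists_fiberHomeomorph (e : OpenPartialHomeomorph 𝕜 𝕜) (he : ContDiffOn 𝕜 ∞ e e.source)
    (he' : ContDiffOn 𝕜 ∞ e.symm e.target) {G : 𝕜 → (Fin m → 𝕜) →L[𝕜] (Fin m → 𝕜)}
    (hG : ContDiffOn 𝕜 ∞ G e.source) (hu : ∀ x ∈ e.source, IsUnit (G x)) :
    ∃ Φ : OpenPartialHomeomorph (𝕜 × (Fin m → 𝕜)) (𝕜 × (Fin m → 𝕜)),
      Φ.source = e.source ×ˢ Set.univ ∧ (∀ p, Φ p = (e p.1, G p.1 p.2)) ∧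
      ContDiffOn 𝕜 ∞ Φ Φ.source ∧ ContDiffOn 𝕜 ∞ Φ.symm Φ.target := by
  have h1 : ContDiffOn 𝕜 ∞ (fun p : 𝕜 × (Fin m → 𝕜) => (e p.1, G p.1 p.2))
      (e.source ×ˢ Set.univ) :=
    (he.comp contDiffOn_fst fun p hp => hp.1).prodMk
      ((hG.comp contDiffOn_fst fun p hp => hp.1).clm_apply contDiffOn_snd)
  have h2 : ContDiffOn 𝕜 ∞ (fun p : 𝕜 × (Fin m → 𝕜) =>
      (e.symm p.1, Ring.inverse (G (e.symm p.1)) p.2)) (e.target ×ˢ Set.univ) :=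
    (he'.comp contDiffOn_fst fun p hp => hp.1).prodMk
      (((contDiffOn_inverse hG hu).comp (he'.comp contDiffOn_fst fun p hp => hp.1)
        fun p hp => e.map_target hp.1).clm_apply contDiffOn_snd)
  exact ⟨{
    toFun := fun p => (e p.1, G p.1 p.2)
    invFun := fun p => (e.symm p.1, Ring.inverse (G (e.symm p.1)) p.2)
    source := e.source ×ˢ Set.univ
    target := e.target ×ˢ Set.univ
    map_source' := fun p hp => ⟨e.map_source hp.1, trivial⟩
    map_target' := fun p hp => ⟨e.map_target hp.1, trivial⟩
    left_inv' := fun p hp => by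
      refine Prod.ext (e.left_inv hp.1) ?_
      simp only [e.left_inv hp.1]
      rw [← mul_apply_eq_comp, Ring.inverse_mul_cancel _ (hu _ hp.1)]; rfl
    right_inv' := fun p hp => by
      refine Prod.ext (e.right_inv hp.1) ?_
      simp only
      rw [← mul_apply_eq_comp, Ring.mul_inverse_cancel _ (hu _ (e.map_target hp.1))]; rfl
    open_source := e.open_source.prod isOpen_univ
    open_target := e.open_target.prod isOpen_univ
    continuousOn_toFun := h1.continuousOn
    continuousOn_invFun := h2.continuousOn }, rfl, fun _ => rfl, h1, h2⟩

theorem exists_chart {χ : 𝕜 → 𝕜} {U : Set 𝕜} (hU : IsOpen U) (hχ : ContDiffOn 𝕜 ∞ χ U)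
    (hχ' : ∀ x ∈ U, deriv χ x ≠ 0) {x₀ : 𝕜} (hx₀ : x₀ ∈ U) :
    ∃ e : OpenPartialHomeomorph 𝕜 𝕜, (∀ x, e x = χ x) ∧ x₀ ∈ e.source ∧ e.source ⊆ U ∧
      ContDiffOn 𝕜 ∞ e e.source ∧ ContDiffOn 𝕜 ∞ e.symm e.target := by
  have hat : ∀ x ∈ U, ContDiffAt 𝕜 ∞ χ x := fun x hx => hχ.contDiffAt (hU.mem_nhds hx)
  have hd : ∀ x ∈ U, HasDerivAt χ (deriv χ x) x := fun x hx =>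
    ((hat x hx).differentiableAt infty_ne_zero).hasDerivAt
  have hs : HasFDerivAt χ
      ((ContinuousLinearEquiv.unitsEquivAut 𝕜 (Units.mk0 _ (hχ' x₀ hx₀)) : 𝕜 ≃L[𝕜] 𝕜) : 𝕜 →L[𝕜] 𝕜)
      x₀ := (hd x₀ hx₀).hasFDerivAt_equiv (hχ' x₀ hx₀)
  let e₀ := (hat x₀ hx₀).toOpenPartialHomeomorph χ hs infty_ne_zero
  let e := e₀.restrOpen U hU
  have hsub : e.source ⊆ U := by
    rw [OpenPartialHomeomorph.restrOpen_source]; exact Set.inter_subset_right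
  refine ⟨e, fun x => rfl, ?_, hsub, hχ.mono hsub, fun X hX => ?_⟩
  · rw [OpenPartialHomeomorph.restrOpen_source]
    exact ⟨(hat x₀ hx₀).mem_toOpenPartialHomeomorph_source hs infty_ne_zero, hx₀⟩
  · have hmem := hsub (e.map_target hX)
    exact (e.contDiffAt_symm_deriv (hχ' _ hmem) hX (hd _ hmem) (hat _ hmem)).contDiffWithinAt

theorem PsiV_iterate_apply {r s : 𝕜 → 𝕜} {w : 𝕜 → Fin m → 𝕜} {x : 𝕜}
    (hr : ContDiffAt 𝕜 ∞ r x) (hs : ContDiffAt 𝕜 ∞ s x) (hw : ContDiffAt 𝕜 ∞ w x) (n : ℕ)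
    (i : Fin m) : (Psi r s)^[n] (fun t => w t i) x = (PsiV r s)^[n] w x i := by
  have h := (PsiV_iterate_clm (ContinuousLinearMap.proj (R := 𝕜) (φ := fun _ : Fin m => 𝕜) i)
    hr hs hw n).eq_of_nhds
  exact h

/-- A nonvanishing solution of `r g' = s g` near `x₀`. -/
theorem exists_multiplier {r s : 𝕜 → 𝕜} {V : Set 𝕜} (hV : IsOpen V) (hr : ContDiffOn 𝕜 ∞ r V)
    (hs : ContDiffOn 𝕜 ∞ s V) (hr0 : ∀ x ∈ V, r x ≠ 0) {x₀ : 𝕜} (hx₀ : x₀ ∈ V) :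
    ∃ ρ > 0, Metric.ball x₀ ρ ⊆ V ∧ ∃ g : 𝕜 → 𝕜, ContDiffOn 𝕜 ∞ g (Metric.ball x₀ ρ) ∧
      (∀ x ∈ Metric.ball x₀ ρ, g x ≠ 0) ∧
      ∀ x ∈ Metric.ball x₀ ρ, HasDerivAt g (s x / r x * g x) x := by
  obtain ⟨ρ₁, hρ₁, hρ₁V, g, hg0, hg, hg'⟩ := exists_linear_ode hV
    (M := fun x => (s x / r x) • ContinuousLinearMap.id 𝕜 𝕜)
    ((hs.div hr hr0).smul contDiffOn_const) hx₀ 1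
  have hopen : IsOpen (Metric.ball x₀ ρ₁ ∩ g ⁻¹' {z | z ≠ 0}) :=
    hg.continuousOn.isOpen_inter_preimage Metric.isOpen_ball isOpen_ne
  obtain ⟨ρ, hρ, hsub⟩ := Metric.isOpen_iff.1 hopen x₀
    ⟨Metric.mem_ball_self hρ₁, by simp [hg0]⟩
  have hsub' := hsub.trans Set.inter_subset_left
  exact ⟨ρ, hρ, hsub'.trans hρ₁V, g, hg.mono hsub', fun x hx => (hsub hx).2,
    fun x hx => by simpa using hg' x (hsub' hx)⟩

/-- With χ' = 1/r and r g' = s g, the transformation is (x, y) ↦ (χ(x), g(x) Q(x)⁻¹ y). For w = Q⁻¹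
y, dⁿ(g w)/dχⁿ = (r d/dx)ⁿ(g w) = g Ψⁿ w = g rⁿ times the normal-form operator, and g rⁿ has no
zero. -/
theorem inCanonicalClass_of_isUncoupledIterative {n : ℕ} {I : Set 𝕜} {x₀ : 𝕜}
    {B A : ℕ → 𝕜 → Matrix (Fin m) (Fin m) 𝕜} (hA : IsNormalForm n B A I x₀)
    (h : IsUncoupledIterative n A x₀) : InCanonicalClass n B I x₀ := by
  obtain ⟨V, hV, hxV, hVI, -, -, Q, hQ, hQu, hop⟩ := hA
  obtain ⟨V', r, s, hV', hxV', hr, hs, hr0, -, hit⟩ := h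
  rw [smoothMatrixOn_iff] at hQ
  have hVo := hV.inter hV'
  have hr' := hr.mono (Set.inter_subset_right (s := V))
  have hs' := hs.mono (Set.inter_subset_right (s := V))
  obtain ⟨ρ, hρ, hρV, g, hg, hg0, hg'⟩ := exists_multiplier hVo hr' hs'
    (fun x hx => hr0 x hx.2) ⟨hxV, hxV'⟩
  have hrb := hr'.mono hρV
  have hrinv : ContDiffOn 𝕜 ∞ (fun x => (r x)⁻¹) (Metric.ball x₀ ρ) :=
    hrb.inv fun x hx => hr0 x (hρV hx).2
  obtain ⟨χ, -, hχ'⟩ := exists_primitive (hrinv.of_le one_le_infty)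
  have hχ : ContDiffOn 𝕜 ∞ χ (Metric.ball x₀ ρ) := by
    rw [contDiffOn_infty_iff_deriv_of_isOpen Metric.isOpen_ball]
    exact ⟨fun x hx => (hχ' x hx).differentiableAt.differentiableWithinAt,
      hrinv.congr fun x hx => (hχ' x hx).deriv⟩
  obtain ⟨e, heχ, hxe, hesub, he, he'⟩ := exists_chart Metric.isOpen_ball hχ
    (fun x hx => by rw [(hχ' x hx).deriv]; exact inv_ne_zero (hr0 x (hρV hx).2))
    (Metric.mem_ball_self hρ)
  have hQi : ContDiffOn 𝕜 ∞ (fun x => Ring.inverse (clm (Q x))) V :=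
    contDiffOn_inverse hQ fun x hx => isUnit_clm (hQu x hx)
  have heV : e.source ⊆ V := fun x hx => (hρV (hesub hx)).1
  obtain ⟨Φ, hΦs, hΦ, hΦ1, hΦ2⟩ := exists_fiberHomeomorph e he he'
    (G := fun x => g x • Ring.inverse (clm (Q x)))
    ((hg.mono hesub).smul (hQi.mono heV)) (fun x hx => by
      have h1 : IsUnit (Ring.inverse (clm (Q x))) := by
        obtain ⟨u, hu⟩ := isUnit_clm (hQu x (heV hx))
        rw [← hu, Ring.inverse_unit]; exact u⁻¹.isUnit
      exact isUnit_smul_clm (hg0 x (hesub hx)) h1)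
  refine ⟨0, Φ, ?_, ?_, hΦ1, hΦ2, ?_⟩
  · rw [hΦs]; exact ⟨hxe, trivial⟩
  · rw [hΦs]; exact Set.prod_mono (heV.trans hVI) le_rfl
  intro x y Y hy hxy _ hY hYΦ
  rw [hΦs] at hxy
  have hxe : x ∈ e.source := hxy.1
  have hxb := hesub hxe
  have hxV := heV hxe
  have hbn := Metric.isOpen_ball.mem_nhds hxb
  have hrx : ContDiffAt 𝕜 ∞ r x := hrb.contDiffAt hbn
  have hsx : ContDiffAt 𝕜 ∞ s x := (hs'.mono hρV).contDiffAt hbn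
  have hgx : ContDiffAt 𝕜 ∞ g x := hg.contDiffAt hbn
  have hχx : ContDiffAt 𝕜 ∞ χ x := hχ.contDiffAt hbn
  have hr0x : r x ≠ 0 := hr0 x (hρV hxb).2
  let w : 𝕜 → Fin m → 𝕜 := fun t => Ring.inverse (clm (Q t)) (y t)
  have hw : ContDiffAt 𝕜 ∞ w x := (hQi.contDiffAt (hV.mem_nhds hxV)).clm_apply hy
  have hyw : y =ᶠ[𝓝 x] fun t => Q t *ᵥ w t := by
    filter_upwards [hV.mem_nhds hxV] with t ht
    simp only [w]
    rw [← clm_apply, ← mul_apply_eq_comp, Ring.mul_inverse_cancel _ (isUnit_clm (hQu t ht))]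
    rfl
  rw [sysOp_congr n B hyw, hop x hxV w hw]
  simp only [hΦ, heχ] at hY hYΦ ⊢
  have hχn : deriv χ x ≠ 0 := by rw [(hχ' x hxb).deriv]; exact inv_ne_zero hr0x
  have h1 := (iteratedDeriv_comp_eventuallyEq hχx hχn hY hYΦ n).eq_of_nhds
  have h2 : (fun t => (deriv χ t)⁻¹) =ᶠ[𝓝 x] r := by
    filter_upwards [hbn] with t ht
    rw [(hχ' t ht).deriv, inv_inv]
  have h3 : (fun t => (g t • Ring.inverse (clm (Q t))) (y t)) = fun t => g t • w t := rfl
  have h4 := (PsiV_iterate_smul hrx hsx hw hgx (by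
    filter_upwards [hbn] with t ht
    rw [(hg' t ht).deriv]
    have := hr0 t (hρV ht).2
    field_simp) n).eq_of_nhds
  have h5 : (PsiV r s)^[n] w x = r x ^ n • sysOp n A w x := by
    ext i
    rw [← PsiV_iterate_apply hrx hsx hw, hit x (hρV hxb).2 w hw]
    rfl
  rw [h1, (PsiV_iterate_congr h2 .rfl .rfl n).eq_of_nhds, h3, h4, h5, smul_smul,
    smul_eq_zero_iff_right (mul_ne_zero (hg0 x hxb) (pow_ne_zero _ hr0x))]
  constructor
  · intro h
    have h6 : Ring.inverse (clm (Q x)) (Q x *ᵥ sysOp n A w x) = sysOp n A w x := by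
      rw [← clm_apply, ← mul_apply_eq_comp, Ring.inverse_mul_cancel _ (isUnit_clm (hQu x hxV))]
      rfl
    rw [← h6, h, map_zero]
  · intro h; rw [h, Matrix.mulVec_zero]

end IterativeToCanonical

/-! ### Linearizing maps of the normal form. -/

section Setup

variable {𝕜 : Type*} [RCLike 𝕜] {m : ℕ}

/-- Composing f with a local inverse of X supplies the function Y that `MapsToCanonical` speaks
about. -/
theorem exists_graph {F : Type*} [NormedAddCommGroup F] [NormedSpace 𝕜 F] {X : 𝕜 → 𝕜} {f : 𝕜 → F}
    {x : 𝕜} (hX : ContDiffAt 𝕜 ∞ X x) (hX' : deriv X x ≠ 0) (hf : ContDiffAt 𝕜 ∞ f x) :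
    ∃ Y : 𝕜 → F, ContDiffAt 𝕜 ∞ Y (X x) ∧ ∀ᶠ t in 𝓝 x, Y (X t) = f t := by
  have hd : HasDerivAt X (deriv X x) x := (hX.differentiableAt infty_ne_zero).hasDerivAt
  have hs : HasFDerivAt X
      ((ContinuousLinearEquiv.unitsEquivAut 𝕜 (Units.mk0 _ hX') : 𝕜 ≃L[𝕜] 𝕜) : 𝕜 →L[𝕜] 𝕜) x :=
    hd.hasFDerivAt_equiv hX'
  have h1 := hX.to_localInverse hs infty_ne_zero
  have h2 := hX.localInverse_apply_image hs infty_ne_zero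
  refine ⟨fun s => f (hX.localInverse hs infty_ne_zero s), ?_, ?_⟩
  · refine ContDiffAt.comp (X x) ?_ h1
    rw [h2]; exact hf
  · have h3 := (hX.hasStrictFDerivAt' hs infty_ne_zero).eventually_left_inverse
    filter_upwards [h3] with t ht
    exact congrArg f ht

theorem contDiffAt_comp_graph {S : Set (𝕜 × (Fin m → 𝕜))} (hS : IsOpen S)
    {Z : 𝕜 × (Fin m → 𝕜) → 𝕜 × (Fin m → 𝕜)} (hZ : ContDiffOn 𝕜 ∞ Z S) {w : 𝕜 → Fin m → 𝕜} {x : 𝕜}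
    (hw : ContDiffAt 𝕜 ∞ w x) (hx : (x, w x) ∈ S) : ContDiffAt 𝕜 ∞ (fun t => Z (t, w t)) x :=
  ContDiffAt.comp (g := Z) (f := fun t => (t, w t)) x (hZ.contDiffAt (hS.mem_nhds hx))
    (contDiffAt_id.prodMk hw)

/-- `Z`, defined on the open set `S`, maps solutions of the system with coefficients `A` to
solutions of the canonical equation. -/
structure Linearizes (n : ℕ) (A : ℕ → 𝕜 → Matrix (Fin m) (Fin m) 𝕜) (S : Set (𝕜 × (Fin m → 𝕜)))
    (Z : 𝕜 × (Fin m → 𝕜) → 𝕜 × (Fin m → 𝕜)) : Prop where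
  isOpen : IsOpen S
  contDiffOn : ContDiffOn 𝕜 ∞ Z S
  injective : ∀ z ∈ S, Function.Injective (fderiv 𝕜 Z z)
  canonical : ∀ (x : 𝕜) (w : 𝕜 → Fin m → 𝕜), ContDiffAt 𝕜 ∞ w x → (x, w x) ∈ S →
    deriv (fun t => (Z (t, w t)).1) x ≠ 0 → sysOp n A w x = 0 →
    (PsiV (fun t => (deriv (fun t => (Z (t, w t)).1) t)⁻¹) 0)^[n] (fun t => (Z (t, w t)).2) x = 0

theorem Linearizes.mono {n : ℕ} {A : ℕ → 𝕜 → Matrix (Fin m) (Fin m) 𝕜}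
    {S S' : Set (𝕜 × (Fin m → 𝕜))} {Z : 𝕜 × (Fin m → 𝕜) → 𝕜 × (Fin m → 𝕜)}
    (h : Linearizes n A S Z) (hS' : IsOpen S') (hSS' : S' ⊆ S) : Linearizes n A S' Z :=
  ⟨hS', h.contDiffOn.mono hSS', fun z hz => h.injective z (hSS' hz),
    fun x w hw hx => h.canonical x w hw (hSS' hx)⟩

/-- The map is Z = Φ ∘ q with q(x, w) = (x, Q(x) w). Only the implication from solutions to
solutions is kept. -/
theorem exists_linearizes {n : ℕ} {I : Set 𝕜} {x₀ : 𝕜} {B A : ℕ → 𝕜 → Matrix (Fin m) (Fin m) 𝕜}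
    (hA : IsNormalForm n B A I x₀) (h : InCanonicalClass n B I x₀) :
    ∃ (V : Set 𝕜) (S : Set (𝕜 × (Fin m → 𝕜))) (Z : 𝕜 × (Fin m → 𝕜) → 𝕜 × (Fin m → 𝕜))
      (w₀ : Fin m → 𝕜), IsOpen V ∧ x₀ ∈ V ∧ SmoothCoeffsOn n A V ∧ (∀ x ∈ V, A 1 x = 0) ∧
      (x₀, w₀) ∈ S ∧ (∀ z ∈ S, z.1 ∈ V) ∧ Linearizes n A S Z := by
  obtain ⟨V, hV, hxV, hVI, hAs, hA1, Q, hQ, hQu, hop⟩ := hA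
  obtain ⟨y₀, Φ, hmem, -, hΦ, hΦs, hmap⟩ := h
  rw [smoothMatrixOn_iff] at hQ
  have hQi : ContDiffOn 𝕜 ∞ (fun x => Ring.inverse (clm (Q x))) V :=
    contDiffOn_inverse hQ fun x hx => isUnit_clm (hQu x hx)
  let q : 𝕜 × (Fin m → 𝕜) → 𝕜 × (Fin m → 𝕜) := fun p => (p.1, clm (Q p.1) p.2)
  have hq : ContDiffOn 𝕜 ∞ q (V ×ˢ Set.univ) :=
    contDiffOn_fst.prodMk ((hQ.comp contDiffOn_fst fun p hp => hp.1).clm_apply contDiffOn_snd)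
  have hqi : ∀ p : 𝕜 × (Fin m → 𝕜), p.1 ∈ V → ContDiffAt 𝕜 ∞
      (fun p : 𝕜 × (Fin m → 𝕜) => (p.1, Ring.inverse (clm (Q p.1)) p.2)) p := fun p hp =>
    contDiffAt_fst.prodMk (((hQi.contDiffAt (hV.mem_nhds hp)).comp p contDiffAt_fst).clm_apply
      contDiffAt_snd)
  have hinv : ∀ x ∈ V, ∀ v, Ring.inverse (clm (Q x)) (clm (Q x) v) = v := fun x hx v => by
    rw [← mul_apply_eq_comp, Ring.inverse_mul_cancel _ (isUnit_clm (hQu x hx))]; rfl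
  have hinv' : ∀ x ∈ V, ∀ v, clm (Q x) (Ring.inverse (clm (Q x)) v) = v := fun x hx v => by
    rw [← mul_apply_eq_comp, Ring.mul_inverse_cancel _ (isUnit_clm (hQu x hx))]; rfl
  have hSo : IsOpen (V ×ˢ Set.univ ∩ q ⁻¹' Φ.source) :=
    hq.continuousOn.isOpen_inter_preimage (hV.prod isOpen_univ) Φ.open_source
  have hZ : ContDiffOn 𝕜 ∞ (Φ ∘ q) (V ×ˢ Set.univ ∩ q ⁻¹' Φ.source) :=
    hΦ.comp (hq.mono Set.inter_subset_left) fun p hp => hp.2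
  refine ⟨V, V ×ˢ Set.univ ∩ q ⁻¹' Φ.source, Φ ∘ q, Ring.inverse (clm (Q x₀)) y₀, hV, hxV, hAs,
    hA1, ⟨⟨hxV, trivial⟩, ?_⟩,
    fun z hz => hz.1.1, hSo, hZ, fun z hz => ?_, fun x w hw hx hX hsys => ?_⟩
  · simpa only [Set.mem_preimage, q, hinv' x₀ hxV] using hmem
  · have hZz : DifferentiableAt 𝕜 (Φ ∘ q) z :=
      (hZ.contDiffAt (hSo.mem_nhds hz)).differentiableAt infty_ne_zero
    have hsymm : Φ.symm ((Φ ∘ q) z) = q z := Φ.left_inv hz.2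
    have hs1 : DifferentiableAt 𝕜 Φ.symm ((Φ ∘ q) z) :=
      (hΦs.contDiffAt (Φ.open_target.mem_nhds (Φ.map_source hz.2))).differentiableAt infty_ne_zero
    have hs2 : DifferentiableAt 𝕜
        (fun p : 𝕜 × (Fin m → 𝕜) => (p.1, Ring.inverse (clm (Q p.1)) p.2))
        (Φ.symm ((Φ ∘ q) z)) := by
      rw [hsymm]; exact (hqi (q z) hz.1.1).differentiableAt infty_ne_zero
    -- Z has the smooth left inverse q⁻¹ ∘ Φ⁻¹, so by the chain rule its derivative has a left
    -- inverse.
    have hcomp := (hs2.hasFDerivAt.comp _ hs1.hasFDerivAt).comp z hZz.hasFDerivAt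
    have hid := hcomp.congr_of_eventuallyEq (f₁ := id) (by
      filter_upwards [hSo.mem_nhds hz] with p hp
      have : Φ.symm (Φ (q p)) = q p := Φ.left_inv hp.2
      simp only [Function.comp, this, id]
      exact Prod.ext rfl (hinv p.1 hp.1.1 p.2).symm)
    have heq := hid.unique (hasFDerivAt_id z)
    intro a b hab
    have ha := DFunLike.congr_fun heq a
    have hb := DFunLike.congr_fun heq b
    simp only [ContinuousLinearMap.comp_apply, hab] at ha hb
    exact ha.symm.trans hb
  · have hxV : x ∈ V := hx.1.1
    have hy : ContDiffAt 𝕜 ∞ (fun t => Q t *ᵥ w t) x :=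
      (hQ.contDiffAt (hV.mem_nhds hxV)).clm_apply hw
    have hΦx : ContDiffAt 𝕜 ∞ (fun t => (Φ ∘ q) (t, w t)) x :=
      contDiffAt_comp_graph hSo hZ hw hx
    obtain ⟨Y, hY, hYX⟩ := exists_graph hΦx.fst hX hΦx.snd
    have h1 := (hmap x _ Y hy hx.2 hX hY hYX).1
      (by rw [hop x hxV w hw, hsys, Matrix.mulVec_zero])
    rw [← (iteratedDeriv_comp_eventuallyEq hΦx.fst hX hY hYX n).eq_of_nhds]
    exact h1

end Setup

/-! ### Transformations X = χ(x), Y = G(x) y + c(x). -/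

section Affine

variable {𝕜 : Type*} [RCLike 𝕜] {m : ℕ}

theorem isUnit_of_injective {L : (Fin m → 𝕜) →L[𝕜] (Fin m → 𝕜)} (h : Function.Injective L) :
    IsUnit L := by
  have h1 : IsUnit (LinearMap.toMatrix' L.toLinearMap) := by
    rw [← Matrix.mulVec_injective_iff_isUnit]
    intro v w hvw
    simpa [LinearMap.toMatrix'_mulVec] using h (by simpa [LinearMap.toMatrix'_mulVec] using hvw)
  rw [← toMatrix'_clm L]
  exact isUnit_clm h1

/-- The linear operators `(r d/dx)ⁿ ∘ G` and `rⁿ G ∘ (dⁿ/dxⁿ + ⋯)` agree if the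
solutions over a small ball of values are mapped to solutions. -/
theorem PsiV_iterate_eq_of_canonical {n : ℕ} (hn : 1 ≤ n) {A : ℕ → 𝕜 → Matrix (Fin m) (Fin m) 𝕜}
    {x : 𝕜} {r : 𝕜 → 𝕜} {G : 𝕜 → (Fin m → 𝕜) →L[𝕜] (Fin m → 𝕜)} {c : 𝕜 → Fin m → 𝕜}
    (hr : ContDiffAt 𝕜 ∞ r x) (hG : ContDiffAt 𝕜 ∞ G x) (hc : ContDiffAt 𝕜 ∞ c x)
    {y₀ : Fin m → 𝕜} {δ : ℝ} (hδ : 0 < δ)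
    (h : ∀ w : 𝕜 → Fin m → 𝕜, ContDiffAt 𝕜 ∞ w x → w x ∈ Metric.ball y₀ δ → sysOp n A w x = 0 →
      (PsiV r 0)^[n] (fun t => G t (w t) + c t) x = 0)
    {w : 𝕜 → Fin m → 𝕜} (hw : ContDiffAt 𝕜 ∞ w x) :
    (PsiV r 0)^[n] (fun t => G t (w t)) x = r x ^ n • G x (sysOp n A w x) := by
  have hs0 : ContDiffAt 𝕜 ∞ (0 : 𝕜 → 𝕜) x := contDiffAt_const
  have hfac : (n.factorial : 𝕜) ≠ 0 := by exact_mod_cast n.factorial_ne_zero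
  -- The two operators differ by a quantity independent of u: adding (t - x)ⁿ v makes u a solution
  -- at x and, as n ≥ 1, keeps its value there.
  have key : ∀ u : 𝕜 → Fin m → 𝕜, ContDiffAt 𝕜 ∞ u x → u x ∈ Metric.ball y₀ δ →
      (PsiV r 0)^[n] (fun t => G t (u t)) x - r x ^ n • G x (sysOp n A u x) =
        -(PsiV r 0)^[n] c x := by
    intro u hu hux
    set v : Fin m → 𝕜 := -((n.factorial : 𝕜)⁻¹ • sysOp n A u x) with hv
    have hp : ContDiffAt 𝕜 ∞ (fun t => (t - x) ^ n • v) x := contDiffAt_pow_smul contDiffAt_const n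
    have hGv : ContDiffAt 𝕜 ∞ (fun t => G t v) x := hG.clm_apply contDiffAt_const
    have h1 := h (u + fun t => (t - x) ^ n • v) (hu.add hp)
      (by simpa [show n ≠ 0 by omega] using hux)
      (by rw [sysOp_add _ _ hu hp, sysOp_pow_smul _ _ contDiffAt_const, hv, smul_neg, smul_smul,
            mul_inv_cancel₀ hfac, one_smul, add_neg_cancel])
    have h2 : (fun t => G t ((u + fun t => (t - x) ^ n • v) t) + c t) =
        ((fun t => G t (u t)) + fun t => (t - x) ^ n • G t v) + c := by
      ext1 t; simp
    have h3 : ContDiffAt 𝕜 ∞ ((fun t => G t (u t)) + fun t => (t - x) ^ n • G t v) x :=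
      (hG.clm_apply hu).add (contDiffAt_pow_smul hGv n)
    rw [h2, (PsiV_iterate_add hr hs0 h3 hc n).eq_of_nhds, Pi.add_apply,
      (PsiV_iterate_add hr hs0 (hG.clm_apply hu)
      (contDiffAt_pow_smul hGv n) n).eq_of_nhds, Pi.add_apply, PsiV_iterate_pow_smul hr hGv, hv,
      map_neg, map_smul, smul_neg, smul_smul] at h1
    rw [show (n.factorial : 𝕜) * r x ^ n * (n.factorial : 𝕜)⁻¹ = r x ^ n by field_simp] at h1
    rw [sub_eq_add_neg]
    exact eq_neg_of_add_eq_zero_left h1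
  -- The curve w may leave the ball, so the constant y₀ is compared with y₀ + l w for a small
  -- nonzero l; linearity then removes l.
  obtain ⟨l, hl0, hl⟩ : ∃ l : 𝕜, l ≠ 0 ∧ y₀ + l • w x ∈ Metric.ball y₀ δ := by
    have h1 : Filter.Tendsto (fun l : 𝕜 => y₀ + l • w x) (𝓝[≠] 0) (𝓝 y₀) := by
      have h2 : Continuous fun l : 𝕜 => y₀ + l • w x := by fun_prop
      simpa using (h2.tendsto 0).mono_left nhdsWithin_le_nhds
    obtain ⟨l, h2, h3⟩ := ((h1.eventually (Metric.ball_mem_nhds y₀ hδ)).and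
      self_mem_nhdsWithin).exists
    exact ⟨l, h3, h2⟩
  have hk : ContDiffAt 𝕜 ∞ (fun _ : 𝕜 => y₀) x := contDiffAt_const
  have hlw : ContDiffAt 𝕜 ∞ (l • w) x := contDiffAt_const.smul hw
  have h1 := key (fun _ => y₀) hk (Metric.mem_ball_self hδ)
  have h2 := key ((fun _ => y₀) + l • w) (hk.add hlw) hl
  have h3 : (fun t => G t (((fun _ : 𝕜 => y₀) + l • w) t)) =
      (fun t => G t y₀) + fun t => (l • ContinuousLinearMap.id 𝕜 (Fin m → 𝕜)) (G t (w t)) := by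
    ext1 t; simp
  rw [h3, (PsiV_iterate_add hr hs0 (hG.clm_apply hk)
    (contDiffAt_const.clm_apply (hG.clm_apply hw)) n).eq_of_nhds, Pi.add_apply,
    (PsiV_iterate_clm _ hr hs0 (hG.clm_apply hw) n).eq_of_nhds, sysOp_add _ _ hk hlw,
    sysOp_const_smul _ _ hw, map_add, map_smul, smul_add, ← h1] at h2
  have h4 : l • ((PsiV r 0)^[n] (fun t => G t (w t)) x - r x ^ n • G x (sysOp n A w x)) = 0 := by
    simp only [smul_apply, ContinuousLinearMap.id_apply] at h2
    rw [smul_sub, smul_comm l (r x ^ n)]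
    rw [← sub_eq_zero] at h2
    rw [← h2]; abel
  exact sub_eq_zero.1 ((smul_eq_zero.1 h4).resolve_left hl0)

theorem fderiv_apply_of_eventuallyEq_affine {χ : 𝕜 → 𝕜} {G : 𝕜 → (Fin m → 𝕜) →L[𝕜] (Fin m → 𝕜)}
    {c : 𝕜 → Fin m → 𝕜} {χ' : 𝕜} {G' : (Fin m → 𝕜) →L[𝕜] (Fin m → 𝕜)} {c' : Fin m → 𝕜} {x : 𝕜}
    {y : Fin m → 𝕜} (hχ : HasDerivAt χ χ' x) (hG : HasDerivAt G G' x) (hc : HasDerivAt c c' x)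
    {Z : 𝕜 × (Fin m → 𝕜) → 𝕜 × (Fin m → 𝕜)}
    (hZe : ∀ᶠ p in 𝓝 (x, y), Z p = (χ p.1, G p.1 p.2 + c p.1)) (a : 𝕜) (b : Fin m → 𝕜) :
    fderiv 𝕜 Z (x, y) (a, b) = (a • χ', a • (G' y + c') + G x b) := by
  have hfst : HasFDerivAt (fun p : 𝕜 × (Fin m → 𝕜) => p.1)
      (ContinuousLinearMap.fst 𝕜 𝕜 (Fin m → 𝕜)) (x, y) := hasFDerivAt_fst
  have h1 : HasFDerivAt (fun p : 𝕜 × (Fin m → 𝕜) => χ p.1) _ (x, y) :=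
    HasFDerivAt.comp (x, y) (g := χ) hχ.hasFDerivAt hfst
  have h2 : HasFDerivAt (fun p : 𝕜 × (Fin m → 𝕜) => G p.1) _ (x, y) :=
    HasFDerivAt.comp (x, y) (g := G) hG.hasFDerivAt hfst
  have h3 : HasFDerivAt (fun p : 𝕜 × (Fin m → 𝕜) => c p.1) _ (x, y) :=
    HasFDerivAt.comp (x, y) (g := c) hc.hasFDerivAt hfst
  have h4 := h1.prodMk ((h2.clm_apply hasFDerivAt_snd).add h3)
  rw [(h4.congr_of_eventuallyEq hZe).fderiv]
  simp
  abel

/-- From (r d/dx)ⁿ(G w) = rⁿ G(⋯) the order n - 1 coefficient gives r G' = s G, so G = g D with g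
scalar and D constant invertible. Then g cancels by conjugation and D by linearity. -/
theorem isUncoupledIterative_of_affine {n : ℕ} (hn : 1 ≤ n)
    {A : ℕ → 𝕜 → Matrix (Fin m) (Fin m) 𝕜} {x₀ : 𝕜} {ρ : ℝ} (hρ : 0 < ρ) {y₀ : Fin m → 𝕜} {δ : ℝ}
    (hδ : 0 < δ) (hA1 : ∀ x ∈ Metric.ball x₀ ρ, A 1 x = 0)
    {Z : 𝕜 × (Fin m → 𝕜) → 𝕜 × (Fin m → 𝕜)}
    (hZ : Linearizes n A (Metric.ball x₀ ρ ×ˢ Metric.ball y₀ δ) Z)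
    {χ : 𝕜 → 𝕜} {G : 𝕜 → (Fin m → 𝕜) →L[𝕜] (Fin m → 𝕜)} {c : 𝕜 → Fin m → 𝕜}
    (hχ : ContDiffOn 𝕜 ∞ χ (Metric.ball x₀ ρ)) (hG : ContDiffOn 𝕜 ∞ G (Metric.ball x₀ ρ))
    (hc : ContDiffOn 𝕜 ∞ c (Metric.ball x₀ ρ))
    (hZe : ∀ x ∈ Metric.ball x₀ ρ, ∀ y ∈ Metric.ball y₀ δ, Z (x, y) = (χ x, G x y + c x)) :
    IsUncoupledIterative n A x₀ := by
  have hbn : ∀ x ∈ Metric.ball x₀ ρ, Metric.ball x₀ ρ ∈ 𝓝 x := fun x hx =>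
    Metric.isOpen_ball.mem_nhds hx
  have hχd : ∀ x ∈ Metric.ball x₀ ρ, HasDerivAt χ (deriv χ x) x := fun x hx =>
    ((hχ.contDiffAt (hbn x hx)).differentiableAt infty_ne_zero).hasDerivAt
  have hGd : ∀ x ∈ Metric.ball x₀ ρ, HasDerivAt G (deriv G x) x := fun x hx =>
    ((hG.contDiffAt (hbn x hx)).differentiableAt infty_ne_zero).hasDerivAt
  have hcd : ∀ x ∈ Metric.ball x₀ ρ, HasDerivAt c (deriv c x) x := fun x hx =>
    ((hc.contDiffAt (hbn x hx)).differentiableAt infty_ne_zero).hasDerivAt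
  have hfd : ∀ x ∈ Metric.ball x₀ ρ, ∀ (a : 𝕜) (b : Fin m → 𝕜), fderiv 𝕜 Z (x, y₀) (a, b) =
      (a • deriv χ x, a • (deriv G x y₀ + deriv c x) + G x b) := by
    intro x hx a b
    have hnhds := hZ.isOpen.mem_nhds (x := (x, y₀)) ⟨hx, Metric.mem_ball_self hδ⟩
    refine fderiv_apply_of_eventuallyEq_affine (hχd x hx) (hGd x hx) (hcd x hx) ?_ a b
    filter_upwards [hnhds] with p hp using hZe p.1 hp.1 p.2 hp.2
  have hGu : ∀ x ∈ Metric.ball x₀ ρ, IsUnit (G x) := fun x hx => by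
    refine isUnit_of_injective fun b b' hb => ?_
    have h1 := hZ.injective (x, y₀) ⟨hx, Metric.mem_ball_self hδ⟩
      (a₁ := ((0 : 𝕜), b)) (a₂ := ((0 : 𝕜), b')) (by rw [hfd x hx, hfd x hx, hb])
    exact congrArg Prod.snd h1
  -- If χ' vanished at x, then (1, -G⁻¹(G' y₀ + c')) would lie in the kernel of DZ.
  have hχ0 : ∀ x ∈ Metric.ball x₀ ρ, deriv χ x ≠ 0 := fun x hx h0 => by
    have h1 : G x (Ring.inverse (G x) (-(deriv G x y₀ + deriv c x))) =
        -(deriv G x y₀ + deriv c x) := by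
      rw [← mul_apply_eq_comp, Ring.mul_inverse_cancel _ (hGu x hx)]; rfl
    have h2 := hZ.injective (x, y₀) ⟨hx, Metric.mem_ball_self hδ⟩
      (a₁ := ((1 : 𝕜), Ring.inverse (G x) (-(deriv G x y₀ + deriv c x)))) (a₂ := 0)
      (by rw [hfd x hx, h0, h1, map_zero]; simp)
    exact one_ne_zero (congrArg Prod.fst h2)
  set r : 𝕜 → 𝕜 := fun t => (deriv χ t)⁻¹ with hrdef
  have hr : ContDiffOn 𝕜 ∞ r (Metric.ball x₀ ρ) :=
    ((contDiffOn_infty_iff_deriv_of_isOpen Metric.isOpen_ball).1 hχ).2.inv hχ0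
  have hr0 : ∀ x ∈ Metric.ball x₀ ρ, r x ≠ 0 := fun x hx => inv_ne_zero (hχ0 x hx)
  have hmain : ∀ x ∈ Metric.ball x₀ ρ, ∀ w : 𝕜 → Fin m → 𝕜, ContDiffAt 𝕜 ∞ w x →
      (PsiV r 0)^[n] (fun t => G t (w t)) x = r x ^ n • G x (sysOp n A w x) := by
    intro x hx w hw
    refine PsiV_iterate_eq_of_canonical (y₀ := y₀) hn (hr.contDiffAt (hbn x hx))
      (hG.contDiffAt (hbn x hx))
      (hc.contDiffAt (hbn x hx)) hδ (fun u hu hux hsys => ?_) hw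
    have h1 : ∀ᶠ t in 𝓝 x, Z (t, u t) = (χ t, G t (u t) + c t) := by
      filter_upwards [hbn x hx, hu.continuousAt.eventually_mem (Metric.isOpen_ball.mem_nhds hux)]
        with t ht hut using hZe t ht _ hut
    have h2 : (fun t => (Z (t, u t)).1) =ᶠ[𝓝 x] χ := h1.mono fun t ht => by simp [ht]
    have h3 : (fun t => (Z (t, u t)).2) =ᶠ[𝓝 x] fun t => G t (u t) + c t :=
      h1.mono fun t ht => by simp [ht]
    rw [← hZ.canonical x u hu ⟨hx, hux⟩ (by rw [h2.deriv_eq]; exact hχ0 x hx) hsys]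
    refine ((PsiV_iterate_congr ?_ .rfl h3 n).eq_of_nhds).symm
    filter_upwards [h2.deriv] with t ht
    rw [ht]
  obtain ⟨k, rfl⟩ := Nat.exists_eq_add_of_le' hn
  set s : 𝕜 → 𝕜 := fun x => -((((k + 1 : ℕ) : 𝕜) - 1) / 2) * deriv r x with hsdef
  have hs : ContDiffOn 𝕜 ∞ s (Metric.ball x₀ ρ) := contDiffOn_const.mul
    ((contDiffOn_infty_iff_deriv_of_isOpen Metric.isOpen_ball).1 hr).2
  have hGv : ∀ x ∈ Metric.ball x₀ ρ, ∀ v, HasDerivAt (fun t => G t v) (deriv G x v) x :=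
    fun x hx v => by simpa using (hGd x hx).clm_apply (hasDerivAt_const x v)
  -- The test (t - x)ᵏ v with k = n - 1 gives 0 on the right because A₁ = 0 and v is constant.
  have hode : ∀ x ∈ Metric.ball x₀ ρ, ∀ v, r x • deriv G x v = s x • G x v := by
    intro x hx v
    have hrx := hr.contDiffAt (hbn x hx)
    have h1 := hmain x hx _ (contDiffAt_pow_smul (contDiffAt_const (c := v)) k)
    have h2 : (fun t => G t ((t - x) ^ k • v)) = fun t => (t - x) ^ k • G t v := by
      ext1 t; rw [map_smul]
    rw [h2, PsiV_iterate_succ_pow_smul hrx ((hG.contDiffAt (hbn x hx)).clm_apply contDiffAt_const),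
      sysOp_succ_pow_smul _ _ contDiffAt_const, hA1 x hx, (hGv x hx v).deriv, Matrix.zero_mulVec,
      deriv_const, smul_zero, add_zero, smul_zero, map_zero, smul_zero, smul_eq_zero] at h1
    have h3 : ((k + 1).factorial * r x ^ k : 𝕜) ≠ 0 :=
      mul_ne_zero (by exact_mod_cast (k + 1).factorial_ne_zero) (pow_ne_zero _ (hr0 x hx))
    rw [eq_neg_of_add_eq_zero_left (h1.resolve_left h3), hsdef, ← neg_smul]
    congr 1
    push_cast
    ring
  obtain ⟨ρ', hρ', hsub, g, hg, hg0, hg'⟩ := exists_multiplier Metric.isOpen_ball hr hs hr0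
    (Metric.mem_ball_self hρ)
  have hx₀ : x₀ ∈ Metric.ball x₀ ρ' := Metric.mem_ball_self hρ'
  set D : (Fin m → 𝕜) →L[𝕜] (Fin m → 𝕜) := (g x₀)⁻¹ • G x₀ with hD
  have hDinj : ∀ v, D v = 0 → v = 0 := fun v hv => by
    rw [hD, smul_apply] at hv
    have h1 := (smul_eq_zero.1 hv).resolve_left (inv_ne_zero (hg0 x₀ hx₀))
    have h2 : Ring.inverse (G x₀) (G x₀ v) = v := by
      rw [← mul_apply_eq_comp, Ring.inverse_mul_cancel _ (hGu x₀ (hsub hx₀))]; rfl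
    rw [← h2, h1, map_zero]
  -- G v and g satisfy the same first-order equation, so g⁻¹ G v is constant on the disc.
  have hGD : ∀ x ∈ Metric.ball x₀ ρ', ∀ v, G x v = g x • D v := by
    intro x hx v
    have h1 : ∀ t ∈ Metric.ball x₀ ρ', HasDerivAt (fun t => (g t)⁻¹ • G t v) 0 t := by
      intro t ht
      have h2 := ((hg' t ht).inv (hg0 t ht)).smul (hGv t (hsub ht) v)
      convert! h2 using 1
      have h3 : deriv G t v = (s t / r t) • G t v := by
        rw [div_eq_inv_mul, mul_smul, ← hode t (hsub ht) v, smul_smul,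
          inv_mul_cancel₀ (hr0 t (hsub ht)), one_smul]
      have h4 := hg0 t ht
      rw [h3, smul_smul, ← add_smul, eq_comm, smul_eq_zero]
      left
      simp only [Pi.inv_apply]
      field_simp
      ring
    have h2 := Metric.isOpen_ball.is_const_of_deriv_eq_zero
      (convex_ball x₀ ρ').isPreconnected
      (fun t ht => (h1 t ht).differentiableAt.differentiableWithinAt)
      (fun t ht => (h1 t ht).deriv) hx hx₀
    rw [hD, smul_apply, ← h2, smul_smul, mul_inv_cancel₀ (hg0 x hx), one_smul]
  refine ⟨Metric.ball x₀ ρ', r, s, Metric.isOpen_ball, hx₀, hr.mono hsub, hs.mono hsub,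
    fun x hx => hr0 x (hsub hx), fun x _ => rfl, fun x hx w hw i => ?_⟩
  have hx' := hbn x (hsub hx)
  have hrx := hr.contDiffAt hx'
  have hsx := hs.contDiffAt hx'
  have hDw : ContDiffAt 𝕜 ∞ (fun t => D (w t)) x := contDiffAt_const.clm_apply hw
  have h1 := hmain x (hsub hx) w hw
  have h2 : (fun t => G t (w t)) =ᶠ[𝓝 x] fun t => g t • D (w t) := by
    filter_upwards [Metric.isOpen_ball.mem_nhds hx] with t ht using hGD t ht _
  rw [(PsiV_iterate_congr .rfl .rfl h2 _).eq_of_nhds,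
    (PsiV_iterate_smul hrx hsx hDw (hg.contDiffAt (Metric.isOpen_ball.mem_nhds hx)) (by
      filter_upwards [Metric.isOpen_ball.mem_nhds hx] with t ht
      rw [(hg' t ht).deriv]
      have := hr0 t (hsub ht)
      field_simp) _).eq_of_nhds,
    (PsiV_iterate_clm D hrx hsx hw _).eq_of_nhds, hGD x hx, smul_comm (r x ^ _)] at h1
  have h3 := smul_right_injective _ (hg0 x hx) h1
  have h4 := sub_eq_zero.1 (hDinj ((PsiV r s)^[k + 1] w x - r x ^ (k + 1) • sysOp (k + 1) A w x)
    (by rw [map_sub, map_smul, sub_eq_zero]; exact h3))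
  rw [PsiV_iterate_apply hrx hsx hw, h4]
  rfl

end Affine

/-! ### Order at least three: the new independent variable depends on x only. -/

section BlowUp

variable {𝕜 : Type*} [RCLike 𝕜] {F : Type*} [NormedAddCommGroup F] [NormedSpace 𝕜 F] {m : ℕ}

/-- Smooth dependence of `(R(ε, ·) d/dσ)ʲ U(ε, ·)` on `(ε, σ)`. -/
theorem contDiffAt_PsiV_iterate_family {U : 𝕜 × 𝕜 → F} {R : 𝕜 × 𝕜 → 𝕜}
    (hU : ContDiffAt 𝕜 ∞ U 0) (hR : ContDiffAt 𝕜 ∞ R 0) (j : ℕ) :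
    ContDiffAt 𝕜 ∞ (fun p : 𝕜 × 𝕜 =>
      (PsiV (fun σ => R (p.1, σ)) 0)^[j] (fun σ => U (p.1, σ)) p.2) 0 := by
  induction j with
  | zero => exact hU
  | succ j ih =>
    set H : 𝕜 × 𝕜 → F := fun p => (PsiV (fun σ => R (p.1, σ)) 0)^[j] (fun σ => U (p.1, σ)) p.2
      with hH
    have h1 : ContDiffAt 𝕜 ∞ (fun p => R p • fderiv 𝕜 H p (0, 1)) 0 :=
      hR.smul ((ih.fderiv_right (m := ∞) (by simp)).clm_apply contDiffAt_const)
    refine h1.congr_of_eventuallyEq ?_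
    filter_upwards [ih.eventually_differentiableAt] with p hp
    simp only [Function.iterate_succ_apply']
    have h2 : HasDerivAt (fun σ : 𝕜 => (p.1, σ)) ((0 : 𝕜), (1 : 𝕜)) p.2 :=
      (hasDerivAt_const p.2 p.1).prodMk (hasDerivAt_id p.2)
    have h3 : HasDerivAt (fun σ => H (p.1, σ)) (fderiv 𝕜 H p (0, 1)) p.2 :=
      HasFDerivAt.comp_hasDerivAt (f := fun σ : 𝕜 => (p.1, σ)) (l := H) p.2 hp.hasFDerivAt h2
    simp only [hH] at h3
    simp only [PsiV, Pi.zero_apply, zero_smul, add_zero]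
    rw [h3.deriv]

/-- Smooth dependence on ε lets the rescaled equation pass to the limit ε = 0, where the test curve
itself is singular. -/
theorem PsiV_iterate_family_eq_zero {U : 𝕜 × 𝕜 → F} {R : 𝕜 × 𝕜 → 𝕜}
    (hU : ContDiffAt 𝕜 ∞ U 0) (hR : ContDiffAt 𝕜 ∞ R 0) (j : ℕ)
    (h : ∀ ε : 𝕜, ε ≠ 0 → (PsiV (fun σ => R (ε, σ)) 0)^[j] (fun σ => U (ε, σ)) 0 = 0) :
    (PsiV (fun σ => R (0, σ)) 0)^[j] (fun σ => U (0, σ)) 0 = 0 := by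
  have h1 := (contDiffAt_PsiV_iterate_family hU hR j).continuousAt
  have h2 : Filter.Tendsto (fun ε : 𝕜 => ((ε, 0) : 𝕜 × 𝕜)) (𝓝[≠] 0) (𝓝 0) := by
    have h3 : Continuous fun ε : 𝕜 => ((ε, 0) : 𝕜 × 𝕜) := by fun_prop
    exact (h3.tendsto 0).mono_left nhdsWithin_le_nhds
  have h4 := h1.tendsto.comp h2
  have h5 : Filter.Tendsto (fun _ : 𝕜 => (0 : F)) (𝓝[≠] (0 : 𝕜)) (𝓝 0) := tendsto_const_nhds
  refine tendsto_nhds_unique (h4.congr' ?_) h5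
  filter_upwards [self_mem_nhdsWithin] with ε hε using h ε hε

/-- The first derivative of the quotient carries the determinant αδ - βγ; each further application
multiplies by -(2j + 3)β and raises the exponent by 2, so nothing but the determinant can vanish. -/
theorem PsiV_iterate_linear_fractional {α β : 𝕜} (hα : α ≠ 0) (hβ : β ≠ 0) (γ δ : F) (j : ℕ) :
    ∃ c : 𝕜, c ≠ 0 ∧ (PsiV (fun σ => (α + β * σ)⁻¹) 0)^[j + 1]
      (fun σ => (α + β * σ)⁻¹ • (γ + σ • δ)) =ᶠ[𝓝 0]
      fun σ => (c * (α + β * σ)⁻¹ ^ (2 * j + 3)) • (α • δ - β • γ) := by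
  have hne : ∀ᶠ σ in 𝓝 (0 : 𝕜), α + β * σ ≠ 0 := by
    have h1 : Continuous fun σ : 𝕜 => α + β * σ := by fun_prop
    exact h1.continuousAt.eventually_ne (by simpa using hα)
  have hd : ∀ σ : 𝕜, α + β * σ ≠ 0 →
      HasDerivAt (fun σ => (α + β * σ)⁻¹) (-β / (α + β * σ) ^ 2) σ := by
    intro σ h
    have h1 : HasDerivAt (fun σ => α + β * σ) β σ := by
      simpa using ((hasDerivAt_id σ).const_mul β).const_add α
    exact h1.inv h
  induction j with
  | zero =>
    refine ⟨1, one_ne_zero, ?_⟩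
    filter_upwards [hne] with σ h
    have h1 : HasDerivAt (fun σ : 𝕜 => γ + σ • δ) δ σ := by
      simpa using ((hasDerivAt_id σ).smul_const δ).const_add γ
    have h2 : deriv (fun σ => (α + β * σ)⁻¹ • (γ + σ • δ)) σ = _ := ((hd σ h).smul h1).deriv
    simp only [zero_add, Function.iterate_one, PsiV, Pi.zero_apply, zero_smul, add_zero]
    rw [h2]
    simp only [mul_zero, zero_add, inv_pow]
    match_scalars <;> field_simp
    ring
  | succ j ih =>
    obtain ⟨c, hc, ih⟩ := ih
    refine ⟨-(2 * j + 3 : ℕ) * β * c, mul_ne_zero (mul_ne_zero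
      (neg_ne_zero.2 (by exact_mod_cast (by omega : 2 * j + 3 ≠ 0))) hβ) hc, ?_⟩
    rw [Function.iterate_succ_apply']
    refine (PsiV_congr .rfl .rfl ih).trans ?_
    filter_upwards [hne] with σ h
    have h2 : deriv (fun σ => (c * (α + β * σ)⁻¹ ^ (2 * j + 3)) • (α • δ - β • γ)) σ = _ :=
      ((((hd σ h).pow (2 * j + 3)).const_mul c).smul_const _).deriv
    simp only [PsiV, Pi.zero_apply, zero_smul, add_zero]
    rw [h2, smul_smul]
    congr 1
    rw [show 2 * j + 3 - 1 = 2 * j + 2 by omega, show 2 * (j + 1) + 3 = 2 * j + 2 + 3 by omega,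
      pow_add _ _ 3, inv_pow _ 3]
    field_simp

theorem exists_fst_ne_zero {L : 𝕜 × (Fin m → 𝕜) →L[𝕜] 𝕜 × (Fin m → 𝕜)} {v : Fin m → 𝕜}
    (hv : (L (0, v)).1 ≠ 0) : ∃ p, (L (1, p)).1 ≠ 0 := by
  by_cases h : (L (1, 0)).1 = 0
  · refine ⟨v, ?_⟩
    have h1 : ((1 : 𝕜), v) = (1, 0) + (0, v) := by simp
    rw [h1, map_add, Prod.fst_add, h, zero_add]
    exact hv
  · exact ⟨0, h⟩

theorem deriv_fst {f : 𝕜 → 𝕜 × F} {f' : 𝕜 × F} {x : 𝕜} (h : HasDerivAt f f' x) :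
    deriv (fun t => (f t).1) x = f'.1 :=
  ((ContinuousLinearMap.fst 𝕜 𝕜 F).hasFDerivAt.comp_hasDerivAt x h).deriv

theorem deriv_snd {f : 𝕜 → 𝕜 × F} {f' : 𝕜 × F} {x : 𝕜} (h : HasDerivAt f f' x) :
    deriv (fun t => (f t).2) x = f'.2 :=
  ((ContinuousLinearMap.snd 𝕜 𝕜 F).hasFDerivAt.comp_hasDerivAt x h).deriv

/-- For order at least three the new independent variable depends on `x` only. -/
theorem Linearizes.fst_fderiv_eq_zero {n : ℕ} (hn : 3 ≤ n) {A : ℕ → 𝕜 → Matrix (Fin m) (Fin m) 𝕜}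
    {S : Set (𝕜 × (Fin m → 𝕜))} {Z : 𝕜 × (Fin m → 𝕜) → 𝕜 × (Fin m → 𝕜)}
    (h : Linearizes n A S Z) {x : 𝕜} {y : Fin m → 𝕜} (hxy : (x, y) ∈ S) (v : Fin m → 𝕜) :
    (fderiv 𝕜 Z (x, y) (0, v)).1 = 0 := by
  by_contra hb
  obtain ⟨p, hp⟩ := exists_fst_ne_zero hb
  obtain ⟨j, rfl⟩ := Nat.exists_eq_add_of_le' hn
  have hfac : ((j + 3).factorial : 𝕜) ≠ 0 := by exact_mod_cast (j + 3).factorial_ne_zero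
  set c₀ := sysOp (j + 3) A (fun t => y + (t - x) • p) x with hc₀
  set c₁ := sysOp (j + 3) A (fun t => (t - x) ^ 2 • v) x with hc₁
  -- The order is n = j + 3. The test curve is y + (t - x)p + ε⁻¹(t - x)²v + ε⁻⁽ʲ⁺²⁾(t - x)ⁿ e(ε).
  -- Its quadratic coefficient is free since n ≥ 3; e(ε) makes it a solution at x and tends to 0.
  let e : 𝕜 → Fin m → 𝕜 := fun ε =>
    -(((j + 3).factorial : 𝕜)⁻¹ • (ε ^ (j + 2) • c₀ + ε ^ (j + 1) • c₁))
  have he : ContDiff 𝕜 ∞ e := by fun_prop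
  have he0 : e 0 = 0 := by simp [e]
  -- With P = (ε, σ), q is the point of the test curve at t = x + εσ and k below is its velocity in
  -- t. Both extend smoothly to ε = 0.
  let q : 𝕜 × 𝕜 → 𝕜 × (Fin m → 𝕜) := fun P => (x + P.1 * P.2,
    y + P.1 • (P.2 • p + P.2 ^ 2 • v + P.2 ^ (j + 3) • e P.1))
  let k : 𝕜 × 𝕜 → 𝕜 × (Fin m → 𝕜) := fun P =>
    (1, p + (2 * P.2) • v + ((j + 3 : 𝕜) * P.2 ^ (j + 2)) • e P.1)
  have hq : ContDiff 𝕜 ∞ q := by fun_prop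
  have hk : ContDiff 𝕜 ∞ k := by fun_prop
  have hq0 : ∀ ε, q (ε, 0) = (x, y) := fun ε => by simp [q]
  have hk0 : ∀ ε, k (ε, 0) = (1, p) := fun ε => by simp [k]
  have hD : ContDiffAt 𝕜 ∞ (fun P => fderiv 𝕜 Z (q P) (k P)) 0 := by
    have h1 : ContDiffAt 𝕜 ∞ (fderiv 𝕜 Z) (q 0) := by
      rw [show (0 : 𝕜 × 𝕜) = (0, 0) from rfl, hq0]
      exact (h.contDiffOn.contDiffAt (h.isOpen.mem_nhds hxy)).fderiv_right (by simp)
    exact (h1.comp 0 hq.contDiffAt).clm_apply hk.contDiffAt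
  have hN0 : ∀ ε, (fderiv 𝕜 Z (q (ε, 0)) (k (ε, 0))).1 ≠ 0 := fun ε => by
    rw [hq0, hk0]; exact hp
  have hR : ContDiffAt 𝕜 ∞ (fun P => ((fderiv 𝕜 Z (q P) (k P)).1)⁻¹) 0 := hD.fst.inv (hN0 0)
  have hU : ContDiffAt 𝕜 ∞ (fun P => ((fderiv 𝕜 Z (q P) (k P)).1)⁻¹ •
      (fderiv 𝕜 Z (q P) (k P)).2) 0 := hR.smul hD.snd
  -- The function differentiated is already the slope dY/dX, so n - 1 = j + 2 applications remain.
  have key := PsiV_iterate_family_eq_zero hU hR (j + 2) ?_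
  · obtain ⟨c, hc, hlf⟩ := PsiV_iterate_linear_fractional hp
      (mul_ne_zero two_ne_zero hb) (fderiv 𝕜 Z (x, y) (1, p)).2
      ((2 : 𝕜) • (fderiv 𝕜 Z (x, y) (0, v)).2) (j + 1)
    have hk' : ∀ σ : 𝕜, fderiv 𝕜 Z (q (0, σ)) (k (0, σ)) =
        fderiv 𝕜 Z (x, y) (1, p) + (2 * σ) • fderiv 𝕜 Z (x, y) (0, v) := by
      intro σ
      rw [show q (0, σ) = (x, y) by simp [q], ← map_smul, ← map_add]
      congr 1
      simp [k, he0]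
    have h1 : (fun σ : 𝕜 => ((fderiv 𝕜 Z (q (0, σ)) (k (0, σ))).1)⁻¹) =
        fun σ => ((fderiv 𝕜 Z (x, y) (1, p)).1 + 2 * (fderiv 𝕜 Z (x, y) (0, v)).1 * σ)⁻¹ := by
      ext1 σ
      rw [hk']
      congr 1
      simp only [Prod.fst_add, Prod.smul_fst, smul_eq_mul]
      ring
    have h2 : (fun σ : 𝕜 => ((fderiv 𝕜 Z (q (0, σ)) (k (0, σ))).1)⁻¹ •
        (fderiv 𝕜 Z (q (0, σ)) (k (0, σ))).2) =
        fun σ => ((fderiv 𝕜 Z (x, y) (1, p)).1 + 2 * (fderiv 𝕜 Z (x, y) (0, v)).1 * σ)⁻¹ •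
          ((fderiv 𝕜 Z (x, y) (1, p)).2 + σ • (2 : 𝕜) • (fderiv 𝕜 Z (x, y) (0, v)).2) := by
      ext1 σ
      rw [← congrFun h1 σ, hk']
      congr 1
      rw [Prod.snd_add, Prod.smul_snd, smul_smul, mul_comm]
    rw [h1, h2, hlf.eq_of_nhds] at key
    have h3 := (smul_eq_zero.1 key).resolve_left
      (mul_ne_zero hc (pow_ne_zero _ (inv_ne_zero (by simpa using hp))))
    -- The vanishing determinant exhibits a kernel vector of DZ whose first component is -2 times
    -- the quantity supposed nonzero.
    have h4 : fderiv 𝕜 Z (x, y) ((fderiv 𝕜 Z (x, y) (1, p)).1 • (2 : 𝕜) • ((0 : 𝕜), v) -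
        (2 * (fderiv 𝕜 Z (x, y) (0, v)).1) • ((1 : 𝕜), p)) = 0 := by
      rw [map_sub, map_smul, map_smul, map_smul]
      refine Prod.ext ?_ ?_
      · simp only [Prod.fst_sub, Prod.smul_fst, smul_eq_mul, Prod.fst_zero]; ring
      · simpa only [Prod.snd_sub, Prod.smul_snd, Prod.snd_zero] using h3
    have h5 := h.injective _ hxy (h4.trans (map_zero _).symm)
    have h6 := congrArg Prod.fst h5
    simp at h6
    exact hb h6
  · intro ε hε
    let w : 𝕜 → Fin m → 𝕜 := fun t => y + (t - x) • p + (ε⁻¹ • (t - x) ^ 2 • v +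
      (ε ^ (j + 2))⁻¹ • (t - x) ^ (j + 3) • e ε)
    have hw : ContDiff 𝕜 ∞ w := by fun_prop
    have hwx : w x = y := by simp [w]
    have hws : ∀ σ, (x + ε * σ, w (x + ε * σ)) = q (ε, σ) := by
      intro σ
      refine Prod.ext rfl ?_
      simp only [w, q, add_sub_cancel_left, mul_pow]
      match_scalars <;> field_simp <;> ring
    have hwd : ∀ σ, HasDerivAt (fun t => (t, w t)) (k (ε, σ)) (x + ε * σ) := by
      intro σ
      have h0 : HasDerivAt (fun t : 𝕜 => t - x) 1 (x + ε * σ) := (hasDerivAt_id _).sub_const x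
      have h1 : HasDerivAt (fun t : 𝕜 => (t - x) ^ 2) (2 * (ε * σ)) (x + ε * σ) := by
        simpa using! h0.pow 2
      have h2 : HasDerivAt (fun t : 𝕜 => (t - x) ^ (j + 3)) ((j + 3 : 𝕜) * (ε * σ) ^ (j + 2))
          (x + ε * σ) := by
        simpa using! h0.pow (j + 3)
      have h3 := (hasDerivAt_id (x + ε * σ)).prodMk (((h0.smul_const p).const_add y).add
        (((h1.smul_const v).const_smul ε⁻¹).add ((h2.smul_const (e ε)).const_smul (ε ^ (j + 2))⁻¹)))
      convert! h3 using 1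
      refine Prod.ext rfl ?_
      simp only [k, mul_pow]
      match_scalars <;> field_simp
    have hsys : sysOp (j + 3) A w x = 0 := by
      have h1 : ContDiffAt 𝕜 ∞ (fun t => y + (t - x) • p) x := by fun_prop
      have h2 : ContDiffAt 𝕜 ∞ (fun t => (t - x) ^ 2 • v) x := by fun_prop
      have h3 : ContDiffAt 𝕜 ∞ (fun t => (t - x) ^ (j + 3) • e ε) x := by fun_prop
      have h4 : w = (fun t => y + (t - x) • p) + ((ε⁻¹ • fun t => (t - x) ^ 2 • v) +
        ((ε ^ (j + 2))⁻¹ • fun t => (t - x) ^ (j + 3) • e ε)) := rfl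
      have h5 : ContDiffAt 𝕜 ∞ (ε⁻¹ • fun t => (t - x) ^ 2 • v) x := contDiffAt_const.smul h2
      have h6 : ContDiffAt 𝕜 ∞ ((ε ^ (j + 2))⁻¹ • fun t => (t - x) ^ (j + 3) • e ε) x :=
        contDiffAt_const.smul h3
      have h7 : ContDiffAt 𝕜 ∞ ((ε⁻¹ • fun t => (t - x) ^ 2 • v) +
          ((ε ^ (j + 2))⁻¹ • fun t => (t - x) ^ (j + 3) • e ε)) x := h5.add h6
      rw [h4, sysOp_add _ _ h1 h7, sysOp_add _ _ h5 h6,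
        sysOp_const_smul _ _ h2, sysOp_const_smul _ _ h3, sysOp_pow_smul _ _ contDiffAt_const,
        ← hc₀, ← hc₁]
      simp only [e]
      match_scalars <;> field_simp <;> ring
    have hZd : ∀ᶠ σ in 𝓝 (0 : 𝕜), HasDerivAt (fun t => Z (t, w t))
        (fderiv 𝕜 Z (q (ε, σ)) (k (ε, σ))) (x + ε * σ) := by
      have h1 : Continuous fun σ : 𝕜 => q (ε, σ) := hq.continuous.comp (by fun_prop)
      filter_upwards [h1.continuousAt.eventually_mem (h.isOpen.mem_nhds
        (show q (ε, 0) ∈ S by rw [hq0]; exact hxy))] with σ hσ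
      have h2 : HasFDerivAt Z (fderiv 𝕜 Z (q (ε, σ))) (x + ε * σ, w (x + ε * σ)) := by
        rw [hws]
        exact ((h.contDiffOn.contDiffAt (h.isOpen.mem_nhds hσ)).differentiableAt
          infty_ne_zero).hasFDerivAt
      exact h2.comp_hasDerivAt (f := fun t => (t, w t)) _ (hwd σ)
    have hfst : ∀ᶠ σ in 𝓝 (0 : 𝕜), deriv (fun t => (Z (t, w t)).1) (x + ε * σ) =
        (fderiv 𝕜 Z (q (ε, σ)) (k (ε, σ))).1 := 
      hZd.mono fun σ hσ => deriv_fst hσ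
    have hsnd : ∀ᶠ σ in 𝓝 (0 : 𝕜), deriv (fun t => (Z (t, w t)).2) (x + ε * σ) =
        (fderiv 𝕜 Z (q (ε, σ)) (k (ε, σ))).2 := 
      hZd.mono fun σ hσ => deriv_snd hσ
    have hcan := h.canonical x w hw.contDiffAt (by rw [hwx]; exact hxy)
      (by have := hfst.self_of_nhds
          rw [mul_zero, add_zero] at this
          rw [this]; exact hN0 ε) hsys
    rw [Function.iterate_succ_apply] at hcan
    have haff := PsiV_iterate_comp_affine (fun t => (deriv (fun t => (Z (t, w t)).1) t)⁻¹)
      (PsiV (fun t => (deriv (fun t => (Z (t, w t)).1) t)⁻¹) 0 fun t => (Z (t, w t)).2)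
      x ε (j + 2) 0
    rw [mul_zero, add_zero, hcan, smul_zero] at haff
    rw [← haff]
    refine ((PsiV_iterate_congr ?_ .rfl ?_ _).eq_of_nhds).symm
    · filter_upwards [hfst] with σ hσ
      rw [hσ]
    · filter_upwards [hfst, hsnd] with σ h1 h2
      simp only [PsiV, Pi.zero_apply, zero_smul, add_zero, h1, h2]

end BlowUp

/-! ### Order at least three: the new dependent variable is affine in y. -/

section AffineInValue

variable {𝕜 : Type*} [RCLike 𝕜] {m : ℕ}

theorem natCast_le_infty (k : ℕ) : (k : WithTop ℕ∞) ≤ ∞ := by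
  exact_mod_cast (le_top : (k : ℕ∞) ≤ ⊤)

theorem iteratedDeriv_pow_add_pow_sq (j : ℕ) :
    iteratedDeriv (j + 3) (fun σ : 𝕜 => (σ + σ ^ (j + 2)) ^ 2) 0 = 2 * (j + 3).factorial := by
  have h1 : (fun σ : 𝕜 => (σ + σ ^ (j + 2)) ^ 2) =
      (fun σ => σ ^ 2) + ((2 : 𝕜) • (fun σ => σ ^ (j + 3)) + fun σ => σ ^ (2 * j + 4)) := by
    ext1 σ
    simp only [Pi.add_apply, Pi.smul_apply, smul_eq_mul]
    ring
  have h2 : ContDiffAt 𝕜 (j + 3 : ℕ)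
      ((2 : 𝕜) • (fun σ => σ ^ (j + 3)) + fun σ : 𝕜 => σ ^ (2 * j + 4)) 0 :=
    ContDiffAt.add (by fun_prop) (by fun_prop)
  rw [h1, iteratedDeriv_add (by fun_prop) h2,
    iteratedDeriv_add (by fun_prop) (by fun_prop), iteratedDeriv_const_smul_field]
  rw [iteratedDeriv_fun_pow_zero, iteratedDeriv_fun_pow_zero, iteratedDeriv_fun_pow_zero]
  simp [show j + 3 ≠ 2 by omega, show j ≠ 2 * j + 1 by omega]

/-- By Faà di Bruno the hypothesis is a polynomial identity in ε, and its ε² coefficient is a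
universal constant times g''(0). The shape σ + σʲ⁺² is chosen to make that constant nonzero. -/
theorem iteratedDeriv_two_eq_zero_of_comp {g : 𝕜 → Fin m → 𝕜} (hg : ContDiffAt 𝕜 ∞ g 0) (j : ℕ)
    (h : ∀ ε : 𝕜, iteratedDeriv (j + 3) (fun σ => g (ε * (σ + σ ^ (j + 2)))) 0 = 0) :
    iteratedDeriv 2 g 0 = 0 := by
  let K : OrderedFinpartition (j + 3) → 𝕜 := fun c =>
    ∏ i, iteratedDeriv (c.partSize i) (fun σ : 𝕜 => σ + σ ^ (j + 2)) 0
  have hc : ∀ ε : 𝕜, ContDiffAt 𝕜 ∞ (fun σ : 𝕜 => ε * (σ + σ ^ (j + 2))) 0 := fun ε => by fun_prop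
  have h1 : ∀ {f : 𝕜 → 𝕜}, ContDiffAt 𝕜 ∞ f 0 → ∀ ε : 𝕜,
      iteratedDeriv (j + 3) (fun σ => f (ε * (σ + σ ^ (j + 2)))) 0 =
        ∑ c : OrderedFinpartition (j + 3), K c * iteratedDeriv c.length f 0 * ε ^ c.length := by
    intro f hf ε
    have h2 := iteratedDeriv_scomp_eq_sum_orderedFinpartition (g := f) (x := (0 : 𝕜))
      (f := fun σ : 𝕜 => ε * (σ + σ ^ (j + 2))) (i := j + 3) (by simpa using hf) (hc ε)
      (natCast_le_infty _)
    refine h2.trans (Finset.sum_congr rfl fun c _ => ?_)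
    have h3 : ∀ k, iteratedDeriv k (fun σ : 𝕜 => ε * (σ + σ ^ (j + 2))) 0 =
        ε * iteratedDeriv k (fun σ : 𝕜 => σ + σ ^ (j + 2)) 0 := fun k =>
      iteratedDeriv_const_mul_field ..
    simp only [h3, Finset.prod_mul_distrib, Finset.prod_const, Finset.card_univ, Fintype.card_fin]
    simp [K]
    ring
  -- The constant is evaluated on g(t) = t²: the square of σ + σʲ⁺² contains 2σʲ⁺³, whose derivative
  -- of order j + 3 is 2 (j + 3)!.
  have h4 : ∑ c : OrderedFinpartition (j + 3), (if c.length = 2 then K c else 0) ≠ 0 := by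
    intro h0
    have h5 := h1 (f := fun t => t ^ 2) (by fun_prop) 1
    simp only [one_mul, iteratedDeriv_pow_add_pow_sq, one_pow, mul_one,
      iteratedDeriv_fun_pow_zero] at h5
    have h6 : ∑ c : OrderedFinpartition (j + 3), (if c.length = 2 then K c else 0) * 2 = 0 := by
      rw [← Finset.sum_mul, h0, zero_mul]
    refine mul_ne_zero (two_ne_zero (α := 𝕜)) (by exact_mod_cast (j + 3).factorial_ne_zero)
      (h5.trans (Eq.trans (Finset.sum_congr rfl fun c _ => ?_) h6))
    by_cases hl : c.length = 2
    · simp [hl]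
    · simp [hl]
  funext i
  have hgi : ContDiffAt 𝕜 ∞ (fun t => g t i) 0 := contDiffAt_pi.1 hg i
  have happ : ∀ {f : 𝕜 → Fin m → 𝕜}, ContDiffAt 𝕜 ∞ f 0 → ∀ k,
      iteratedDeriv k f 0 i = iteratedDeriv k (fun t => f t i) 0 := by
    intro f hf k
    have h2 := (PsiV_iterate_clm (ContinuousLinearMap.proj (R := 𝕜) (φ := fun _ : Fin m => 𝕜) i)
      (contDiffAt_const (c := (1 : 𝕜))) contDiffAt_const hf k (s := 0)).eq_of_nhds
    rw [iteratedDeriv_eq_PsiV hf, iteratedDeriv_eq_PsiV (contDiffAt_pi.1 hf i)]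
    exact h2.symm
  let P : Polynomial 𝕜 := ∑ c : OrderedFinpartition (j + 3),
    Polynomial.C (K c * iteratedDeriv c.length (fun t => g t i) 0) * Polynomial.X ^ c.length
  have hP : P = 0 := by
    refine Polynomial.funext fun ε => ?_
    rw [Polynomial.eval_zero, Polynomial.eval_finsetSum]
    have h5 := congrFun (h ε) i
    have h6 : ContDiffAt 𝕜 ∞ (fun σ => g (ε * (σ + σ ^ (j + 2)))) 0 :=
      ContDiffAt.comp (g := g) 0 (by simpa using hg) (hc ε)
    rw [happ h6, Pi.zero_apply] at h5
    refine Eq.trans ?_ ((h1 hgi ε).symm.trans h5)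
    simp
  have h6 : P.coeff 2 = (∑ c : OrderedFinpartition (j + 3), (if c.length = 2 then K c else 0)) *
      iteratedDeriv 2 (fun t => g t i) 0 := by
    rw [Polynomial.finsetSum_coeff, Finset.sum_mul]
    refine Finset.sum_congr rfl fun c _ => ?_
    rw [Polynomial.coeff_C_mul_X_pow]
    by_cases hl : c.length = 2
    · simp [hl]
    · simp [hl, Ne.symm hl]
  rw [hP, Polynomial.coeff_zero] at h6
  rw [happ hg, Pi.zero_apply]
  exact (mul_eq_zero.1 h6.symm).resolve_left h4

/-- At t = x + εσ the test curve is y + (σ + σⁿ⁻¹)p + σⁿ e(ε) with n = j + 3. In the limit ε = 0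
time stands still at x while the value still moves along p, and d/dX becomes d/dσ up to the constant
χ'(x). -/
theorem Linearizes.iteratedDeriv_snd_eq_zero {j : ℕ} {A : ℕ → 𝕜 → Matrix (Fin m) (Fin m) 𝕜}
    {S : Set (𝕜 × (Fin m → 𝕜))} {Z : 𝕜 × (Fin m → 𝕜) → 𝕜 × (Fin m → 𝕜)}
    (h : Linearizes (j + 3) A S Z) {x : 𝕜} {y : Fin m → 𝕜} (hxy : (x, y) ∈ S) {χ : 𝕜 → 𝕜}
    (hχ : ContDiffAt 𝕜 ∞ χ x) (hχ0 : deriv χ x ≠ 0) (hZ : ∀ z ∈ S, (Z z).1 = χ z.1)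
    (p : Fin m → 𝕜) :
    iteratedDeriv (j + 3) (fun σ : 𝕜 => (Z (x, y + (σ + σ ^ (j + 2)) • p)).2) 0 = 0 := by
  have hfac : ((j + 3).factorial : 𝕜) ≠ 0 := by exact_mod_cast (j + 3).factorial_ne_zero
  set c₀ := sysOp (j + 3) A (fun _ => y) x with hc₀
  set c₁ := sysOp (j + 3) A (fun t => (t - x) • p) x with hc₁
  set c₂ := sysOp (j + 3) A (fun t => (t - x) ^ (j + 2) • p) x with hc₂
  -- The correction again makes the curve a solution at x; after rescaling it carries positive
  -- powers of ε, so it disappears at ε = 0.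
  let e : 𝕜 → Fin m → 𝕜 := fun ε =>
    -(((j + 3).factorial : 𝕜)⁻¹ • (ε ^ (j + 3) • c₀ + ε ^ (j + 2) • c₁ + ε • c₂))
  have he : ContDiff 𝕜 ∞ e := by fun_prop
  have he0 : e 0 = 0 := by simp [e]
  let q : 𝕜 × 𝕜 → 𝕜 × (Fin m → 𝕜) := fun P => (x + P.1 * P.2,
    y + ((P.2 + P.2 ^ (j + 2)) • p + P.2 ^ (j + 3) • e P.1))
  have hq : ContDiff 𝕜 ∞ q := by fun_prop
  have hq0 : ∀ ε, q (ε, 0) = (x, y) := fun ε => by simp [q]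
  have hZs := h.contDiffOn.contDiffAt (h.isOpen.mem_nhds hxy)
  have hU : ContDiffAt 𝕜 ∞ (fun P => (Z (q P)).2) 0 := by
    refine ContDiffAt.snd (f := fun P => Z (q P)) (ContDiffAt.comp (g := Z) 0 ?_ hq.contDiffAt)
    rw [show (0 : 𝕜 × 𝕜) = (0, 0) from rfl, hq0]
    exact hZs
  have hR : ContDiffAt 𝕜 ∞ (fun P : 𝕜 × 𝕜 => (deriv χ (x + P.1 * P.2))⁻¹) 0 := by
    refine ContDiffAt.inv (f := fun P : 𝕜 × 𝕜 => deriv χ (x + P.1 * P.2))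
      (ContDiffAt.comp (g := deriv χ) 0 (by simpa using hχ.deriv_infty) (by fun_prop))
      (by simpa using hχ0)
  have key := PsiV_iterate_family_eq_zero hU hR (j + 3) ?_
  · have h1 : (fun σ => (Z (q (0, σ))).2) = fun σ : 𝕜 => (Z (x, y + (σ + σ ^ (j + 2)) • p)).2 := by
      ext1 σ; simp [q, he0]
    have h2 : ContDiffAt 𝕜 ∞ (fun σ : 𝕜 => (Z (x, y + (σ + σ ^ (j + 2)) • p)).2) 0 := by
      refine ContDiffAt.snd (f := fun σ : 𝕜 => Z (x, y + (σ + σ ^ (j + 2)) • p))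
        (ContDiffAt.comp (g := Z) 0 (by simpa using hZs) (by fun_prop))
    simp only [zero_mul, add_zero] at key
    rw [h1, (PsiV_iterate_const _ _ h2 _).eq_of_nhds, smul_eq_zero] at key
    exact key.resolve_left (pow_ne_zero _ (inv_ne_zero hχ0))
  · intro ε hε
    let w : 𝕜 → Fin m → 𝕜 := fun t => y + (ε⁻¹ • (t - x) • p +
      ((ε ^ (j + 2))⁻¹ • (t - x) ^ (j + 2) • p +
      (ε ^ (j + 3))⁻¹ • (t - x) ^ (j + 3) • e ε))
    have hw : ContDiff 𝕜 ∞ w := by fun_prop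
    have hwx : w x = y := by simp [w]
    have hws : ∀ σ, (x + ε * σ, w (x + ε * σ)) = q (ε, σ) := by
      intro σ
      refine Prod.ext rfl ?_
      simp only [w, q, add_sub_cancel_left, mul_pow]
      match_scalars <;> field_simp
    have hsys : sysOp (j + 3) A w x = 0 := by
      have h0 : ContDiffAt 𝕜 ∞ (fun _ : 𝕜 => y) x := contDiffAt_const
      have h1 : ContDiffAt 𝕜 ∞ (fun t => (t - x) • p) x := by fun_prop
      have h2 : ContDiffAt 𝕜 ∞ (fun t => (t - x) ^ (j + 2) • p) x := by fun_prop
      have h3 : ContDiffAt 𝕜 ∞ (fun t => (t - x) ^ (j + 3) • e ε) x := by fun_prop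
      have h4 : w = (fun _ => y) + ((ε⁻¹ • fun t => (t - x) • p) +
        (((ε ^ (j + 2))⁻¹ • fun t => (t - x) ^ (j + 2) • p) +
          ((ε ^ (j + 3))⁻¹ • fun t => (t - x) ^ (j + 3) • e ε))) := rfl
      have h5 : ContDiffAt 𝕜 ∞ (ε⁻¹ • fun t => (t - x) • p) x := contDiffAt_const.smul h1
      have h6 : ContDiffAt 𝕜 ∞ ((ε ^ (j + 2))⁻¹ • fun t => (t - x) ^ (j + 2) • p) x :=
        contDiffAt_const.smul h2
      have h7 : ContDiffAt 𝕜 ∞ ((ε ^ (j + 3))⁻¹ • fun t => (t - x) ^ (j + 3) • e ε) x :=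
        contDiffAt_const.smul h3
      have h8 : ContDiffAt 𝕜 ∞ (((ε ^ (j + 2))⁻¹ • fun t => (t - x) ^ (j + 2) • p) +
        ((ε ^ (j + 3))⁻¹ • fun t => (t - x) ^ (j + 3) • e ε)) x := h6.add h7
      have h9 : ContDiffAt 𝕜 ∞ ((ε⁻¹ • fun t => (t - x) • p) +
        (((ε ^ (j + 2))⁻¹ • fun t => (t - x) ^ (j + 2) • p) +
          ((ε ^ (j + 3))⁻¹ • fun t => (t - x) ^ (j + 3) • e ε))) x := h5.add h8
      rw [h4, sysOp_add _ _ h0 h9, sysOp_add _ _ h5 h8, sysOp_add _ _ h6 h7,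
        sysOp_const_smul _ _ h1, sysOp_const_smul _ _ h2, sysOp_const_smul _ _ h3,
        sysOp_pow_smul _ _ contDiffAt_const, ← hc₀, ← hc₁, ← hc₂]
      simp only [e]
      match_scalars <;> field_simp <;> ring
    have hmem : (x, w x) ∈ S := by rw [hwx]; exact hxy
    have hfst : (fun t => (Z (t, w t)).1) =ᶠ[𝓝 x] χ := by
      have h1 : Continuous fun t => (t, w t) := continuous_id.prodMk hw.continuous
      filter_upwards [h1.continuousAt.eventually_mem (h.isOpen.mem_nhds hmem)] with t ht
        using hZ _ ht
    have hcan := h.canonical x w hw.contDiffAt hmem (by rw [hfst.deriv_eq]; exact hχ0) hsys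
    have h1 : (fun t => (deriv (fun t => (Z (t, w t)).1) t)⁻¹) =ᶠ[𝓝 x] fun t => (deriv χ t)⁻¹ :=
      hfst.deriv.mono fun t ht => by simp only [ht]
    rw [(PsiV_iterate_congr h1 .rfl .rfl _).eq_of_nhds] at hcan
    have haff := PsiV_iterate_comp_affine (fun t => (deriv χ t)⁻¹) (fun t => (Z (t, w t)).2)
      x ε (j + 3) 0
    rw [mul_zero, add_zero, hcan, smul_zero] at haff
    simpa only [hws] using haff

theorem eq_add_deriv_of_iteratedDeriv_two_eq_zero {F : Type*} [NormedAddCommGroup F]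
    [NormedSpace 𝕜 F] {h : 𝕜 → F} {T : Set 𝕜} (hT : IsOpen T) (hTc : Convex ℝ T)
    (hh : ContDiffOn 𝕜 ∞ h T) (h2 : ∀ t ∈ T, iteratedDeriv 2 h t = 0) (h0 : (0 : 𝕜) ∈ T)
    (h1 : (1 : 𝕜) ∈ T) : h 1 = h 0 + deriv h 0 := by
  have hs : ∀ t ∈ T, ContDiffAt 𝕜 ∞ h t := fun t ht => hh.contDiffAt (hT.mem_nhds ht)
  have hd : ∀ t ∈ T, deriv h t = deriv h 0 := fun t ht =>
    hT.is_const_of_deriv_eq_zero hTc.isPreconnected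
      (fun t ht => ((hs t ht).deriv_infty.differentiableAt infty_ne_zero).differentiableWithinAt)
      (fun t ht => by
        rw [← iteratedDeriv_one (f := deriv h), ← iteratedDeriv_succ']
        exact h2 t ht) ht h0
  have hk : ∀ t ∈ T, HasDerivAt (fun t => h t - t • deriv h 0) 0 t := fun t ht => by
    have h3 := ((hs t ht).differentiableAt infty_ne_zero).hasDerivAt.sub
      ((hasDerivAt_id t).smul_const (deriv h 0))
    rw [hd t ht, one_smul, sub_self] at h3
    exact h3
  have h3 := hT.is_const_of_deriv_eq_zero hTc.isPreconnected
    (fun t ht => (hk t ht).differentiableAt.differentiableWithinAt)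
    (fun t ht => (hk t ht).deriv) h1 h0
  simp only [one_smul, zero_smul, sub_zero] at h3
  rw [← h3, sub_add_cancel]

theorem fst_fderiv_ne_zero {L : 𝕜 × (Fin m → 𝕜) →L[𝕜] 𝕜 × (Fin m → 𝕜)} (hL : Function.Injective L)
    (h : ∀ v, (L (0, v)).1 = 0) : (L (1, 0)).1 ≠ 0 := by
  intro h0
  obtain ⟨⟨a, v⟩, h1⟩ := LinearMap.injective_iff_surjective (f := L.toLinearMap).1 hL (1, 0)
  have h2 : ((a, v) : 𝕜 × (Fin m → 𝕜)) = a • (1, 0) + (0, v) := by simp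
  have h3 := congrArg Prod.fst h1
  rw [h2, map_add, map_smul] at h3
  simp [h0, h] at h3

/-- On a product of balls X depends on x only, and the second derivative of Y along every line in y
vanishes, so Y is its first-order Taylor polynomial at w₀ and the affine case applies. -/
theorem isUncoupledIterative_of_three_le {n : ℕ} (hn : 3 ≤ n)
    {A : ℕ → 𝕜 → Matrix (Fin m) (Fin m) 𝕜} {V : Set 𝕜} {S : Set (𝕜 × (Fin m → 𝕜))}
    {Z : 𝕜 × (Fin m → 𝕜) → 𝕜 × (Fin m → 𝕜)} {x₀ : 𝕜} {w₀ : Fin m → 𝕜}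
    (hA1 : ∀ x ∈ V, A 1 x = 0) (hmem : (x₀, w₀) ∈ S) (hSV : ∀ z ∈ S, z.1 ∈ V)
    (hZ : Linearizes n A S Z) : IsUncoupledIterative n A x₀ := by
  obtain ⟨ρ, hρ, hball⟩ := Metric.isOpen_iff.1 hZ.isOpen _ hmem
  rw [← ball_prod_same] at hball
  have hw₀ : w₀ ∈ Metric.ball w₀ ρ := Metric.mem_ball_self hρ
  have hZb := hZ.mono (Metric.isOpen_ball.prod Metric.isOpen_ball) hball
  have hs : ∀ x ∈ Metric.ball x₀ ρ, ∀ y ∈ Metric.ball w₀ ρ, ContDiffAt 𝕜 ∞ Z (x, y) :=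
    fun x hx y hy => hZb.contDiffOn.contDiffAt (hZb.isOpen.mem_nhds ⟨hx, hy⟩)
  have hχ : ContDiffOn 𝕜 ∞ (fun x => (Z (x, w₀)).1) (Metric.ball x₀ ρ) := fun x hx =>
    (ContDiffAt.fst (f := fun x => Z (x, w₀)) (ContDiffAt.comp (g := Z) x (hs x hx _ hw₀)
      (by fun_prop))).contDiffWithinAt
  have hfst : ∀ z ∈ Metric.ball x₀ ρ ×ˢ Metric.ball w₀ ρ, (Z z).1 = (Z (z.1, w₀)).1 := by
    rintro ⟨x, y⟩ ⟨hx, hy⟩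
    have hd : ∀ y ∈ Metric.ball w₀ ρ, HasFDerivAt (fun y => (Z (x, y)).1)
        ((ContinuousLinearMap.fst 𝕜 𝕜 (Fin m → 𝕜)) ∘L (fderiv 𝕜 Z (x, y)) ∘L
          (ContinuousLinearMap.inr 𝕜 𝕜 (Fin m → 𝕜))) y := fun y hy =>
      HasFDerivAt.comp y (ContinuousLinearMap.fst 𝕜 𝕜 (Fin m → 𝕜)).hasFDerivAt
        (HasFDerivAt.comp y ((hs x hx y hy).differentiableAt infty_ne_zero).hasFDerivAt
          (hasFDerivAt_prodMk_right x y))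
    refine Metric.isOpen_ball.is_const_of_fderiv_eq_zero (𝕜 := 𝕜)
      (f := fun y => (Z (x, y)).1) (convex_ball w₀ ρ).isPreconnected
      (fun y hy => (hd y hy).differentiableAt.differentiableWithinAt) (fun y hy => ?_) hy hw₀
    rw [(hd y hy).fderiv]
    ext1 v
    exact hZb.fst_fderiv_eq_zero hn (Set.mk_mem_prod hx hy) v
  have hχ0 : ∀ x ∈ Metric.ball x₀ ρ, deriv (fun x => (Z (x, w₀)).1) x ≠ 0 := by
    intro x hx
    have h1 : HasDerivAt (fun x => Z (x, w₀)) (fderiv 𝕜 Z (x, w₀) (1, 0)) x :=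
      HasFDerivAt.comp_hasDerivAt (l := Z) (f := fun x => (x, w₀)) x
        ((hs x hx _ hw₀).differentiableAt infty_ne_zero).hasFDerivAt
        ((hasDerivAt_id x).prodMk (hasDerivAt_const x w₀))
    rw [deriv_fst h1]
    exact fst_fderiv_ne_zero (hZb.injective _ ⟨hx, hw₀⟩)
      (hZb.fst_fderiv_eq_zero hn ⟨hx, hw₀⟩)
  let G : 𝕜 → (Fin m → 𝕜) →L[𝕜] (Fin m → 𝕜) := fun x =>
    (ContinuousLinearMap.snd 𝕜 𝕜 (Fin m → 𝕜)) ∘L (fderiv 𝕜 Z (x, w₀)) ∘L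
          (ContinuousLinearMap.inr 𝕜 𝕜 (Fin m → 𝕜))
  have hG : ContDiffOn 𝕜 ∞ G (Metric.ball x₀ ρ) := fun x hx => by
    have h1 : ContDiffAt 𝕜 ∞ (fun x => fderiv 𝕜 Z (x, w₀)) x :=
      ContDiffAt.comp (g := fderiv 𝕜 Z) x ((hs x hx _ hw₀).fderiv_right (by simp)) (by fun_prop)
    exact (contDiffAt_const.clm_comp (h1.clm_comp contDiffAt_const)).contDiffWithinAt
  have hsnd : ContDiffOn 𝕜 ∞ (fun x => (Z (x, w₀)).2) (Metric.ball x₀ ρ) := fun x hx =>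
    (ContDiffAt.snd (f := fun x => Z (x, w₀)) (ContDiffAt.comp (g := Z) x (hs x hx _ hw₀)
      (by fun_prop))).contDiffWithinAt
  refine isUncoupledIterative_of_affine (by omega) hρ hρ
    (fun x hx => hA1 x (hSV _ (hball (Set.mk_mem_prod hx hw₀)))) hZb hχ hG
    (c := fun x => (Z (x, w₀)).2 - G x w₀) (hsnd.sub (hG.clm_apply contDiffOn_const))
    fun x hx y hy => Prod.ext (hfst _ ⟨hx, hy⟩) ?_
  -- The parameters for which the line through w₀ and y stays in the ball: a convex open set
  -- containing 0 and 1.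
  let T : Set 𝕜 := (fun t : 𝕜 => t • (y - w₀)) ⁻¹' Metric.ball 0 ρ
  have hTw : ∀ {t}, t ∈ T ↔ w₀ + t • (y - w₀) ∈ Metric.ball w₀ ρ := fun {t} => by
    simp [T]
  have hTc : Convex ℝ T := (convex_ball (0 : Fin m → 𝕜) ρ).linear_preimage
    ((LinearMap.toSpanSingleton 𝕜 (Fin m → 𝕜) (y - w₀)).restrictScalars ℝ)
  have hT : IsOpen T := Metric.isOpen_ball.preimage (by fun_prop)
  have h0 : (0 : 𝕜) ∈ T := by simp [T, hρ]
  have h1 : (1 : 𝕜) ∈ T := by rw [hTw]; simpa using hy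
  have hh : ∀ t ∈ T, ContDiffAt 𝕜 ∞ (fun t : 𝕜 => (Z (x, w₀ + t • (y - w₀))).2) t := fun t ht =>
    (ContDiffAt.snd (f := fun t : 𝕜 => Z (x, w₀ + t • (y - w₀)))
      (ContDiffAt.comp (g := Z) t (hs x hx _ (hTw.1 ht)) (by fun_prop)))
  have h2 : ∀ t ∈ T, iteratedDeriv 2 (fun t : 𝕜 => (Z (x, w₀ + t • (y - w₀))).2) t = 0 := by
    intro t ht
    obtain ⟨j, rfl⟩ := Nat.exists_eq_add_of_le' hn
    have h3 : ContDiffAt 𝕜 ∞ (fun τ : 𝕜 => (Z (x, w₀ + (t + τ) • (y - w₀))).2) 0 :=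
      ContDiffAt.comp (g := fun t : 𝕜 => (Z (x, w₀ + t • (y - w₀))).2) 0
        (by simpa using hh t ht) (by fun_prop)
    -- The free scale ε is obtained by taking the direction p = ε(y - w₀).
    have h4 := iteratedDeriv_two_eq_zero_of_comp h3 j fun ε => by
      have h5 := hZb.iteratedDeriv_snd_eq_zero ⟨hx, hTw.1 ht⟩ (hχ.contDiffAt
        (Metric.isOpen_ball.mem_nhds hx)) (hχ0 x hx) hfst (ε • (y - w₀))
      rw [← h5]
      congr 1
      ext1 σ
      congr 3
      module
    rw [iteratedDeriv_comp_const_add 2 (fun t : 𝕜 => (Z (x, w₀ + t • (y - w₀))).2) t] at h4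
    simpa using h4
  have h3 := eq_add_deriv_of_iteratedDeriv_two_eq_zero hT hTc
    (fun t ht => (hh t ht).contDiffWithinAt) h2 h0 h1
  have h4 : HasDerivAt (fun t : 𝕜 => Z (x, w₀ + t • (y - w₀)))
      (fderiv 𝕜 Z (x, w₀) (0, y - w₀)) 0 := by
    refine HasFDerivAt.comp_hasDerivAt (l := Z) (f := fun t : 𝕜 => (x, w₀ + t • (y - w₀))) 0 ?_
      ((hasDerivAt_const 0 x).prodMk (by
        simpa using! ((hasDerivAt_id (0 : 𝕜)).smul_const (y - w₀)).const_add w₀))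
    simpa using ((hs x hx _ hw₀).differentiableAt infty_ne_zero).hasFDerivAt
  rw [deriv_snd h4] at h3
  have h5 : G x y - G x w₀ = (fderiv 𝕜 Z (x, w₀) (0, y - w₀)).2 := by
    rw [← map_sub]; rfl
  simp only [one_smul, add_sub_cancel, zero_smul, add_zero] at h3
  rw [h3, ← h5]
  simp only
  abel

end AffineInValue

/-! ### Quadratic maps preserving all lines. -/

section Projective

variable {𝕜 : Type*} [RCLike 𝕜] {W : Type*} [NormedAddCommGroup W] [NormedSpace 𝕜 W]

/-- A quadratic map preserving every line is of the form `z ↦ c(z) z`, with polar form determined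
by `c`. -/
theorem exists_polar_of_forall_smul {T : W →L[𝕜] W →L[𝕜] W} (hsymm : ∀ u v, T u v = T v u)
    (h : ∀ z, z ≠ 0 → ∃ c : 𝕜, T z z = c • z) :
    ∃ c : W → 𝕜, ∀ u v, (2 : 𝕜) • T u v = c u • v + c v • u := by
  have h' : ∀ z, ∃ c : 𝕜, T z z = c • z ∧ (z = 0 → c = 0) := fun z => by
    by_cases hz : z = 0
    · exact ⟨0, by simp [hz]⟩
    · exact (h z hz).imp fun c hc => ⟨hc, fun h0 => absurd h0 hz⟩
  choose c hc hc0 using h'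
  refine ⟨c, fun u v => ?_⟩
  by_cases hli : LinearIndependent 𝕜 ![u, v]
  · have h1 := hc (u + v)
    have h2 := hc (u - v)
    simp only [map_add, map_sub, add_apply, sub_apply, hc u, hc v, hsymm v u] at h1 h2
    rw [LinearIndependent.pair_iff] at hli
    -- Adding the identities for u + v and u - v eliminates T u v; independence of u and v then
    -- gives c(u + v) = c(u) + c(v).
    have h3 := hli (c (u + v) + c (u - v) - 2 * c u) (c (u + v) - c (u - v) - 2 * c v) (by
      linear_combination (norm := module) - h1 - h2)
    have h4 : c (u + v) = c u + c v := by linear_combination (h3.1 + h3.2) / 2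
    rw [h4] at h1
    linear_combination (norm := module) h1
  · by_cases hu : u = 0
    · simp [hu, hc0 0 rfl]
    · rw [LinearIndependent.pair_iff' hu] at hli
      push Not at hli
      obtain ⟨a, rfl⟩ := hli
      have h1 : c (a • u) = a * c u := by
        by_cases ha : a = 0
        · simp [ha, hc0 0 rfl]
        · have h2 := hc (a • u)
          rw [map_smul, map_smul, smul_apply, hc u, smul_smul, smul_smul, smul_smul] at h2
          have h3 := smul_left_injective 𝕜 hu h2
          refine mul_right_cancel₀ ha (h3.symm.trans ?_)
          ring
      rw [map_smul, hc u, h1]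
      module

/-- Independence of z and T z z is an open condition. If it held at z it would hold at z + t e for
small t ≠ 0, where f and g do not vanish. -/
theorem exists_smul_of_forall_fst {f g : W →L[𝕜] 𝕜} {e : W} (hfe : f e ≠ 0) (hge : g e ≠ 0)
    {T : W →L[𝕜] W →L[𝕜] W} (h : ∀ z, f z ≠ 0 → g z ≠ 0 → ∃ c : 𝕜, T z z = c • z) (z : W)
    (hz : z ≠ 0) : ∃ c : 𝕜, T z z = c • z := by
  have key : ¬ LinearIndependent 𝕜 ![z, T z z] := by
    intro hli
    have h1 : ∀ {f : W →L[𝕜] 𝕜}, f e ≠ 0 → ∀ᶠ t : 𝕜 in 𝓝[≠] 0, f (z + t • e) ≠ 0 := by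
      intro f hf
      by_cases h0 : f z = 0
      · filter_upwards [self_mem_nhdsWithin] with t ht
        simpa [h0, hf] using ht
      · have h2 : Continuous fun t : 𝕜 => f (z + t • e) := by fun_prop
        exact (h2.continuousAt.eventually_ne (by simpa using h0)).filter_mono nhdsWithin_le_nhds
    have h2 : ∀ᶠ t : 𝕜 in 𝓝[≠] 0, LinearIndependent 𝕜 ![z + t • e, T (z + t • e) (z + t • e)] := by
      have h3 : Continuous fun t : 𝕜 => ![z + t • e, T (z + t • e) (z + t • e)] :=
        continuous_pi fun i => by fin_cases i <;> simp <;> fun_prop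
      exact (h3.continuousAt.eventually_mem ((isOpen_setOfPred_linearIndependent (𝕜 := 𝕜)).mem_nhds
        (by simpa using hli))).filter_mono nhdsWithin_le_nhds
    obtain ⟨t, ⟨hf, hg⟩, ht⟩ := (((h1 hfe).and (h1 hge)).and h2).exists
    obtain ⟨c, hc⟩ := h _ hf hg
    rw [LinearIndependent.pair_iff' (fun h0 => hf (by rw [h0, map_zero]))] at ht
    exact ht c hc.symm
  rw [LinearIndependent.pair_iff' hz] at key
  push Not at key
  exact key.imp fun c hc => hc.symm

end Projective

/-! ### The flat connection pulled back by Z. -/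

section Geometry

variable {𝕜 : Type*} [RCLike 𝕜] {W : Type*} [NormedAddCommGroup W] [NormedSpace 𝕜 W]

/-- The Christoffel symbol `(DZ)⁻¹ D²Z(u, v)` of the flat connection transported by `Z`. -/
noncomputable def christoffel (Z : W → W) (z : W) : W →L[𝕜] W →L[𝕜] W :=
  (ContinuousLinearMap.compL 𝕜 W W W (Ring.inverse (fderiv 𝕜 Z z))) ∘L fderiv 𝕜 (fderiv 𝕜 Z) z

theorem christoffel_apply (Z : W → W) (z u v : W) :
    christoffel (𝕜 := 𝕜) Z z u v = Ring.inverse (fderiv 𝕜 Z z) (fderiv 𝕜 (fderiv 𝕜 Z) z u v) := rfl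

theorem fderiv_fderiv_comm {F : Type*} [NormedAddCommGroup F] [NormedSpace 𝕜 F] {f : W → F} {z : W}
    (hf : ContDiffAt 𝕜 ∞ f z) (u v : W) :
    fderiv 𝕜 (fderiv 𝕜 f) z u v = fderiv 𝕜 (fderiv 𝕜 f) z v u :=
  (hf.isSymmSndFDerivAt (by
    rw [minSmoothness_of_isRCLikeNormedField]; exact natCast_le_infty 2)).eq u v

/-- Differentiating (DZ)⁻¹ D²Z shows that ∂ₖΓ(u, v) + Γ(k, Γ(u, v)) equals (DZ)⁻¹ D³Z(k, u, v). Its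
symmetry in k and u is the vanishing of the curvature. -/
theorem hasDerivAt_christoffel [CompleteSpace W] {Z : W → W} {z : W} (hZ : ContDiffAt 𝕜 ∞ Z z)
    (hu : IsUnit (fderiv 𝕜 Z z)) (k u v : W) :
    HasDerivAt (fun τ : 𝕜 => christoffel (𝕜 := 𝕜) Z (z + τ • k) u v)
      (Ring.inverse (fderiv 𝕜 Z z) (fderiv 𝕜 (fderiv 𝕜 (fderiv 𝕜 Z)) z k u v) -
        christoffel (𝕜 := 𝕜) Z z k (christoffel (𝕜 := 𝕜) Z z u v)) 0 := by
  have hl : HasDerivAt (fun τ : 𝕜 => z + τ • k) k 0 := by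
    simpa using! ((hasDerivAt_id (0 : 𝕜)).smul_const k).const_add z
  have h1 : ContDiffAt 𝕜 ∞ (fderiv 𝕜 Z) z := hZ.fderiv_right (by simp)
  have h2 : ContDiffAt 𝕜 ∞ (fderiv 𝕜 (fderiv 𝕜 Z)) z := h1.fderiv_right (by simp)
  have hN : HasDerivAt (fun τ : 𝕜 => fderiv 𝕜 Z (z + τ • k)) (fderiv 𝕜 (fderiv 𝕜 Z) z k) 0 :=
    HasFDerivAt.comp_hasDerivAt (l := fderiv 𝕜 Z) (f := fun τ : 𝕜 => z + τ • k) 0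
      (by simpa using (h1.differentiableAt infty_ne_zero).hasFDerivAt) hl
  have hH : HasDerivAt (fun τ : 𝕜 => fderiv 𝕜 (fderiv 𝕜 Z) (z + τ • k))
      (fderiv 𝕜 (fderiv 𝕜 (fderiv 𝕜 Z)) z k) 0 :=
    HasFDerivAt.comp_hasDerivAt (l := fderiv 𝕜 (fderiv 𝕜 Z)) (f := fun τ : 𝕜 => z + τ • k) 0
      (by simpa using (h2.differentiableAt infty_ne_zero).hasFDerivAt) hl
  have hI : HasDerivAt (fun τ : 𝕜 => Ring.inverse (fderiv 𝕜 Z (z + τ • k)))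
      (-(Ring.inverse (fderiv 𝕜 Z z) * fderiv 𝕜 (fderiv 𝕜 Z) z k *
        Ring.inverse (fderiv 𝕜 Z z))) 0 := by
    obtain ⟨U, hU⟩ := hu
    have h3 := HasFDerivAt.comp_hasDerivAt (l := Ring.inverse)
      (f := fun τ : 𝕜 => fderiv 𝕜 Z (z + τ • k)) 0
      (by simpa [← hU] using hasFDerivAt_ringInverse (𝕜 := 𝕜) U) hN
    rw [← hU, Ring.inverse_unit]
    simpa using! h3
  have h3 := hI.clm_apply ((hH.clm_apply (hasDerivAt_const 0 u)).clm_apply (hasDerivAt_const 0 v))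
  convert! h3 using 1
  simp [christoffel_apply]
  abel

theorem fderiv_christoffel_symm {Z : W → W} {z : W} (hZ : ContDiffAt 𝕜 ∞ Z z) (k u v : W) :
    fderiv 𝕜 (fderiv 𝕜 (fderiv 𝕜 Z)) z k u v = fderiv 𝕜 (fderiv 𝕜 (fderiv 𝕜 Z)) z u k v := by
  rw [fderiv_fderiv_comm (f := fderiv 𝕜 Z) (hZ.fderiv_right (by simp)) k u]

end Geometry

/-! ### Order two: flatness forces a scalar coefficient. -/

section SecondOrder

variable {𝕜 : Type*} [RCLike 𝕜] {m : ℕ} {A : ℕ → 𝕜 → Matrix (Fin m) (Fin m) 𝕜}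
  {S : Set (𝕜 × (Fin m → 𝕜))} {Z : 𝕜 × (Fin m → 𝕜) → 𝕜 × (Fin m → 𝕜)}

theorem Linearizes.isUnit_fderiv {n : ℕ} (h : Linearizes n A S Z) {z : 𝕜 × (Fin m → 𝕜)}
    (hz : z ∈ S) : IsUnit (fderiv 𝕜 Z z) :=
  ContinuousLinearMap.isUnit_iff_bijective.2 ⟨h.injective z hz,
    LinearMap.injective_iff_surjective (f := (fderiv 𝕜 Z z).toLinearMap).1 (h.injective z hz)⟩

/-- A solution curve with velocity (1, p) has acceleration (0, -A₂ y). Its image satisfies Y'' = 0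
in X, so D²Z((1, p), (1, p)) - DZ(0, A₂ y) is parallel to DZ(1, p); applying (DZ)⁻¹ gives the claim.
-/
theorem Linearizes.exists_christoffel_eq (h : Linearizes 2 A S Z) {x : 𝕜} {y p : Fin m → 𝕜}
    (hA1 : A 1 x = 0) (hxy : (x, y) ∈ S) (hp : (fderiv 𝕜 Z (x, y) (1, p)).1 ≠ 0) :
    ∃ c : 𝕜, christoffel (𝕜 := 𝕜) Z (x, y) (1, p) (1, p) - (0, A 2 x *ᵥ y) = c • (1, p) := by
  set a := A 2 x *ᵥ y with ha
  let w : 𝕜 → Fin m → 𝕜 := fun t => y + ((t - x) • p - (t - x) ^ 2 • (2 : 𝕜)⁻¹ • a)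
  have hw : ContDiff 𝕜 ∞ w := by fun_prop
  have hwx : w x = y := by simp [w]
  have hmem : (x, w x) ∈ S := by rw [hwx]; exact hxy
  have hw1 : ∀ t, HasDerivAt w (p - (t - x) • a) t := by
    intro t
    have h0 : HasDerivAt (fun t : 𝕜 => t - x) 1 t := (hasDerivAt_id _).sub_const x
    have h1 := ((h0.smul_const p).sub ((h0.pow 2).smul_const ((2 : 𝕜)⁻¹ • a))).const_add y
    convert! h1 using 1
    simp
    module
  have hw2 : deriv w = fun t => p - (t - x) • a := funext fun t => (hw1 t).deriv
  have hw3 : HasDerivAt (fun t => p - (t - x) • a) (-a) x := by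
    simpa using! (((hasDerivAt_id x).sub_const x).smul_const a).const_sub p
  have hsys : sysOp 2 A w x = 0 := by
    simp [sysOp, iteratedDeriv_succ, show Finset.Icc 1 2 = {1, 2} from rfl, hA1, hwx, ← ha, hw2,
      hw3.deriv]
  have hcurve : ∀ t, HasDerivAt (fun t => (t, w t)) ((1 : 𝕜), p - (t - x) • a) t := fun t =>
    (hasDerivAt_id t).prodMk (hw1 t)
  have hZs : ContDiffAt 𝕜 ∞ Z (x, y) := h.contDiffOn.contDiffAt (h.isOpen.mem_nhds hxy)
  have hZ1 : ∀ᶠ t in 𝓝 x, HasDerivAt (fun t => Z (t, w t))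
      (fderiv 𝕜 Z (t, w t) (1, p - (t - x) • a)) t := by
    have h1 : Continuous fun t => (t, w t) := continuous_id.prodMk hw.continuous
    filter_upwards [h1.continuousAt.eventually_mem (h.isOpen.mem_nhds hmem)] with t ht
    exact HasFDerivAt.comp_hasDerivAt (l := Z) (f := fun t => (t, w t)) t
      ((h.contDiffOn.contDiffAt (h.isOpen.mem_nhds ht)).differentiableAt infty_ne_zero).hasFDerivAt
      (hcurve t)
  set f : 𝕜 → 𝕜 × (Fin m → 𝕜) := fun t => fderiv 𝕜 Z (t, w t) (1, p - (t - x) • a) with hf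
  set f' := fderiv 𝕜 (fderiv 𝕜 Z) (x, y) (1, p) (1, p) - fderiv 𝕜 Z (x, y) (0, a) with hf'
  have hfx : f x = fderiv 𝕜 Z (x, y) (1, p) := by simp [hf, hwx]
  have hZ2 : HasDerivAt f f' x := by
    have h1 : HasDerivAt (fun t => fderiv 𝕜 Z (t, w t))
        (fderiv 𝕜 (fderiv 𝕜 Z) (x, y) (1, p)) x := by
      refine HasFDerivAt.comp_hasDerivAt (l := fderiv 𝕜 Z) (f := fun t => (t, w t)) x ?_
        (by simpa using hcurve x)
      rw [hwx]
      exact ((hZs.fderiv_right (m := ∞) (by simp)).differentiableAt infty_ne_zero).hasFDerivAt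
    have h2 := h1.clm_apply ((hasDerivAt_const x (1 : 𝕜)).prodMk hw3)
    convert! h2 using 1
    rw [hf', hwx, sub_self, zero_smul, sub_zero, show ((0 : 𝕜), -a) = -(0, a) by simp, map_neg,
      sub_eq_add_neg]
  have hfst : (fun t => deriv (fun t => (Z (t, w t)).1) t) =ᶠ[𝓝 x] fun t => (f t).1 :=
    hZ1.mono fun t ht => deriv_fst ht
  have hsnd : (fun t => deriv (fun t => (Z (t, w t)).2) t) =ᶠ[𝓝 x] fun t => (f t).2 :=
    hZ1.mono fun t ht => deriv_snd ht
  have hp' : (f x).1 ≠ 0 := by rw [hfx]; exact hp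
  have hcan := h.canonical x w hw.contDiffAt hmem (by rw [hfst.eq_of_nhds]; exact hp') hsys
  have h1 : (PsiV (fun t => (deriv (fun t => (Z (t, w t)).1) t)⁻¹) 0) (fun t => (Z (t, w t)).2)
      =ᶠ[𝓝 x] fun t => (f t).1⁻¹ • (f t).2 := by
    filter_upwards [hfst, hsnd] with t h1 h2
    simp [PsiV, h1, h2]
  have hf1 : HasDerivAt (fun t => (f t).1) f'.1 x :=
    (ContinuousLinearMap.fst 𝕜 𝕜 (Fin m → 𝕜)).hasFDerivAt.comp_hasDerivAt x hZ2
  have hf2 : HasDerivAt (fun t => (f t).2) f'.2 x :=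
    (ContinuousLinearMap.snd 𝕜 𝕜 (Fin m → 𝕜)).hasFDerivAt.comp_hasDerivAt x hZ2
  have h2 : deriv (fun t => (f t).1⁻¹ • (f t).2) x = _ := ((hf1.inv hp').smul hf2).deriv
  rw [Function.iterate_succ_apply, Function.iterate_one,
    (PsiV_congr .rfl .rfl h1).eq_of_nhds] at hcan
  simp only [PsiV, Pi.zero_apply, zero_smul, add_zero, hfst.eq_of_nhds] at hcan
  rw [h2] at hcan
  have h3 := (smul_eq_zero.1 hcan).resolve_left (inv_ne_zero hp')
  have h4 : f' = (f'.1 / (f x).1) • fderiv 𝕜 Z (x, y) (1, p) := by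
    rw [← hfx]
    refine Prod.ext ?_ ?_
    · simp [hp']
    · have h5 : (f x).1 • ((f x).1⁻¹ • f'.2 + (-f'.1 / (f x).1 ^ 2) • (f x).2) = 0 := by
        rw [show (f x).1⁻¹ • f'.2 + (-f'.1 / (f x).1 ^ 2) • (f x).2 = 0 from h3, smul_zero]
      rw [smul_add, smul_smul, smul_smul, mul_inv_cancel₀ hp', one_smul] at h5
      rw [eq_neg_of_add_eq_zero_left h5, ← neg_smul, Prod.smul_snd]
      congr 1
      field_simp
  generalize f'.1 / (f x).1 = c at h4
  refine ⟨c, ?_⟩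
  have hinv : ∀ v, Ring.inverse (fderiv 𝕜 Z (x, y)) (fderiv 𝕜 Z (x, y) v) = v := fun v => by
    rw [← mul_apply_eq_comp, Ring.inverse_mul_cancel _ (h.isUnit_fderiv hxy)]; rfl
  have h5 := congrArg (fun v => Ring.inverse (fderiv 𝕜 Z (x, y)) v) h4
  simp only [hf', map_sub, hinv, map_smul] at h5
  exact h5

theorem Linearizes.christoffel_comm {n : ℕ} (h : Linearizes n A S Z) {z : 𝕜 × (Fin m → 𝕜)}
    (hz : z ∈ S) (u v : 𝕜 × (Fin m → 𝕜)) :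
    christoffel (𝕜 := 𝕜) Z z u v = christoffel (𝕜 := 𝕜) Z z v u := by
  rw [christoffel_apply, christoffel_apply,
    fderiv_fderiv_comm (h.contDiffOn.contDiffAt (h.isOpen.mem_nhds hz))]

/-- The connection transported by a linearizing map is projectively equivalent to the one whose
geodesics are the solutions. -/
theorem Linearizes.exists_polar (h : Linearizes 2 A S Z) {x : 𝕜} {y : Fin m → 𝕜}
    (hA1 : A 1 x = 0) (hxy : (x, y) ∈ S) :
    ∃ c : 𝕜 × (Fin m → 𝕜) → 𝕜, ∀ u v, (2 : 𝕜) • christoffel (𝕜 := 𝕜) Z (x, y) u v =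
      (2 * (u.1 * v.1)) • ((0 : 𝕜), A 2 x *ᵥ y) + (c u • v + c v • u) := by
  set N := fderiv 𝕜 Z (x, y) with hN
  let fst := ContinuousLinearMap.fst 𝕜 𝕜 (Fin m → 𝕜)
  let T : 𝕜 × (Fin m → 𝕜) →L[𝕜] 𝕜 × (Fin m → 𝕜) →L[𝕜] 𝕜 × (Fin m → 𝕜) :=
    christoffel Z (x, y) - fst.smulRight (fst.smulRight ((0 : 𝕜), A 2 x *ᵥ y))
  have hT : ∀ u v, T u v = christoffel (𝕜 := 𝕜) Z (x, y) u v -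
      (u.1 * v.1) • ((0 : 𝕜), A 2 x *ᵥ y) := fun u v => by
    rw [mul_smul]; rfl
  obtain ⟨p, hp⟩ : ∃ p, (N (1, p)).1 ≠ 0 := by
    by_cases h0 : ∀ v, (N (0, v)).1 = 0
    · exact ⟨0, fst_fderiv_ne_zero (h.injective _ hxy) h0⟩
    · push Not at h0
      exact exists_fst_ne_zero h0.choose_spec
  -- The geodesic equation covers directions (1, p) that are not vertical after Z. Homogeneity and
  -- density extend it to all directions.
  have hline : ∀ z, z ≠ 0 → ∃ c : 𝕜, T z z = c • z := by
    refine exists_smul_of_forall_fst (f := fst) (g := fst ∘L N) (e := ((1 : 𝕜), p))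
      one_ne_zero hp ?_
    intro z hz1 hz2
    have h1 : z = z.1 • ((1 : 𝕜), z.1⁻¹ • z.2) := by
      refine Prod.ext (by simp) ?_
      rw [Prod.smul_snd, smul_smul, mul_inv_cancel₀ (show z.1 ≠ 0 from hz1), one_smul]
    have h2 : (N (1, z.1⁻¹ • z.2)).1 ≠ 0 := fun h0 => hz2 (by
      have h3 : N z = z.1 • N (1, z.1⁻¹ • z.2) := by rw [← map_smul, ← h1]
      change (N z).1 = 0
      rw [h3, Prod.smul_fst, h0, smul_zero])
    obtain ⟨c, hc⟩ := h.exists_christoffel_eq hA1 hxy h2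
    have h3 : T (1, z.1⁻¹ • z.2) (1, z.1⁻¹ • z.2) = c • (1, z.1⁻¹ • z.2) := by
      rw [hT, ← hc, mul_one, one_smul]
    refine ⟨z.1 * c, ?_⟩
    have h4 : T z z = z.1 • z.1 • T (1, z.1⁻¹ • z.2) (1, z.1⁻¹ • z.2) := by
      rw [← map_smul, ← smul_apply, ← map_smul, ← h1]
    rw [h4, h3, mul_smul]
    congr 1
    rw [smul_comm, ← h1]
  obtain ⟨c, hc⟩ := exists_polar_of_forall_smul (T := T) (fun u v => by
    rw [hT, hT, h.christoffel_comm hxy, mul_comm]) hline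
  refine ⟨c, fun u v => ?_⟩
  rw [← hc, hT, smul_sub, mul_smul, add_sub_cancel]

/-- With e = (1, 0) and v for (0, v), flatness reads ∂ᵥΓ(e, e) + Γ(v, Γ(e, e)) = ∂ₑΓ(v, e) + Γ(e,
Γ(v, e)). Apply π = ℓ ∘ snd, which kills e and v. Then πΓ(e, e) = ℓ(A₂ y) and πΓ(v, e) = 0, both
quadratic terms become c(v) πΓ(e, e)/2, and what remains is ℓ(A₂ v) = 0. -/
theorem Linearizes.apply_mulVec_eq_zero (h : Linearizes 2 A S Z) (hA1 : ∀ z ∈ S, A 1 z.1 = 0)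
    {x : 𝕜} {y : Fin m → 𝕜} (hxy : (x, y) ∈ S) {ℓ : (Fin m → 𝕜) →L[𝕜] 𝕜} {v : Fin m → 𝕜}
    (hℓ : ℓ v = 0) : ℓ (A 2 x *ᵥ v) = 0 := by
  have hZs : ContDiffAt 𝕜 ∞ Z (x, y) := h.contDiffOn.contDiffAt (h.isOpen.mem_nhds hxy)
  have hmem : ∀ k : 𝕜 × (Fin m → 𝕜), ∀ᶠ τ in 𝓝 (0 : 𝕜), (x, y) + τ • k ∈ S := fun k => by
    have h1 : Continuous fun τ : 𝕜 => (x, y) + τ • k := by fun_prop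
    exact h1.continuousAt.eventually_mem (h.isOpen.mem_nhds (by simpa using hxy))
  let π : 𝕜 × (Fin m → 𝕜) →L[𝕜] 𝕜 := ℓ ∘L ContinuousLinearMap.snd 𝕜 𝕜 (Fin m → 𝕜)
  have hπe : π (1, 0) = 0 := map_zero ℓ
  have hπu : π (0, v) = 0 := hℓ
  have hee : ∀ z ∈ S, π (christoffel (𝕜 := 𝕜) Z z (1, 0) (1, 0)) = ℓ (A 2 z.1 *ᵥ z.2) := by
    intro z hz
    obtain ⟨c, hc⟩ := h.exists_polar (hA1 z hz) hz
    have h1 := congrArg π (hc (1, 0) (1, 0))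
    rw [map_add, map_add, map_smul, map_smul, map_smul, hπe] at h1
    have h2 : π ((0 : 𝕜), A 2 z.1 *ᵥ z.2) = ℓ (A 2 z.1 *ᵥ z.2) := rfl
    rw [h2] at h1
    simpa using h1
  have hue : ∀ z ∈ S, π (christoffel (𝕜 := 𝕜) Z z (0, v) (1, 0)) = 0 := by
    intro z hz
    obtain ⟨c, hc⟩ := h.exists_polar (hA1 z hz) hz
    have h1 := congrArg π (hc (0, v) (1, 0))
    rw [map_add, map_add, map_smul, map_smul, map_smul, map_smul, hπe, hπu] at h1
    simpa using h1
  have h1 := π.hasFDerivAt.comp_hasDerivAt 0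
    (hasDerivAt_christoffel hZs (h.isUnit_fderiv hxy) (0, v) (1, 0) (1, 0))
  have h2 := π.hasFDerivAt.comp_hasDerivAt 0
    (hasDerivAt_christoffel hZs (h.isUnit_fderiv hxy) (1, 0) (0, v) (1, 0))
  have h3 : HasDerivAt (fun τ : 𝕜 => ℓ (A 2 x *ᵥ (y + τ • v))) (ℓ (A 2 x *ᵥ v)) 0 := by
    have h4 : (fun τ : 𝕜 => ℓ (A 2 x *ᵥ (y + τ • v))) =
        fun τ => ℓ (A 2 x *ᵥ y) + τ • ℓ (A 2 x *ᵥ v) := by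
      ext1 τ; rw [Matrix.mulVec_add, Matrix.mulVec_smul, map_add, map_smul]
    rw [h4]
    simpa using! ((hasDerivAt_id (0 : 𝕜)).smul_const (ℓ (A 2 x *ᵥ v))).const_add (ℓ (A 2 x *ᵥ y))
  have h4 := (h3.congr_of_eventuallyEq ((hmem (0, v)).mono fun τ hτ => by
    have := hee _ hτ
    simpa using this)).unique h1
  have h5 := ((hasDerivAt_const (0 : 𝕜) (0 : 𝕜)).congr_of_eventuallyEq
    ((hmem (1, 0)).mono fun τ hτ => hue _ hτ)).unique h2
  rw [fderiv_christoffel_symm hZs, map_sub] at h4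
  rw [map_sub] at h5
  obtain ⟨c, hc⟩ := h.exists_polar (hA1 _ hxy) hxy
  have h6 := congrArg π (hc (0, v) (christoffel (𝕜 := 𝕜) Z (x, y) (1, 0) (1, 0)))
  have h7 := congrArg π (congrArg (christoffel (𝕜 := 𝕜) Z (x, y) (1, 0)) (hc (0, v) (1, 0)))
  rw [zero_mul, mul_zero, zero_smul, zero_add, map_add, map_smul, map_smul, map_smul, hπu,
    smul_zero, add_zero] at h6
  rw [zero_mul, mul_zero, zero_smul, zero_add, map_add, map_smul, map_smul, map_smul, map_smul,
    map_add, map_smul, map_smul, h.christoffel_comm hxy (1, 0) (0, v), hue _ hxy, smul_zero,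
    add_zero, ← h6] at h7
  have h8 := smul_right_injective _ (two_ne_zero (α := 𝕜)) h7
  simp only at h8
  rw [h4, ← h8]
  exact h5.symm

/-- Coordinate functionals on basis vectors kill the off-diagonal entries; the difference of two
coordinates on the sum of two basis vectors equates diagonal entries. -/
theorem eq_smul_one_of_forall_apply {M : Matrix (Fin m) (Fin m) 𝕜}
    (hM : ∀ (ℓ : (Fin m → 𝕜) →L[𝕜] 𝕜) v, ℓ v = 0 → ℓ (M *ᵥ v) = 0) (i : Fin m) :
    M = M i i • (1 : Matrix (Fin m) (Fin m) 𝕜) := by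
  let pr : Fin m → (Fin m → 𝕜) →L[𝕜] 𝕜 := fun i =>
    ContinuousLinearMap.proj (R := 𝕜) (φ := fun _ : Fin m => 𝕜) i
  have h1 : ∀ k l, k ≠ l → M k l = 0 := fun k l hkl => by
    have := hM (pr k) (Pi.single l 1) (by simp [pr, hkl])
    simpa [pr] using this
  ext k l
  by_cases hkl : k = l
  · subst hkl
    rw [Matrix.smul_apply, Matrix.one_apply_eq, smul_eq_mul, mul_one]
    by_cases hki : k = i
    · rw [hki]
    · have := hM (pr k - pr i) (Pi.single k 1 + Pi.single i 1)
        (by simp [pr, hki, Ne.symm hki])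
      simp [pr, Matrix.mulVec_add, h1 k i hki, h1 i k (Ne.symm hki)] at this
      exact sub_eq_zero.1 this
  · simp [h1 k l hkl, Matrix.one_apply_ne hkl]

/-- Near every point, `u'' + a u = 0` has a solution without zeros. -/
theorem exists_ne_zero_of_second_order {V : Set 𝕜} {a : 𝕜 → 𝕜} {x₀ : 𝕜} (hV : IsOpen V)
    (ha : ContDiffOn 𝕜 ∞ a V) (hx₀ : x₀ ∈ V) :
    ∃ (U : Set 𝕜) (u v : 𝕜 → 𝕜), IsOpen U ∧ x₀ ∈ U ∧ U ⊆ V ∧ ContDiffOn 𝕜 ∞ u U ∧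
      ContDiffOn 𝕜 ∞ v U ∧ (∀ x ∈ U, u x ≠ 0) ∧ (∀ x ∈ U, HasDerivAt u (v x) x) ∧
      ∀ x ∈ U, HasDerivAt v (-(a x * u x)) x := by
  let M : 𝕜 → 𝕜 × 𝕜 →L[𝕜] 𝕜 × 𝕜 := fun x =>
    (ContinuousLinearMap.inl 𝕜 𝕜 𝕜) ∘L (ContinuousLinearMap.snd 𝕜 𝕜 𝕜) -
      a x • ((ContinuousLinearMap.inr 𝕜 𝕜 𝕜) ∘L (ContinuousLinearMap.fst 𝕜 𝕜 𝕜))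
  have hM : ContDiffOn 𝕜 ∞ M V := contDiffOn_const.sub (ha.smul contDiffOn_const)
  obtain ⟨ρ, hρ, hsub, y, hy0, hys, hyd⟩ := exists_linear_ode hV hM hx₀ (1, 0)
  have hc : ContinuousOn (fun x => (y x).1) (Metric.ball x₀ ρ) := hys.continuousOn.fst
  have hmem : Metric.ball x₀ ρ ∩ (fun x => (y x).1) ⁻¹' {0}ᶜ ⊆ Metric.ball x₀ ρ :=
    Set.inter_subset_left
  refine ⟨Metric.ball x₀ ρ ∩ (fun x => (y x).1) ⁻¹' {0}ᶜ, fun x => (y x).1, fun x => (y x).2,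
    hc.isOpen_inter_preimage Metric.isOpen_ball isOpen_compl_singleton,
    ⟨Metric.mem_ball_self hρ, by simp [hy0]⟩, hmem.trans hsub, hys.fst.mono hmem, hys.snd.mono hmem,
    fun x hx => hx.2, fun x hx => ?_, fun x hx => ?_⟩
  · have h1 := (ContinuousLinearMap.fst 𝕜 𝕜 𝕜).hasFDerivAt.comp_hasDerivAt x (hyd x hx.1)
    simpa [M] using! h1
  · have h1 := (ContinuousLinearMap.snd 𝕜 𝕜 𝕜).hasFDerivAt.comp_hasDerivAt x (hyd x hx.1)
    simpa [M] using! h1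

/-- For a zero-free solution u of u'' + a u = 0, take r = u² and s = -u u' = -r'/2; then Ψ² w = u⁴
(w'' + a w). -/
theorem isUncoupledIterative_of_scalar {V : Set 𝕜} {a : 𝕜 → 𝕜} {x₀ : 𝕜} (hV : IsOpen V)
    (ha : ContDiffOn 𝕜 ∞ a V) (hx₀ : x₀ ∈ V) (hA1 : ∀ x ∈ V, A 1 x = 0)
    (hA2 : ∀ x ∈ V, A 2 x = a x • (1 : Matrix (Fin m) (Fin m) 𝕜)) :
    IsUncoupledIterative 2 A x₀ := by
  obtain ⟨U, u, v, hU, hxU, hUV, hus, hvs, hu0, hu', hv'⟩ :=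
    exists_ne_zero_of_second_order hV ha hx₀
  have hr' : ∀ x ∈ U, HasDerivAt (fun x => u x ^ 2) (2 * u x * v x) x := fun x hx => by
    simpa using! (hu' x hx).pow 2
  refine ⟨U, fun x => u x ^ 2, fun x => -(u x * v x), hU, hxU, hus.pow 2, (hus.mul hvs).neg,
    fun x hx => pow_ne_zero 2 (hu0 x hx), fun x hx => ?_, fun x hx w hw i => ?_⟩
  · rw [(hr' x hx).deriv]
    push_cast
    ring
  · have hwi : ContDiffAt 𝕜 ∞ (fun t => w t i) x := contDiffAt_pi.1 hw i
    have h1 : Psi (fun x => u x ^ 2) (fun x => -(u x * v x)) (fun t => w t i) =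
        fun t => u t ^ 2 * deriv (fun t => w t i) t + -(u t * v t) * w t i := rfl
    have h2 := (((hr' x hx).mul (hwi.deriv_infty.differentiableAt infty_ne_zero).hasDerivAt).add
      (((hu' x hx).mul (hv' x hx)).neg.mul (hwi.differentiableAt infty_ne_zero).hasDerivAt)).deriv
    have h3 : deriv (deriv w) x i = deriv (deriv fun t => w t i) x := by
      have h4 : (fun t => deriv w t i) =ᶠ[𝓝 x] deriv fun t => w t i := by
        filter_upwards [hw.eventually_differentiableAt] with t ht
        rw [deriv_pi (differentiableAt_pi.1 ht)]
      rw [← h4.deriv_eq, deriv_pi fun i =>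
        (contDiffAt_pi.1 hw.deriv_infty i).differentiableAt infty_ne_zero]
    have h4 : sysOp 2 A w x i = deriv (deriv fun t => w t i) x + a x * w x i := by
      simp [sysOp, iteratedDeriv_succ, show Finset.Icc 1 2 = {1, 2} from rfl, hA1 x (hUV hx),
        hA2 x (hUV hx), h3, Matrix.smul_mulVec]
    rw [h4, Function.iterate_succ_apply, Function.iterate_one, h1, Psi]
    refine (congrArg₂ (· + ·) (congrArg (u x ^ 2 * ·) h2) rfl).trans ?_
    rw [show (-(u * v)) x = -(u x * v x) from rfl]
    ring

theorem isUncoupledIterative_two {V : Set 𝕜} {x₀ : 𝕜} {w₀ : Fin m → 𝕜}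
    (hA : SmoothCoeffsOn 2 A V) (hA1 : ∀ x ∈ V, A 1 x = 0) (hmem : (x₀, w₀) ∈ S)
    (hSV : ∀ z ∈ S, z.1 ∈ V) (hZ : Linearizes 2 A S Z) : IsUncoupledIterative 2 A x₀ := by
  set V' : Set 𝕜 := (fun x => (x, w₀)) ⁻¹' S with hV'
  have hVV' : V' ⊆ V := fun x hx => hSV _ hx
  have hV'o : IsOpen V' := hZ.isOpen.preimage (by fun_prop)
  obtain ⟨a, ha, hA2⟩ : ∃ a : 𝕜 → 𝕜, ContDiffOn 𝕜 ∞ a V' ∧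
      ∀ x ∈ V', A 2 x = a x • (1 : Matrix (Fin m) (Fin m) 𝕜) := by
    rcases isEmpty_or_nonempty (Fin m) with hm | ⟨⟨i⟩⟩
    -- For m = 0 there is no diagonal entry to read a from, and any function serves.
    · exact ⟨0, contDiffOn_const, fun x _ => Subsingleton.elim _ _⟩
    · exact ⟨fun x => A 2 x i i, (hA 2 (by simp) i i).mono hVV', fun x hx =>
        eq_smul_one_of_forall_apply (fun ℓ v hℓ =>
          hZ.apply_mulVec_eq_zero (fun z hz => hA1 _ (hSV z hz)) hx hℓ) i⟩
  exact isUncoupledIterative_of_scalar hV'o ha hmem (fun x hx => hA1 x (hVV' hx)) hA2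

end SecondOrder

/-! ### Order one, and assembly of the theorem. -/

variable {𝕜 : Type*} [RCLike 𝕜] {m : ℕ}

theorem isUncoupledIterative_one {A : ℕ → 𝕜 → Matrix (Fin m) (Fin m) 𝕜} {V : Set 𝕜} {x₀ : 𝕜}
    (hV : IsOpen V) (hx₀ : x₀ ∈ V) (hA1 : ∀ x ∈ V, A 1 x = 0) : IsUncoupledIterative 1 A x₀ := by
  refine ⟨V, fun _ => 1, fun _ => 0, hV, hx₀, contDiffOn_const, contDiffOn_const,
    fun _ _ => one_ne_zero, fun x _ => by simp, fun x hx w hw i => ?_⟩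
  have h1 : deriv w x i = deriv (fun t => w t i) x := by
    rw [deriv_pi fun i => (contDiffAt_pi.1 hw i).differentiableAt infty_ne_zero]
  simp [Psi, sysOp, hA1 x hx, h1]

end LinSys

theorem corollary1 {𝕜 : Type*} [RCLike 𝕜] (m n : ℕ) (hn : 1 ≤ n)
    (I : Set 𝕜) (hI : IsOpen I) (x₀ : 𝕜) (hx₀ : x₀ ∈ I)
    (B : ℕ → 𝕜 → Matrix (Fin m) (Fin m) 𝕜) (hB : LinSys.SmoothCoeffsOn n B I) :
    (∃ A : ℕ → 𝕜 → Matrix (Fin m) (Fin m) 𝕜, LinSys.IsNormalForm n B A I x₀) ∧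
    ∀ A : ℕ → 𝕜 → Matrix (Fin m) (Fin m) 𝕜, LinSys.IsNormalForm n B A I x₀ →
      (LinSys.InCanonicalClass n B I x₀ ↔ LinSys.IsUncoupledIterative n A x₀) := by
  refine ⟨LinSys.exists_isNormalForm hn hI hx₀ hB, fun A hA => ⟨fun h => ?_,
    LinSys.inCanonicalClass_of_isUncoupledIterative hA⟩⟩
  obtain ⟨V, S, Z, w₀, hV, hxV, hAs, hA1, hmem, hSV, hZ⟩ := LinSys.exists_linearizes hA h
  obtain rfl | rfl | h3 : n = 1 ∨ n = 2 ∨ 3 ≤ n := by omega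
  · exact LinSys.isUncoupledIterative_one hV hxV hA1
  · exact LinSys.isUncoupledIterative_two hAs hA1 hmem hSV hZ
  · exact LinSys.isUncoupledIterative_of_three_le h3 hA1 hmem hSV hZ
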